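/- Let $\mathbb K$ be $\mathbb R$ or $\mathbb C$, and write $\|g\|_{S}=\sup_{x\in S}|g(x)|$. (1) There are absolute constants $C>0$ and $c\in\mathbb N$ and a single algorithm such that the following holds. Let $r\in(0,1]$, $\delta\in(0,r]$, and let $f:[-r-\delta,r+\delta]\to\mathbb K$ satisfy $f(x)=\sum_{k=0}^\infty a_kx^k$ for all $x\in[-r-\delta,r+\delta]$, with $a_k\in\mathbb K$. Let $B>0$ satisfy $B\ge\sum_{k=0}^\infty|a_k|(r+\delta)^k$, and let $\epsilon\in(0,3B/2)$. Put $N=\frac1\delta\max\{1,\log\frac B\epsilon\}$. Then there is a polynomial $P\in\mathbb K[x]$ of degree at most $C N$, that is, of degree $O\!\left(\frac1\delta\max\{1,\log\frac B\epsilon\}\right)$, with $$\|f-P\|_{[-r,r]}\le\epsilon\qquad\text{and}\qquad\|P\|_{[-1,1]}\le\epsilon+\|f\|_{[-r-\delta/2,\,r+\delta/2]}.$$ Moreover $P$ is efficiently computable: given $r,\delta,B,\epsilon$ and access to the coefficients $a_0,a_1,\dots$, the algorithm outputs a bound $d\le CN$ for the degree of $P$ together with the coefficients of $1,x,\dots,x^d$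 in $P$, after at most $C N^{c}$ steps. Here an algorithm is a finite program for a random access machine with exact arithmetic in $\mathbb K$: each operation $+,-,\times,\div$ on elements of $\mathbb K$, each addition or subtraction of counters, each assignment of an integer constant, and each comparison (of counters or of real parts) is one step. (2) There is an absolute constant $C>0$ such that for all $\epsilon>0$, $t\in\mathbb R$, $\Gamma>0$ and $\lambda\ge\Gamma$, and for each of the two functions $f(x)=\sin(t\lambda x^2)$ and $f(x)=\cos(t\lambda x^2)$, there is a real polynomial $P$ of degree at most $$C\left(|t|\sqrt{\lambda\Gamma}+\sqrt{\lambda/\Gamma}\,\max\{0,\log(1/\epsilon)\}\right)$$ such that $|P(x)|\le1$ for all $x\in[-1,1]$ and $|P(x)-f(x)|\le2\epsilon$ for all $x\in[-\sqrt{\Gamma/\lambda},\sqrt{\Gamma/\lambda}]$. -/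

import Mathlib

open Polynomial

/-- The supremum norm `‖g‖_S = sup_{x ∈ S} ‖g x‖` on a set `S` of reals. It is only used on non-empty
compact intervals on which `g` is bounded. -/
noncomputable def supNormOn {𝕜 : Type} [RCLike 𝕜] (S : Set ℝ) (g : ℝ → 𝕜) : ℝ :=
  sSup ((fun x => ‖g x‖) '' S)

/-! A random access machine with exact arithmetic in the field `𝕜` (`ℝ` or `ℂ`) and unit cost per
instruction. It has natural number registers, used as counters and addresses, and arrays of
elements of `𝕜`; array number `b` is accessed at the address held in register `i`. Programs are
finite, contain only integer constants, and do not depend on `𝕜` (for `𝕜 = ℂ` one instruction is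
a bounded number of operations on real and imaginary parts). -/

namespace FieldRAM

/-- The four arithmetic operations. -/
inductive ArithOp where
  | add
  | sub
  | mul
  | div

/-- Division by zero returns zero. -/
noncomputable def ArithOp.eval {𝕜 : Type} [RCLike 𝕜] : ArithOp → 𝕜 → 𝕜 → 𝕜
  | .add, x, y => x + y
  | .sub, x, y => x - y
  | .mul, x, y => x * y
  | .div, x, y => x / y

/-- Instructions other than control flow. Below `R i` is register `i` and `A b` is array `b`. -/
inductive Instr where
  /-- `R i := n` -/
  | natConst (i n : ℕ)
  /-- `R i := R j + R k` -/
  | natAdd (i j k : ℕ)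
  /-- `R i := R j - R k`, truncated at zero -/
  | natSub (i j k : ℕ)
  /-- `A b [R i] := z` -/
  | const (b i : ℕ) (z : ℤ)
  /-- `A b [R i] := A c [R j] op A d [R k]` -/
  | arith (op : ArithOp) (b i c j d k : ℕ)

/-- Tests for branching. -/
inductive Test where
  /-- `R i < R j` -/
  | natLt (i j : ℕ)
  /-- the real part of `A b [R i]` is less than the real part of `A c [R j]` -/
  | valLt (b i c j : ℕ)

inductive Program where
  | instr (I : Instr)
  | seq (p q : Program)
  | ite (t : Test) (p q : Program)
  | whileDo (t : Test) (p : Program)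

structure State (𝕜 : Type) where
  /-- the natural number registers -/
  reg : ℕ → ℕ
  /-- `arr b n` is entry `n` of array `b` -/
  arr : ℕ → ℕ → 𝕜

def State.setReg {𝕜 : Type} (s : State 𝕜) (i n : ℕ) : State 𝕜 :=
  { s with reg := Function.update s.reg i n }

def State.setArr {𝕜 : Type} (s : State 𝕜) (b n : ℕ) (x : 𝕜) : State 𝕜 :=
  { s with arr := Function.update s.arr b (Function.update (s.arr b) n x) }

noncomputable def Instr.run {𝕜 : Type} [RCLike 𝕜] : Instr → State 𝕜 → State 𝕜
  | .natConst i n, s => s.setReg i n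
  | .natAdd i j k, s => s.setReg i (s.reg j + s.reg k)
  | .natSub i j k, s => s.setReg i (s.reg j - s.reg k)
  | .const b i z, s => s.setArr b (s.reg i) (z : 𝕜)
  | .arith op b i c j d k, s =>
      s.setArr b (s.reg i) (op.eval (s.arr c (s.reg j)) (s.arr d (s.reg k)))

def Test.Holds {𝕜 : Type} [RCLike 𝕜] : Test → State 𝕜 → Prop
  | .natLt i j, s => s.reg i < s.reg j
  | .valLt b i c j, s => RCLike.re (s.arr b (s.reg i)) < RCLike.re (s.arr c (s.reg j))

/-- `Exec p s n s'`: the program `p`, started in the state `s`, halts in the state `s'` after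
exactly `n` steps; every instruction and every test counts as one step. -/
inductive Exec {𝕜 : Type} [RCLike 𝕜] : Program → State 𝕜 → ℕ → State 𝕜 → Prop where
  | instr (I : Instr) (s : State 𝕜) : Exec (.instr I) s 1 (I.run s)
  | seq {p q : Program} {s s' s'' : State 𝕜} {m n : ℕ} :
      Exec p s m s' → Exec q s' n s'' → Exec (.seq p q) s (m + n) s''
  | iteTrue {t : Test} {p q : Program} {s s' : State 𝕜} {n : ℕ} :
      t.Holds s → Exec p s n s' → Exec (.ite t p q) s (n + 1) s'
  | iteFalse {t : Test} {p q : Program} {s s' : State 𝕜} {n : ℕ} :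
      ¬ t.Holds s → Exec q s n s' → Exec (.ite t p q) s (n + 1) s'
  | whileTrue {t : Test} {p : Program} {s s' s'' : State 𝕜} {m n : ℕ} :
      t.Holds s → Exec p s m s' → Exec (.whileDo t p) s' n s'' →
        Exec (.whileDo t p) s (m + n + 1) s''
  | whileFalse {t : Test} {p : Program} {s : State 𝕜} :
      ¬ t.Holds s → Exec (.whileDo t p) s 1 s

/-- The initial state: array `0` gives access to the Taylor coefficients, the first four entries of
array `1` are `r, δ, B, ε`, and everything else is zero. -/
noncomputable def inputState {𝕜 : Type} [RCLike 𝕜] (a : ℕ → 𝕜) (r δ B ε : ℝ) : State 𝕜 where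
  reg := fun _ => 0
  arr := fun b n =>
    match b, n with
    | 0, n => a n
    | 1, 0 => (r : 𝕜)
    | 1, 1 => (δ : 𝕜)
    | 1, 2 => (B : 𝕜)
    | 1, 3 => (ε : 𝕜)
    | _, _ => 0

/-- The state `s` presents the polynomial `P` as output: register `0` holds a bound `d` for the
degree of `P`, and the entries `0, …, d` of array `2` are the coefficients of `P`. -/
def State.Outputs {𝕜 : Type} [RCLike 𝕜] (s : State 𝕜) (P : 𝕜[X]) : Prop :=
  P.natDegree ≤ s.reg 0 ∧ ∀ j ≤ s.reg 0, s.arr 2 j = P.coeff j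

end FieldRAM

/-! Put R = r + δ. Truncating the power series at order Q of size (r/δ) log(B/ε) approximates f on
[-r, r], but on the rest of [-1, 1] the truncation may be far too large for a cut-off to repair
cheaply. The remedy is to fold [-1, 1] first.

For odd m = 2j + 1 of size 1/r, y = sin(m arcsin(βx)) is a polynomial in x of degree m with |y| ≤ 1
on [-1, 1] (`foldPoly`), and β is such that [-R, R] lies in its first monotone branch. There x = β⁻¹
sin(α arcsin y) with α = 1/m, a power series in y with nonnegative coefficients. Let h be a long
Taylor polynomial of sin(α arcsin y) and β = h(1)/R, so that h/β (`unfoldPoly`) takes the value R at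
y = 1. Substituting it for x in the truncated series gives a polynomial in y whose absolute
coefficient sum is at most ∑ |a_l| R^l ≤ B; it is therefore bounded by B on |y| ≤ 1, hence for all x
in [-1, 1].

Its degree in y is lowered below Q without losing this bound. Expand it in T_i(y/Y) with Y slightly
below 1. Monomials have nonnegative Chebyshev coefficients, so the sum of |c_i| T_i(1/Y) is still at
most B. Modulo T_Q each T_i is congruent to 0 or to ± T_i' with i' < Q and i' ≤ i. The remainder is
bounded by B on |y| ≤ 1 and on |y| ≤ Y it differs from the original by at most 2B / T_Q(1/Y)
(`ChebBound.exists_remainder`). The degree in x is below Qm, of order (r/δ)(1/r) log(B/ε) = (1/δ)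
log(B/ε). This is `foldedTaylor_spec`.

The result p is bounded by B on [-1, 1] and close to f on |x| ≤ r + δ/2. Multiplying it by a window
polynomial with values in [0, 1], near 1 on [-r, r] and near 0 for |x| ≥ r + δ/2
(`windowPoly_spec`), gives P (`boundedTaylor_spec`).

As p is a remainder modulo a monic polynomial in x, ring operations, coefficient extraction and
division of constants suffice to compute P. A small language of polynomial commands is compiled to
the machine with polynomial time bounds (`PolyCmd.runs_compile`); logarithm and reciprocals are
replaced by integers found by counting.

For the second part take δ = r = √(Γ/λ). The absolute series of sin(cx²) and cos(cx²) at 2r are at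
most exp(4|c|r²), so log(B/ε) is 4|t|Γ + log(1/ε); dividing P by 1 + ε gives the bound 1. -/

namespace FieldRAM

/-! ### Running-time rules for machine programs -/

/-- The program `p`, started in `s`, halts within `T` steps in a state satisfying `Q`. -/
def Runs {𝕜 : Type} [RCLike 𝕜] (p : Program) (s : State 𝕜) (T : ℕ) (Q : State 𝕜 → Prop) : Prop :=
  ∃ n s', Exec p s n s' ∧ n ≤ T ∧ Q s'

section Runs

variable {𝕜 : Type} [RCLike 𝕜] {p q : Program} {s : State 𝕜} {T T' : ℕ} {Q Q' : State 𝕜 → Prop}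

lemma Runs.mono (h : Runs p s T Q) (hT : T ≤ T') (hQ : ∀ s', Q s' → Q' s') : Runs p s T' Q' := by
  obtain ⟨n, s', h1, h2, h3⟩ := h
  exact ⟨n, s', h1, h2.trans hT, hQ _ h3⟩

lemma Runs.instr {I : Instr} (h : Q (I.run s)) : Runs (.instr I) s 1 Q :=
  ⟨1, _, .instr I s, le_rfl, h⟩

lemma Runs.seq (h : Runs p s T Q) (h' : ∀ s', Q s' → Runs q s' T' Q') :
    Runs (.seq p q) s (T + T') Q' := by
  obtain ⟨n, s', h1, h2, h3⟩ := h
  obtain ⟨m, s'', h4, h5, h6⟩ := h' _ h3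
  exact ⟨_, _, .seq h1 h4, by lia, h6⟩

lemma Runs.instrSeq {I : Instr} (h : Runs q (I.run s) T Q) :
    Runs (.seq (.instr I) q) s (T + 1) Q := by
  obtain ⟨n, s', h1, h2, h3⟩ := h
  exact ⟨_, _, .seq (.instr I s) h1, by lia, h3⟩

/-- The invariant is indexed by the number of completed passes. Each pass pays one step for its
test, and one more step pays for the final failing test. -/
lemma Runs.whileDo {t : Test} {N : ℕ} {Inv : ℕ → State 𝕜 → Prop}
    (hb : ∀ k < N, ∀ s, Inv k s → t.Holds s ∧ Runs p s T (Inv (k + 1)))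
    (hN : ∀ s, Inv N s → ¬ t.Holds s) (h0 : Inv 0 s) :
    Runs (.whileDo t p) s (N * (T + 1) + 1) (Inv N) := by
  suffices H : ∀ d k s, k + d = N → Inv k s →
      Runs (.whileDo t p) s (d * (T + 1) + 1) (Inv N) from H N 0 s (by simp) h0
  intro d
  induction d with
  | zero =>
    intro k s hk h
    obtain rfl : k = N := by simpa using hk
    exact ⟨1, s, .whileFalse (hN s h), by simp, h⟩
  | succ d ih =>
    intro k s hk h
    obtain ⟨ht, n, s', h1, h2, h3⟩ := hb k (by lia) s h
    obtain ⟨m, s'', h4, h5, h6⟩ := ih (k + 1) s' (by lia) h3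
    refine ⟨_, _, .whileTrue ht h1 h4, ?_, h6⟩
    rw [add_mul]
    lia

end Runs

/-- `for R i := 0; R i < R j; R i := R i + 1 do p`, given that `R 32 = 1`. -/
def forLoop (i j : ℕ) (p : Program) : Program :=
  .seq (.instr (.natConst i 0)) (.whileDo (.natLt i j) (.seq p (.instr (.natAdd i i 32))))

section setters

variable {𝕜 : Type} (s : State 𝕜)

@[simp] lemma setReg_reg (i n k : ℕ) : (s.setReg i n).reg k = if k = i then n else s.reg k := by
  simp [State.setReg, Function.update_apply]

@[simp] lemma setReg_arr (i n : ℕ) : (s.setReg i n).arr = s.arr := rfl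

@[simp] lemma setArr_reg (b n : ℕ) (x : 𝕜) : (s.setArr b n x).reg = s.reg := rfl

lemma setArr_arr (b n : ℕ) (x : 𝕜) (c : ℕ) :
    (s.setArr b n x).arr c = if c = b then Function.update (s.arr b) n x else s.arr c := by
  simp [State.setArr, Function.update_apply]

@[simp] lemma setArr_arr_self (b n : ℕ) (x : 𝕜) :
    (s.setArr b n x).arr b = Function.update (s.arr b) n x := by
  simp [setArr_arr]

lemma setArr_arr_of_ne {b c : ℕ} (h : c ≠ b) (n : ℕ) (x : 𝕜) :
    (s.setArr b n x).arr c = s.arr c := by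
  simp [setArr_arr, h]

end setters

section forLoop

variable {𝕜 : Type} [RCLike 𝕜]

/-- The body establishes the next invariant only for the state in which the counter is already
increased, so invariants may mention the counter. Each pass pays for test and increment;
initialisation and the last test give the final 2. -/
lemma Runs.forLoop {i j : ℕ} {p : Program} {s : State 𝕜} {T N : ℕ} {Inv : ℕ → State 𝕜 → Prop}
    (h0 : Inv 0 (s.setReg i 0))
    (hI : ∀ k s', Inv k s' → s'.reg j = N ∧ s'.reg i = k)
    (hb : ∀ k < N, ∀ s', Inv k s' →
      Runs p s' T (fun s'' => s''.reg i = k ∧ s''.reg 32 = 1 ∧ Inv (k + 1) (s''.setReg i (k + 1)))) :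
    Runs (forLoop i j p) s (N * (T + 2) + 2) (Inv N) := by
  refine (Runs.instrSeq (T := N * (T + 1 + 1) + 1) ?_).mono le_rfl (fun _ h => h)
  refine Runs.whileDo (Inv := Inv) ?_ ?_ h0
  · intro k hk s' h
    obtain ⟨h1, h2⟩ := hI k s' h
    refine ⟨by simpa [Test.Holds, h1, h2] using hk, ?_⟩
    refine Runs.seq (hb k hk s' h) ?_
    rintro s'' ⟨h3, h4, h5⟩
    refine Runs.instr ?_
    simpa [Instr.run, h3, h4] using h5
  · intro s' h
    obtain ⟨h1, h2⟩ := hI N s' h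
    simp [Test.Holds, h1, h2]

end forLoop

/-! ### Frame conditions and array subroutines -/

/-- Registers `0, …, 32` and arrays `0, …, 40` other than array `b` agree in the two states. -/
structure Keep {𝕜 : Type} (b : ℕ) (s s' : State 𝕜) : Prop where
  reg : ∀ i < 33, s'.reg i = s.reg i
  arr : ∀ c < 41, c ≠ b → s'.arr c = s.arr c

lemma Keep.refl {𝕜 : Type} {b : ℕ} (s : State 𝕜) : Keep b s s := ⟨fun _ _ => rfl, fun _ _ _ => rfl⟩

lemma Keep.trans {𝕜 : Type} {b : ℕ} {s s' s'' : State 𝕜} (h : Keep b s s') (h' : Keep b s' s'') :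
    Keep b s s'' :=
  ⟨fun i hi => (h'.reg i hi).trans (h.reg i hi), fun c hc hb => (h'.arr c hc hb).trans (h.arr c hc hb)⟩

lemma Keep.setReg {𝕜 : Type} {b : ℕ} {s s' : State 𝕜} (h : Keep b s s') {i : ℕ} (hi : 33 ≤ i)
    (n : ℕ) : Keep b s (s'.setReg i n) :=
  ⟨fun k hk => by simp [show k ≠ i by lia, h.reg k hk], fun c hc hb => by simp [h.arr c hc hb]⟩

lemma Keep.setArr {𝕜 : Type} {b : ℕ} {s s' : State 𝕜} (h : Keep b s s') {c : ℕ}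
    (hc : c = b ∨ 41 ≤ c) (n : ℕ) (x : 𝕜) : Keep b s (s'.setArr c n x) :=
  ⟨fun k hk => by simp [h.reg k hk], fun c' hc' hb => by
    rw [setArr_arr_of_ne _ (by lia), h.arr c' hc' hb]⟩

lemma Keep.of_le {𝕜 : Type} {b b' : ℕ} {s s' : State 𝕜} (h : Keep b s s') (hb : 41 ≤ b) :
    Keep b' s s' :=
  ⟨h.reg, fun c hc _ => h.arr c hc (by lia)⟩

/-- Registers and arrays reserved for the compiled programs: register `30` holds the length `D` of
the arrays in use. -/
structure Ready {𝕜 : Type} [RCLike 𝕜] (D : ℕ) (s : State 𝕜) : Prop where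
  len : s.reg 30 = D
  zero : s.reg 31 = 0
  one : s.reg 32 = 1
  arr : ∀ i, s.arr 40 i = 0

lemma Ready.keep {𝕜 : Type} [RCLike 𝕜] {D b : ℕ} {s s' : State 𝕜} (h : Ready D s)
    (hk : Keep b s s') (hb : b ≠ 40) : Ready D s' :=
  ⟨(hk.reg 30 (by lia)).trans h.len, (hk.reg 31 (by lia)).trans h.zero,
    (hk.reg 32 (by lia)).trans h.one, fun i => by rw [hk.arr 40 (by lia) hb.symm, h.arr]⟩

section subroutines

variable {𝕜 : Type} [RCLike 𝕜] {D : ℕ} {s : State 𝕜}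

/-- Entrywise operations on arrays. -/
def entrywise (op : ArithOp) (b c d : ℕ) : Program :=
  forLoop 33 30 (.instr (.arith op b 33 c 33 d 33))

lemma runs_entrywise (op : ArithOp) {b c d : ℕ} (hs : Ready D s) (hb : b < 40) :
    Runs (entrywise op b c d) s (3 * D + 2)
      (fun s' => Keep b s s' ∧ ∀ j < D, s'.arr b j = op.eval (s.arr c j) (s.arr d j)) := by
  let Inv : ℕ → State 𝕜 → Prop := fun k s' => s'.reg = Function.update s.reg 33 k ∧
    (∀ c ≠ b, s'.arr c = s.arr c) ∧ (∀ j, s'.arr b j = if j < k then op.eval (s.arr c j) (s.arr d j)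
      else s.arr b j)
  refine (Runs.forLoop (N := D) (T := 1) (Inv := Inv) ?_ ?_ ?_).mono (by lia) ?_
  · refine ⟨by ext k; simp [Function.update_apply], by simp, by simp⟩
  · rintro k s' ⟨h1, -, -⟩
    simp [h1, hs.len]
  · rintro k hk s' ⟨h1, h2, h3⟩
    -- Pass `k` reads only entries `k`, which no earlier pass has written; so `b` may coincide with
    -- `c` or `d`.
    have key : ∀ e, s'.arr e k = s.arr e k := fun e => by
      by_cases he : e = b
      · subst he; simp [h3]
      · rw [h2 e he]
    refine Runs.instr ⟨by simp [Instr.run, h1], by simp [Instr.run, h1, hs.one], ?_, ?_, ?_⟩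
    · ext i; simp [Instr.run, h1, Function.update_apply]; split_ifs <;> rfl
    · intro e he
      simp [Instr.run, setArr_arr_of_ne _ he, h2 e he]
    · intro j
      simp only [Instr.run, setReg_arr, setArr_arr_self, h1, Function.update_self, key,
        Function.update_apply, h3]
      grind
  · rintro s' ⟨h1, h2, h3⟩
    refine ⟨⟨fun i hi => by simp [h1, show i ≠ 33 by lia], fun e _ he => h2 e he⟩, fun j hj => by
      simp [h3, hj]⟩

/-- Array `b` becomes the constant polynomial stored in entry `0` of array `41`. -/
def setConst (b : ℕ) : Program :=
  -- Array `40` is zero: its sum with itself clears `b`, and adding its entry `0` to a scratch entry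
  -- acts as a copy instruction.
  .seq (entrywise .add b 40 40) (.instr (.arith .add b 31 41 31 40 31))

lemma runs_setConst {b : ℕ} (hs : Ready D s) (hb : b < 40) :
    Runs (setConst b) s (3 * D + 3) (fun s' => Keep b s s' ∧
      ∀ j < D, s'.arr b j = if j = 0 then s.arr 41 0 else 0) := by
  -- array `41` is not covered by `Keep`, so it has to be carried along
  have h : Runs (entrywise .add b 40 40) s (3 * D + 2) (fun s' => Keep b s s' ∧
      s'.arr 41 = s.arr 41 ∧ ∀ j < D, s'.arr b j = 0) := by
    let Inv : ℕ → State 𝕜 → Prop := fun k s' => s'.reg = Function.update s.reg 33 k ∧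
      (∀ c ≠ b, s'.arr c = s.arr c) ∧ (∀ j < k, s'.arr b j = 0)
    refine (Runs.forLoop (N := D) (T := 1) (Inv := Inv) ?_ ?_ ?_).mono (by lia) ?_
    · exact ⟨by ext k; simp [Function.update_apply], by simp, by simp⟩
    · rintro k s' ⟨h1, -, -⟩
      simp [h1, hs.len]
    · rintro k hk s' ⟨h1, h2, h3⟩
      refine Runs.instr ⟨by simp [Instr.run, h1], by simp [Instr.run, h1, hs.one], ?_, ?_, ?_⟩
      · ext i; simp [Instr.run, h1, Function.update_apply]; split_ifs <;> rfl
      · intro e he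
        simp [Instr.run, setArr_arr_of_ne _ he, h2 e he]
      · intro j hj
        simp only [Instr.run, setReg_arr, setArr_arr_self, h1, Function.update_self,
          Function.update_apply, ArithOp.eval, h2 40 (by lia), hs.arr]
        grind
    · rintro s' ⟨h1, h2, h3⟩
      exact ⟨⟨fun i hi => by simp [h1, show i ≠ 33 by lia], fun e _ he => h2 e he⟩,
        h2 41 (by lia), fun j hj => h3 j hj⟩
  refine (Runs.seq (T' := 1) h ?_).mono (by lia) (fun _ h => h)
  rintro s' ⟨h1, h2, h3⟩
  have hr := hs.keep h1 (by lia)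
  refine Runs.instr ⟨h1.setArr (Or.inl rfl) _ _, fun j hj => ?_⟩
  simp only [Instr.run, setArr_arr_self, hr.zero, Function.update_apply, ArithOp.eval, hr.arr, h2]
  grind

/-- Array `b` becomes the product, as polynomials, of arrays `c` and `d`. -/
def mulProg (b c d : ℕ) : Program :=
  -- The convolution is accumulated in scratch array `42` and copied at the end, so `b` may coincide
  -- with a factor.
  .seq (forLoop 33 30 (.seq (.instr (.arith .add 42 33 40 33 40 33))
    (.seq (.instr (.natAdd 35 33 32)) (forLoop 34 35 (.seq (.instr (.natSub 36 33 34))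
      (.seq (.instr (.arith .mul 43 31 c 34 d 36)) (.instr (.arith .add 42 33 42 33 43 31))))))))
    (entrywise .add b 42 40)

lemma runs_mulProg {b c d : ℕ} (hs : Ready D s) (hb : b < 40) (hc : c < 40) (hd : d < 40) :
    Runs (mulProg b c d) s (D * (5 * D + 6) + 2 + (3 * D + 2)) (fun s' => Keep b s s' ∧
      ∀ k < D, s'.arr b k = ∑ l ∈ Finset.range (k + 1), s.arr c l * s.arr d (k - l)) := by
  refine Runs.seq (Q := fun s' => Keep 42 s s' ∧
    ∀ k < D, s'.arr 42 k = ∑ l ∈ Finset.range (k + 1), s.arr c l * s.arr d (k - l)) ?_ ?_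
  · let Inv : ℕ → State 𝕜 → Prop := fun k s' => Keep 42 s s' ∧ s'.reg 33 = k ∧
      ∀ j < k, s'.arr 42 j = ∑ l ∈ Finset.range (j + 1), s.arr c l * s.arr d (j - l)
    refine (Runs.forLoop (N := D) (T := 5 * D + 4) (Inv := Inv) ?_ ?_ ?_).mono (by lia) ?_
    · exact ⟨(Keep.refl s).setReg (by lia) _, by simp, by simp⟩
    · rintro k s' ⟨h1, h2, -⟩
      exact ⟨(h1.reg 30 (by lia)).trans hs.len, h2⟩
    · rintro k hk s' ⟨h1, h2, h3⟩
      have hr := hs.keep h1 (by lia)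
      refine (Runs.instrSeq (T := 5 * D + 3) (Runs.instrSeq (T := (k + 1) * (3 + 2) + 2)
        ?_ |>.mono (by lia) (fun _ h => h))).mono le_rfl (fun _ h => h)
      let Inv' : ℕ → State 𝕜 → Prop := fun l s' => Keep 42 s s' ∧ s'.reg 33 = k ∧
        s'.reg 35 = k + 1 ∧ s'.reg 34 = l ∧
        s'.arr 42 k = ∑ l ∈ Finset.range l, s.arr c l * s.arr d (k - l) ∧
        ∀ j < k, s'.arr 42 j = ∑ l ∈ Finset.range (j + 1), s.arr c l * s.arr d (j - l)
      refine (Runs.forLoop (Inv := Inv') ?_ ?_ ?_).mono le_rfl ?_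
      · refine ⟨((h1.setArr (by lia) _ _).setReg (by lia) _).setReg (by lia) _, ?_, ?_, ?_, ?_, ?_⟩
        · simp [Instr.run, h2]
        · simp [Instr.run, h2, hr.one]
        · simp
        · simp [Instr.run, h2, hr.arr, ArithOp.eval]
        · intro j hj
          simp [Instr.run, h2, show j ≠ k by lia, h3 j hj]
      · rintro l s' ⟨-, -, h, h', -⟩
        exact ⟨h, h'⟩
      · rintro l hl s' ⟨h1, h2, h3, h4, h5, h6⟩
        have hr := hs.keep h1 (by lia)
        refine (Runs.instrSeq (T := 2) (Runs.instrSeq (T := 1) (Runs.instr ?_)))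
        refine ⟨?_, ?_, ?_, ?_, ?_, ?_, ?_, ?_⟩
        · simp [Instr.run, h4]
        · simp [Instr.run, hr.one]
        · exact (((h1.setReg (by lia) _).setArr (by lia) _ _).setArr (by lia) _ _).setReg (by lia) _
        · simp [Instr.run, h2]
        · simp [Instr.run, h3]
        · simp
        · simp only [Instr.run, setReg_arr, setArr_arr_self, setArr_reg, setReg_reg, h2, h4,
            hr.zero, setArr_arr_of_ne _ (show (42 : ℕ) ≠ 43 by lia), ArithOp.eval,
            h1.arr c (by lia) (by lia), h1.arr d (by lia) (by lia)]
          simp [Finset.sum_range_succ, h5]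
        · intro j hj
          simp [Instr.run, h2, show j ≠ k by lia, h6 j hj,
            setArr_arr_of_ne _ (show (42 : ℕ) ≠ 43 by lia)]
      · rintro s' ⟨h1, h2, h3, h4, h5, h6⟩
        refine ⟨h2, (h1.reg 32 (by lia)).trans hs.one, h1.setReg (by lia) _, by simp, ?_⟩
        intro j hj
        rcases Nat.lt_succ_iff_lt_or_eq.1 hj with hj | rfl
        · exact h6 j hj
        · exact h5
    · rintro s' ⟨h1, -, h3⟩
      exact ⟨h1, h3⟩
  · rintro s' ⟨h1, h2⟩
    have hr := hs.keep h1 (by lia)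
    refine (runs_entrywise .add (c := 42) (d := 40) hr hb).mono le_rfl ?_
    rintro s'' ⟨h3, h4⟩
    refine ⟨(h1.of_le (by lia)).trans h3, fun k hk => ?_⟩
    rw [h4 k hk, h2 k hk, hr.arr]
    simp [ArithOp.eval]

end subroutines

end FieldRAM

/-! ### A language of polynomial commands and its compiler -/

namespace FieldRAM

/-- A language of straight-line programs with bounded loops on polynomial registers. -/
inductive PolyCmd where
  /-- `b := z` -/
  | const (b : ℕ) (z : ℤ)
  /-- `b := X` -/
  | var (b : ℕ)
  | add (b c d : ℕ)
  | sub (b c d : ℕ)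
  | mul (b c d : ℕ)
  /-- quotient of constant coefficients -/
  | div (b c d : ℕ)
  /-- `b := coeff c (R i)` -/
  | coeff (b c i : ℕ)
  /-- `b := a (R i)` with the input sequence `a` -/
  | input (b i : ℕ)
  | seq (p q : PolyCmd)
  /-- `for R i := 0; R i < R j; R i := R i + 1 do p` -/
  | loop (i j : ℕ) (p : PolyCmd)

/-- States with counters and polynomial registers. -/
structure PolyState (𝕜 : Type) [RCLike 𝕜] where
  reg : ℕ → ℕ
  poly : ℕ → 𝕜[X]

namespace PolyState

variable {𝕜 : Type} [RCLike 𝕜]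

def setReg (σ : PolyState 𝕜) (i n : ℕ) : PolyState 𝕜 :=
  { σ with reg := Function.update σ.reg i n }

def setPoly (σ : PolyState 𝕜) (b : ℕ) (P : 𝕜[X]) : PolyState 𝕜 :=
  { σ with poly := Function.update σ.poly b P }

end PolyState

namespace PolyCmd

variable {𝕜 : Type} [RCLike 𝕜]

/-- One pass of a loop whose counter is `R i`. -/
def next (f : PolyState 𝕜 → PolyState 𝕜) (i : ℕ) (σ : PolyState 𝕜) : PolyState 𝕜 :=
  (f σ).setReg i ((f σ).reg i + 1)

/-- The function on states computed by a command. -/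
noncomputable def run (a : ℕ → 𝕜) : PolyCmd → PolyState 𝕜 → PolyState 𝕜
  | const b z, σ => σ.setPoly b (z : 𝕜[X])
  | var b, σ => σ.setPoly b Polynomial.X
  | add b c d, σ => σ.setPoly b (σ.poly c + σ.poly d)
  | sub b c d, σ => σ.setPoly b (σ.poly c - σ.poly d)
  | mul b c d, σ => σ.setPoly b (σ.poly c * σ.poly d)
  | div b c d, σ => σ.setPoly b (C ((σ.poly c).coeff 0 / (σ.poly d).coeff 0))
  | coeff b c i, σ => σ.setPoly b (C ((σ.poly c).coeff (σ.reg i)))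
  | input b i, σ => σ.setPoly b (C (a (σ.reg i)))
  | seq p q, σ => q.run a (p.run a σ)
  | loop i j p, σ => (next (p.run a) i)^[σ.reg j] (σ.setReg i 0)

/-- The registers that a command assigns. -/
def Writes : PolyCmd → ℕ → Prop
  | seq p q, k => p.Writes k ∨ q.Writes k
  | loop i _ p, k => k = i ∨ p.Writes k
  | _, _ => False

/-- Commands in which the compiler's own registers and arrays do not occur and loop counters and
bounds are not changed in loops. -/
def WellFormed : PolyCmd → Prop
  | const b _ => 0 < b ∧ b < 40
  | var b => 0 < b ∧ b < 40
  | add b c d => (0 < b ∧ b < 40) ∧ (0 < c ∧ c < 40) ∧ 0 < d ∧ d < 40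
  | sub b c d => (0 < b ∧ b < 40) ∧ (0 < c ∧ c < 40) ∧ 0 < d ∧ d < 40
  | mul b c d => (0 < b ∧ b < 40) ∧ (0 < c ∧ c < 40) ∧ 0 < d ∧ d < 40
  | div b c d => (0 < b ∧ b < 40) ∧ (0 < c ∧ c < 40) ∧ 0 < d ∧ d < 40
  | coeff b c i => (0 < b ∧ b < 40) ∧ (0 < c ∧ c < 40) ∧ i < 30
  | input b i => (0 < b ∧ b < 40) ∧ i < 30
  | seq p q => p.WellFormed ∧ q.WellFormed
  | loop i j p => i < 30 ∧ j < 30 ∧ i ≠ j ∧ ¬ p.Writes i ∧ ¬ p.Writes j ∧ p.WellFormed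

def compile : PolyCmd → Program
  | const b z => .seq (.instr (.const 41 31 z)) (setConst b)
  | var b => .seq (.instr (.const 41 31 0)) (.seq (setConst b) (.instr (.const b 32 1)))
  | add b c d => entrywise .add b c d
  | sub b c d => entrywise .sub b c d
  | mul b c d => mulProg b c d
  | div b c d => .seq (.instr (.arith .div 41 31 c 31 d 31)) (setConst b)
  | coeff b c i => .seq (.instr (.arith .add 41 31 c i 40 31)) (setConst b)
  | input b i => .seq (.instr (.arith .add 41 31 0 i 40 31)) (setConst b)
  | seq p q => .seq p.compile q.compile
  | loop i j p => forLoop i j p.compile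

/-- The machine state `s` represents `σ`, up to the coefficients of order at least `D`. -/
structure Rep (a : ℕ → 𝕜) (D : ℕ) (s : State 𝕜) (σ : PolyState 𝕜) : Prop where
  ready : Ready D s
  input : s.arr 0 = a
  reg : ∀ i < 30, s.reg i = σ.reg i
  poly : ∀ b, 0 < b → b < 40 → ∀ j < D, s.arr b j = (σ.poly b).coeff j

variable {a : ℕ → 𝕜} {D : ℕ} {s : State 𝕜} {σ : PolyState 𝕜}

lemma Rep.setPoly (h : Rep a D s σ) {s' : State 𝕜} {b : ℕ} (hb : 0 < b ∧ b < 40) {P : 𝕜[X]}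
    (hk : Keep b s s') (hP : ∀ j < D, s'.arr b j = P.coeff j) : Rep a D s' (σ.setPoly b P) := by
  refine ⟨h.ready.keep hk (by lia), (hk.arr 0 (by lia) (by lia)).trans h.input,
    fun i hi => (hk.reg i (by lia)).trans (h.reg i hi), fun c hc hc' j hj => ?_⟩
  by_cases hcb : c = b
  · subst hcb
    simp [PolyState.setPoly, hP j hj]
  · simp [PolyState.setPoly, hcb, hk.arr c (by lia) hcb, h.poly c hc hc' j hj]

lemma Rep.setReg (h : Rep a D s σ) {i : ℕ} (hi : i < 30) (n : ℕ) :
    Rep a D (s.setReg i n) (σ.setReg i n) := by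
  refine ⟨⟨?_, ?_, ?_, h.ready.arr⟩, h.input, fun k hk => ?_, h.poly⟩
  · simp [h.ready.len, show 30 ≠ i by lia]
  · simp [h.ready.zero, show 31 ≠ i by lia]
  · simp [h.ready.one, show 32 ≠ i by lia]
  · simp [PolyState.setReg, Function.update_apply, h.reg k hk]

lemma runs_const {I : Instr} {b : ℕ} {x : 𝕜} (h : Rep a D s σ) (hb : 0 < b ∧ b < 40)
    (hI : I.run s = s.setArr 41 0 x) :
    Runs (.seq (.instr I) (setConst b)) s (3 * D + 4) (fun s' => Rep a D s' (σ.setPoly b (C x))) := by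
  have h41 : Keep b s (I.run s) := by rw [hI]; exact (Keep.refl s).setArr (by lia) _ _
  refine Runs.instrSeq ((runs_setConst (h.ready.keep h41 (by lia)) hb.2).mono le_rfl ?_)
  rintro s' ⟨h1, h2⟩
  refine h.setPoly hb (h41.trans h1) fun j hj => ?_
  rw [h2 j hj, hI, coeff_C]
  simp

lemma run_reg_of_not_writes {p : PolyCmd} {k : ℕ} (hk : ¬ p.Writes k) (σ : PolyState 𝕜) :
    (p.run a σ).reg k = σ.reg k := by
  induction p generalizing σ with
  | seq p q hp hq =>
    simp only [Writes, not_or] at hk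
    rw [run, hq hk.2, hp hk.1]
  | loop i j p hp =>
    simp only [Writes, not_or] at hk
    rw [run]
    have : ∀ n τ, ((next (p.run a) i)^[n] τ).reg k = τ.reg k := by
      intro n
      induction n with
      | zero => simp
      | succ n ih =>
        intro τ
        rw [Function.iterate_succ_apply, ih]
        simp [next, PolyState.setReg, hk.1, hp hk.2]
    rw [this]
    simp [PolyState.setReg, hk.1]
  | _ => rfl

lemma iterate_next_counter {p : PolyCmd} {i : ℕ} (hi : ¬ p.Writes i) (σ : PolyState 𝕜) (n : ℕ) :
    ((next (p.run a) i)^[n] σ).reg i = σ.reg i + n := by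
  induction n with
  | zero => simp
  | succ n ih =>
    rw [Function.iterate_succ_apply', next, PolyState.setReg]
    simp [run_reg_of_not_writes hi, ih, add_assoc]

lemma iterate_next_reg {p : PolyCmd} {i k : ℕ} (hk : ¬ p.Writes k) (hki : k ≠ i) (σ : PolyState 𝕜)
    (n : ℕ) : ((next (p.run a) i)^[n] σ).reg k = σ.reg k := by
  induction n with
  | zero => simp
  | succ n ih =>
    rw [Function.iterate_succ_apply', next, PolyState.setReg]
    simp [run_reg_of_not_writes hk, ih, hki]

/-- Registers change only as loop counters, and a counter never exceeds its bound, which is itself a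
register. This keeps the indices of `coeff` within the `D` stored coefficients. -/
lemma reg_run_lt (p : PolyCmd) (hp : p.WellFormed) {σ : PolyState 𝕜} (h : ∀ k < 30, σ.reg k < D) :
    ∀ k < 30, (p.run a σ).reg k < D := by
  induction p generalizing σ with
  | seq p q ihp ihq => exact ihq hp.2 (ihp hp.1 h)
  | loop i j p ih =>
    obtain ⟨hi, hj, hij, hwi, hwj, hw⟩ := hp
    have key : ∀ n ≤ σ.reg j, ∀ k < 30, ((next (p.run a) i)^[n] (σ.setReg i 0)).reg k < D := by
      intro n
      induction n with
      | zero =>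
        intro _ k hk
        have := h k hk
        simp only [Function.iterate_zero, id, PolyState.setReg, Function.update_apply]
        split_ifs <;> lia
      | succ n ihn =>
        intro hn k hk
        have h1 := ih hw (ihn (by lia)) k hk
        rw [Function.iterate_succ_apply', next]
        simp only [PolyState.setReg, Function.update_apply]
        split_ifs
        · rw [run_reg_of_not_writes hwi, iterate_next_counter hwi]
          have := h j hj
          simp
          lia
        · exact h1
    exact key _ le_rfl
  | _ => exact h

/-- Compiled commands compute what they should, in time polynomial in the length of the arrays. -/
theorem runs_compile (p : PolyCmd) (hp : p.WellFormed) :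
    ∃ A k : ℕ, ∀ (𝕜 : Type) [RCLike 𝕜] (a : ℕ → 𝕜) (D : ℕ) (s : State 𝕜) (σ : PolyState 𝕜),
      2 ≤ D → Rep a D s σ → (∀ i < 30, σ.reg i < D) →
        Runs p.compile s (A * D ^ k) (fun s' => Rep a D s' (p.run a σ)) := by
  induction p with
  | const b z =>
    refine ⟨5, 1, fun 𝕜 _ a D s σ hD h hr => ?_⟩
    refine (runs_const (x := (z : 𝕜)) h hp ?_).mono (by lia) fun s' h => by simpa [run] using h
    simp [Instr.run, h.ready.zero]
  | var b =>
    refine ⟨6, 1, fun 𝕜 _ a D s σ hD h hr => ?_⟩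
    have hs := h.ready
    have h41 : Keep b s (Instr.run (.const 41 31 0) s) := (Keep.refl s).setArr (by lia) _ _
    refine (Runs.instrSeq (Runs.seq (T' := 1) (runs_setConst (hs.keep h41
      (by have := hp.2; lia)) hp.2) ?_)).mono (by lia) fun s' h => h
    rintro s' ⟨h1, h2⟩
    have h3 := h41.trans h1
    have hs' := hs.keep h3 (by have := hp.2; lia)
    refine Runs.instr (h.setPoly hp (h3.setArr (Or.inl rfl) _ _) fun j hj => ?_)
    simp only [setArr_arr_self, hs'.one, Function.update_apply, h2 j hj, coeff_X, Instr.run,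
      hs.zero, Int.cast_zero, Int.cast_one]
    grind
  | add b c d =>
    refine ⟨4, 1, fun 𝕜 _ a D s σ hD h hr => ?_⟩
    obtain ⟨hb, hc, hd⟩ := hp
    refine (runs_entrywise .add h.ready hb.2).mono (by lia) ?_
    rintro s' ⟨h1, h2⟩
    refine h.setPoly hb h1 fun j hj => ?_
    rw [h2 j hj, h.poly c hc.1 hc.2 j hj, h.poly d hd.1 hd.2 j hj, coeff_add, ArithOp.eval]
  | sub b c d =>
    refine ⟨4, 1, fun 𝕜 _ a D s σ hD h hr => ?_⟩
    obtain ⟨hb, hc, hd⟩ := hp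
    refine (runs_entrywise .sub h.ready hb.2).mono (by lia) ?_
    rintro s' ⟨h1, h2⟩
    refine h.setPoly hb h1 fun j hj => ?_
    rw [h2 j hj, h.poly c hc.1 hc.2 j hj, h.poly d hd.1 hd.2 j hj, coeff_sub, ArithOp.eval]
  | mul b c d =>
    refine ⟨20, 2, fun 𝕜 _ a D s σ hD h hr => ?_⟩
    obtain ⟨hb, hc, hd⟩ := hp
    refine (runs_mulProg h.ready hb.2 hc.2 hd.2).mono (by nlinarith) ?_
    rintro s' ⟨h1, h2⟩
    refine h.setPoly hb h1 fun j hj => ?_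
    -- Coefficient `j` of a product involves only coefficients of order at most `j`, so discarding
    -- the orders from `D` on is harmless.
    rw [h2 j hj, coeff_mul, Finset.Nat.sum_antidiagonal_eq_sum_range_succ_mk]
    refine Finset.sum_congr rfl fun l hl => ?_
    rw [h.poly c hc.1 hc.2 l (by simp at hl; lia), h.poly d hd.1 hd.2 (j - l) (by lia)]
  | div b c d =>
    refine ⟨5, 1, fun 𝕜 _ a D s σ hD h hr => ?_⟩
    obtain ⟨hb, hc, hd⟩ := hp
    refine (runs_const (x := (σ.poly c).coeff 0 / (σ.poly d).coeff 0) h hb ?_).mono (by lia)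
      fun s' h => by simpa [run] using h
    simp [Instr.run, h.ready.zero, ArithOp.eval, h.poly c hc.1 hc.2 0 (by lia),
      h.poly d hd.1 hd.2 0 (by lia)]
  | coeff b c i =>
    refine ⟨5, 1, fun 𝕜 _ a D s σ hD h hr => ?_⟩
    obtain ⟨hb, hc, hi⟩ := hp
    refine (runs_const (x := (σ.poly c).coeff (σ.reg i)) h hb ?_).mono (by lia)
      fun s' h => by simpa [run] using h
    simp [Instr.run, h.ready.zero, h.ready.arr, ArithOp.eval, h.reg i hi,
      h.poly c hc.1 hc.2 _ (hr i hi)]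
  | input b i =>
    refine ⟨5, 1, fun 𝕜 _ a D s σ hD h hr => ?_⟩
    obtain ⟨hb, hi⟩ := hp
    refine (runs_const (x := a (σ.reg i)) h hb ?_).mono (by lia) fun s' h => by simpa [run] using h
    simp [Instr.run, h.ready.zero, h.ready.arr, ArithOp.eval, h.reg i hi, h.input]
  | seq p q ihp ihq =>
    obtain ⟨A, k, hA⟩ := ihp hp.1
    obtain ⟨A', k', hA'⟩ := ihq hp.2
    refine ⟨A + A', k + k', fun 𝕜 _ a D s σ hD h hr => ?_⟩
    refine (Runs.seq (hA 𝕜 a D s σ hD h hr) fun s' h' =>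
      hA' 𝕜 a D s' _ hD h' (reg_run_lt p hp.1 hr)).mono ?_ fun s' h => h
    have h1 : D ^ k ≤ D ^ (k + k') := Nat.pow_le_pow_right (by lia) (by lia)
    have h2 : D ^ k' ≤ D ^ (k + k') := Nat.pow_le_pow_right (by lia) (by lia)
    nlinarith
  | loop i j p ih =>
    obtain ⟨hi, hj, hij, hwi, hwj, hw⟩ := hp
    obtain ⟨A, k, hA⟩ := ih hw
    -- The loop bound is a register below `D`, so a loop costs one more power of `D`.
    refine ⟨A + 4, k + 1, fun 𝕜 _ a D s σ hD h hr => ?_⟩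
    let τ : ℕ → PolyState 𝕜 := fun n => (next (p.run a) i)^[n] (σ.setReg i 0)
    have hτi : ∀ n, (τ n).reg i = n := fun n => by
      rw [iterate_next_counter hwi]; simp [PolyState.setReg]
    have hτj : ∀ n, (τ n).reg j = σ.reg j := fun n => by
      rw [iterate_next_reg hwj hij.symm]; simp [PolyState.setReg, hij.symm]
    have hτ : ∀ n ≤ σ.reg j, ∀ l < 30, (τ n).reg l < D := by
      intro n hn
      induction n with
      | zero =>
        intro l hl
        have := hr l hl
        simp only [τ, Function.iterate_zero, id, PolyState.setReg, Function.update_apply]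
        split_ifs <;> lia
      | succ n ihn =>
        intro l hl
        by_cases hli : l = i
        · rw [hli, hτi]
          have := hr j hj
          lia
        · have := reg_run_lt (a := a) p hw (ihn (by lia)) l hl
          simpa [τ, Function.iterate_succ_apply', next, PolyState.setReg, hli] using this
    refine (Runs.forLoop (N := σ.reg j) (T := A * D ^ k) (Inv := fun n s' => Rep a D s' (τ n))
      (h.setReg hi 0) ?_ ?_).mono ?_ fun s' h => h
    · intro n s' h'
      rw [h'.reg j hj, h'.reg i hi, hτi, hτj]
      exact ⟨rfl, rfl⟩
    · intro n hn s' h'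
      refine (hA 𝕜 a D s' _ hD h' (hτ n hn.le)).mono le_rfl fun s'' h'' => ⟨?_, h''.ready.one, ?_⟩
      · rw [h''.reg i hi, run_reg_of_not_writes hwi, hτi]
      · have := h''.setReg hi (n + 1)
        simpa [τ, Function.iterate_succ_apply', next, run_reg_of_not_writes hwi, hτi] using this
    · have h1 := hr j hj
      have h2 : 1 ≤ D ^ k := Nat.one_le_pow _ _ (by lia)
      have h3 : σ.reg j * (A * D ^ k + 2) ≤ D * (A * D ^ k + 2) := by gcongr
      rw [pow_succ]
      nlinarith

end PolyCmd

end FieldRAM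

/-! ### Counter arithmetic and counting loops -/

namespace FieldRAM

/-- Arithmetic on counters, including multiplication. -/
inductive NatCmd where
  | const (i n : ℕ)
  | add (i j k : ℕ)
  | mul (i j k : ℕ)

namespace NatCmd

def run : NatCmd → (ℕ → ℕ) → ℕ → ℕ
  | const i n, ρ => Function.update ρ i n
  | add i j k, ρ => Function.update ρ i (ρ j + ρ k)
  | mul i j k, ρ => Function.update ρ i (ρ j * ρ k)

def cost : NatCmd → (ℕ → ℕ) → ℕ
  | mul _ j _, ρ => 3 * ρ j + 3
  | _, _ => 1

def WellFormed : NatCmd → Prop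
  | const i _ => i < 32
  | add i j k => i < 32 ∧ j < 33 ∧ k < 33
  | mul i j k => i < 32 ∧ j < 33 ∧ k < 33 ∧ i ≠ j ∧ i ≠ k

def compile : NatCmd → Program
  | const i n => .instr (.natConst i n)
  | add i j k => .instr (.natAdd i j k)
  | mul i j k => .seq (.instr (.natConst i 0)) (forLoop 33 j (.instr (.natAdd i i k)))

/-- Composition of a list of commands, ending with a dummy instruction. -/
def compileList : List NatCmd → Program
  | [] => .instr (.natConst 33 0)
  | c :: l => .seq c.compile (compileList l)

def runList : List NatCmd → (ℕ → ℕ) → ℕ → ℕ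
  | [], ρ => ρ
  | c :: l, ρ => runList l (c.run ρ)

def costList : List NatCmd → (ℕ → ℕ) → ℕ
  | [], _ => 1
  | c :: l, ρ => c.cost ρ + costList l (c.run ρ)

variable {𝕜 : Type} [RCLike 𝕜]

lemma run_congr {c : NatCmd} (hc : c.WellFormed) {ρ ρ' : ℕ → ℕ} (h : ∀ i < 33, ρ' i = ρ i) :
    c.cost ρ' = c.cost ρ ∧ ∀ i < 33, c.run ρ' i = c.run ρ i := by
  cases c with
  | const i n =>
    refine ⟨rfl, fun l hl => ?_⟩
    simp [run, Function.update_apply, h l hl]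
  | add i j k =>
    obtain ⟨h1, h2, h3⟩ := hc
    refine ⟨rfl, fun l hl => ?_⟩
    simp [run, Function.update_apply, h l hl, h j h2, h k h3]
  | mul i j k =>
    obtain ⟨h1, h2, h3, -⟩ := hc
    refine ⟨by simp [cost, h j h2], fun l hl => ?_⟩
    simp [run, Function.update_apply, h l hl, h j h2, h k h3]

lemma runs_compile {c : NatCmd} (hc : c.WellFormed) {s : State 𝕜} (h1 : s.reg 32 = 1) :
    Runs c.compile s (c.cost s.reg)
      (fun s' => s'.arr = s.arr ∧ ∀ l < 33, s'.reg l = c.run s.reg l) := by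
  cases c with
  | const i n => exact Runs.instr ⟨rfl, fun l _ => rfl⟩
  | add i j k => exact Runs.instr ⟨rfl, fun l _ => rfl⟩
  | mul i j k =>
    obtain ⟨hi, hj, hk, hij, hik⟩ := hc
    let Inv : ℕ → State 𝕜 → Prop := fun n s' => s'.arr = s.arr ∧ s'.reg 33 = n ∧
      ∀ l < 33, s'.reg l = Function.update s.reg i (n * s.reg k) l
    refine (Runs.instrSeq (Runs.forLoop (T := 1) (N := s.reg j) (Inv := Inv) ?_ ?_ ?_)).mono
      (by simp only [cost]; lia) ?_
    · refine ⟨rfl, by simp, fun l hl => ?_⟩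
      simp [Instr.run, show l ≠ 33 by lia, Function.update_apply]
    · rintro n s' ⟨h2, h3, h4⟩
      refine ⟨?_, h3⟩
      rw [h4 j hj, Function.update_of_ne hij.symm]
    · rintro n hn s' ⟨h2, h3, h4⟩
      refine Runs.instr ⟨?_, ?_, h2, by simp, fun l hl => ?_⟩
      · simp [Instr.run, h3, show 33 ≠ i by lia]
      · simp [Instr.run, h4, show 32 ≠ i by lia, h1]
      · simp only [Instr.run, setReg_reg, show l ≠ 33 by lia, if_false, h4 i (by lia),
          h4 k hk, h4 l hl, Function.update_self, Function.update_of_ne hik.symm,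
          Function.update_apply]
        split_ifs <;> ring
    · rintro s' ⟨h2, h3, h4⟩
      exact ⟨h2, h4⟩

lemma run_one {c : NatCmd} (hc : c.WellFormed) (ρ : ℕ → ℕ) : c.run ρ 32 = ρ 32 := by
  cases c with
  | const i n => exact Function.update_of_ne (by simp [WellFormed] at hc; lia) _ _
  | add i j k => exact Function.update_of_ne (by simp [WellFormed] at hc; lia) _ _
  | mul i j k => exact Function.update_of_ne (by simp [WellFormed] at hc; lia) _ _

lemma runs_compileList (l : List NatCmd) (hl : ∀ c ∈ l, c.WellFormed) {s : State 𝕜} {ρ : ℕ → ℕ}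
    (hρ : ∀ i < 33, s.reg i = ρ i) (h1 : ρ 32 = 1) :
    Runs (compileList l) s (costList l ρ)
      (fun s' => s'.arr = s.arr ∧ ∀ i < 33, s'.reg i = runList l ρ i) := by
  induction l generalizing s ρ with
  | nil =>
    refine Runs.instr ⟨rfl, fun i hi => ?_⟩
    simp [Instr.run, runList, hρ i hi, show i ≠ 33 by lia]
  | cons c l ih =>
    have hc := hl c (by simp)
    obtain ⟨h2, h3⟩ := run_congr hc hρ
    refine (Runs.seq (runs_compile hc ((hρ 32 (by lia)).trans h1)) ?_).mono
      (by rw [costList, h2]) fun _ h => h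
    rintro s' ⟨h4, h5⟩
    refine (ih (fun c hc => hl c (by simp [hc])) (ρ := c.run ρ)
      (fun i hi => (h5 i hi).trans (h3 i hi)) ((run_one hc ρ).trans h1)).mono le_rfl ?_
    rintro s'' ⟨h6, h7⟩
    exact ⟨h6.trans h4, h7⟩

end NatCmd

section counting

variable {𝕜 : Type} [RCLike 𝕜]

/-- `while A 41 [0] < A b [R i] do A 41 [0] += A c [R j]; R l += 1`. -/
def countUp (l b i c j : ℕ) : Program :=
  .whileDo (.valLt 41 31 b i)
    (.seq (.instr (.arith .add 41 31 41 31 c j)) (.instr (.natAdd l l 32)))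

/-- `v` lists the successive values of the accumulator. The case distinction in `hv` covers an
increment that is the accumulator itself; the loop then doubles instead of adding a fixed number. -/
lemma runs_countUp {l b i c j N : ℕ} {s : State 𝕜} (v : ℕ → 𝕜) (h31 : s.reg 31 = 0)
    (h32 : s.reg 32 = 1) (hl : l ≠ 31 ∧ l ≠ 32 ∧ l ≠ i ∧ l ≠ j) (hl0 : s.reg l = 0) (hb : b ≠ 41)
    (hv0 : s.arr 41 0 = v 0)
    (hv : ∀ k, v (k + 1) = v k + if c = 41 ∧ s.reg j = 0 then v k else s.arr c (s.reg j))
    (hlt : ∀ k < N, RCLike.re (v k) < RCLike.re (s.arr b (s.reg i)))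
    (hN : ¬ RCLike.re (v N) < RCLike.re (s.arr b (s.reg i))) :
    Runs (countUp l b i c j) s (3 * N + 1) (fun s' => s'.reg = Function.update s.reg l N ∧
      ∀ e ≠ 41, s'.arr e = s.arr e) := by
  let Inv : ℕ → State 𝕜 → Prop := fun n s' => s'.reg = Function.update s.reg l n ∧
    (∀ e ≠ 41, s'.arr e = s.arr e) ∧ s'.arr 41 = Function.update (s.arr 41) 0 (v n)
  refine (Runs.whileDo (T := 2) (N := N) (Inv := Inv) ?_ ?_ ?_).mono (by lia) ?_
  · rintro k hk s' ⟨h1, h2, h3⟩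
    refine ⟨?_, Runs.instrSeq (Runs.instr ⟨?_, ?_, ?_⟩)⟩
    · simp only [Test.Holds, h1, Function.update_of_ne hl.1.symm, Function.update_of_ne hl.2.2.1.symm,
        h31, h3, Function.update_self, h2 b hb]
      exact hlt k hk
    · simp only [Instr.run]
      ext e
      simp only [setReg_reg, setArr_reg, h1, Function.update_self, Function.update_of_ne hl.2.1.symm,
        h32, Function.update_apply]
      split_ifs <;> rfl
    · intro e he
      simp [Instr.run, setArr_arr_of_ne _ he, h2 e he]
    · simp only [Instr.run, setReg_arr, h1, Function.update_of_ne hl.1.symm,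
        Function.update_of_ne hl.2.2.2.symm, h31, setArr_arr_self, h3, Function.update_self, hv,
        ArithOp.eval, Function.update_idem]
      congr 2
      by_cases hc : c = 41
      · subst hc
        simp [h3, Function.update_apply]
      · simp [h2 c hc, hc]
  · rintro s' ⟨h1, h2, h3⟩
    simp only [Test.Holds, h1, Function.update_of_ne hl.1.symm, Function.update_of_ne hl.2.2.1.symm,
        h31, h3, Function.update_self, h2 b hb]
    exact hN
  · exact ⟨by simp [← hl0], by simp, by simp [← hv0]⟩
  · rintro s' ⟨h1, h2, h3⟩
    exact ⟨h1, h2⟩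

end counting

/-- Counters derived from the numbers in registers `14, 3, 15, 16`. -/
def counters : List NatCmd :=
  -- With Q = 4e(n+5) and Z the degree bound, the registers receive: 4: Q, the Chebyshev order; 5:
  -- Q³, the length of the Taylor polynomial of sin(α arcsin y); 6: Q(2j+1), the degree of the
  -- modulus; 7 and 8: 26d and 2(n+5), the window parameters; 13: 4e; 0: Z; 9: Z⁵; 30: the array
  -- length Z⁵ + 1.
  [.const 17 5, .add 17 14 17, .const 18 4, .mul 13 18 16, .mul 4 13 17, .mul 18 4 4, .mul 5 18 4,
    .add 18 3 3, .add 18 18 2, .mul 6 4 18, .const 18 26, .mul 7 18 15, .add 8 17 17, .add 18 7 7,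
    .mul 19 18 8, .add 18 19 6, .add 0 18 2, .mul 18 0 0, .mul 19 18 18, .mul 9 19 0, .add 30 9 2]

end FieldRAM

/-! ### Integer sizes of the input and the setup phase -/

/-- Integers comparable to `log (B / ε)`, `1 / r`, `1 / δ` and `r / δ`. -/
structure Sizes (r δ B ε : ℝ) (n j d e : ℕ) : Prop where
  lt_n : ∀ k < n, 2 ^ k * ε < B
  le_n : B ≤ 2 ^ n * ε
  lt_j : ∀ k < j, k * r < 1
  le_j : 1 ≤ j * r
  lt_d : ∀ k < d, k * δ < 1
  le_d : 1 ≤ d * δ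
  lt_e : ∀ k < e, k * δ < r
  le_e : r ≤ e * δ

/-- Bound for the degree of the approximating polynomial. -/
def degreeBound (n j d e : ℕ) : ℕ :=
  -- The first product bounds the degree of `foldedTaylor`, the second together with 1 that of
  -- `windowPoly`.
  4 * e * (n + 5) * (2 * j + 1) + (26 * d + 26 * d) * (n + 5 + (n + 5)) + 1

namespace FieldRAM

/-- The counters with which `counters` is started. -/
def initialCounters (n j d e : ℕ) : ℕ → ℕ :=
  fun i => if i = 32 then 1 else if i = 2 then 1 else if i = 20 then 2 else if i = 21 then 3 else
    if i = 14 then n else if i = 3 then j else if i = 15 then d else if i = 16 then e else 0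

/-- Computation of all counters from the input. -/
def setup : Program :=
  .seq (.instr (.natConst 32 1)) <| .seq (.instr (.natConst 2 1)) <|
  .seq (.instr (.natConst 20 2)) <| .seq (.instr (.natConst 21 3)) <|
  .seq (.instr (.const 42 31 1)) <| .seq (.instr (.arith .add 41 31 1 21 40 31)) <|
  -- The accumulator starts at ε and doubles until it reaches B, which replaces the logarithm. The
  -- three later loops count multiples of r up to 1, of δ up to 1 and of δ up to r.
  .seq (countUp 14 1 20 41 31) <|
  .seq (.seq (.instr (.const 41 31 0)) (countUp 3 42 31 1 1)) <|
  .seq (.seq (.instr (.const 41 31 0)) (countUp 15 42 31 1 2)) <|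
  .seq (.seq (.instr (.const 41 31 0)) (countUp 16 1 1 1 2)) <| NatCmd.compileList counters

lemma wellFormed_counters : ∀ c ∈ counters, c.WellFormed := by
  simp [counters, NatCmd.WellFormed]

section setup

variable {𝕜 : Type} [RCLike 𝕜] {s₀ : State 𝕜}

/-- Intermediate states of `setup`, started in `s₀`. -/
structure Stage (s₀ : State 𝕜) (n j d e : ℕ) (s : State 𝕜) : Prop where
  reg : s.reg = initialCounters n j d e
  arr : ∀ i < 41, s.arr i = s₀.arr i
  one : s.arr 42 0 = 1

lemma Stage.countUp {n j d e n' j' d' e' l b i c k N : ℕ} {s : State 𝕜} (h : Stage s₀ n j d e s)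
    (v : ℕ → 𝕜) (hl : l ≠ 31 ∧ l ≠ 32 ∧ l ≠ i ∧ l ≠ k) (hl0 : initialCounters n j d e l = 0)
    (hb : b ≠ 41) (hu : Function.update (initialCounters n j d e) l N = initialCounters n' j' d' e')
    (hv0 : s.arr 41 0 = v 0)
    (hv : ∀ m, v (m + 1) = v m + if c = 41 ∧ initialCounters n j d e k = 0 then v m else
        s.arr c (initialCounters n j d e k))
    (hlt : ∀ k < N, RCLike.re (v k) < RCLike.re (s.arr b (initialCounters n j d e i)))
    (hN : ¬ RCLike.re (v N) < RCLike.re (s.arr b (initialCounters n j d e i))) :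
    Runs (countUp l b i c k) s (3 * N + 1) (Stage s₀ n' j' d' e') := by
  refine (runs_countUp v (by simp [h.reg, initialCounters]) (by simp [h.reg, initialCounters]) hl
    (by rw [h.reg, hl0]) hb hv0 (by simpa [h.reg] using hv) (by simpa [h.reg] using hlt)
    (by simpa [h.reg] using hN)).mono le_rfl ?_
  rintro s' ⟨h4, h5⟩
  exact ⟨by rw [h4, h.reg, hu], fun i hi => by rw [h5 i (by lia), h.arr i hi],
    by rw [h5 42 (by lia), h.one]⟩

/-- Counting the multiples of `x` below a bound. -/
lemma Stage.countMultiples {n j d e n' j' d' e' l b i k N : ℕ} {s : State 𝕜} (x y : ℝ)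
    (h : Stage s₀ n j d e s) (hl : l ≠ 31 ∧ l ≠ 32 ∧ l ≠ i ∧ l ≠ k)
    (hl0 : initialCounters n j d e l = 0) (hb : b ≠ 41)
    (hu : Function.update (initialCounters n j d e) l N = initialCounters n' j' d' e')
    (hx : s.arr 1 (initialCounters n j d e k) = (x : 𝕜))
    (hy : s.arr b (initialCounters n j d e i) = (y : 𝕜)) (hlt : ∀ k < N, k * x < y)
    (hN : y ≤ N * x) :
    Runs (.seq (.instr (.const 41 31 0)) (FieldRAM.countUp l b i 1 k)) s (3 * N + 2)
      (Stage s₀ n' j' d' e') := by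
  have h' : Stage s₀ n j d e (Instr.run (.const 41 31 0) s) :=
    ⟨h.reg, fun i hi => by simp [Instr.run, setArr_arr_of_ne _ (show i ≠ 41 by lia), h.arr i hi],
      by simp [Instr.run, setArr_arr_of_ne _ (show 42 ≠ 41 by lia), h.one]⟩
  refine Runs.instrSeq (h'.countUp (fun k => ((k * x : ℝ) : 𝕜)) hl hl0 hb hu ?_ ?_ ?_ ?_)
  · simp [Instr.run, h.reg, initialCounters]
  · intro m
    simp only [Instr.run, setArr_arr_of_ne _ (show 1 ≠ 41 by lia), hx]
    push_cast
    simp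
    ring
  · intro k hk
    simpa [Instr.run, setArr_arr_of_ne _ hb, hy] using hlt k hk
  · simpa [Instr.run, setArr_arr_of_ne _ hb, hy] using hN

lemma stage_start (h0 : s₀.reg = fun _ => 0) (h40 : ∀ i, s₀.arr 40 i = 0) {x : 𝕜}
    (hx : s₀.arr 1 3 = x) :
    ∃ s, Stage s₀ 0 0 0 0 s ∧ s.arr 41 0 = x ∧ ∀ {p : Program} {T : ℕ} {Q : State 𝕜 → Prop},
      Runs p s T Q → Runs (.seq (.instr (.natConst 32 1)) <| .seq (.instr (.natConst 2 1)) <|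
        .seq (.instr (.natConst 20 2)) <| .seq (.instr (.natConst 21 3)) <|
        .seq (.instr (.const 42 31 1)) <| .seq (.instr (.arith .add 41 31 1 21 40 31)) p) s₀
        (T + 6) Q := by
  refine ⟨Instr.run (.arith .add 41 31 1 21 40 31) (Instr.run (.const 42 31 1)
    (Instr.run (.natConst 21 3) (Instr.run (.natConst 20 2) (Instr.run (.natConst 2 1)
      (Instr.run (.natConst 32 1) s₀))))), ⟨?_, fun i hi => ?_, ?_⟩, ?_, fun h => ?_⟩
  · ext i
    simp only [Instr.run, setArr_reg, setReg_reg, h0, initialCounters]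
    grind
  · simp [Instr.run, setArr_arr_of_ne _ (show i ≠ 41 by lia),
      setArr_arr_of_ne _ (show i ≠ 42 by lia)]
  · simp [Instr.run, setArr_arr_of_ne _ (show 42 ≠ 41 by lia), h0]
  · simp [Instr.run, h0, setArr_arr_of_ne _ (show 1 ≠ 42 by lia),
      setArr_arr_of_ne _ (show 40 ≠ 42 by lia), hx, h40, ArithOp.eval]
  · exact (h.instrSeq.instrSeq.instrSeq.instrSeq.instrSeq.instrSeq).mono le_rfl fun _ h => h

lemma runs_setup (a : ℕ → 𝕜) {r δ B ε : ℝ} {n j d e : ℕ} (h : Sizes r δ B ε n j d e) :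
    Runs setup (inputState a r δ B ε)
      (3 * n + 3 * j + 3 * d + 3 * e + 13 + NatCmd.costList counters (initialCounters n j d e))
      (fun s => (∀ i < 41, s.arr i = (inputState a r δ B ε).arr i) ∧
        ∀ i < 33, s.reg i = NatCmd.runList counters (initialCounters n j d e) i) := by
  have h10 : (inputState a r δ B ε).arr 1 0 = (r : 𝕜) := rfl
  have h11 : (inputState a r δ B ε).arr 1 1 = (δ : 𝕜) := rfl
  have h12 : (inputState a r δ B ε).arr 1 2 = (B : 𝕜) := rfl
  have h13 : (inputState a r δ B ε).arr 1 3 = (ε : 𝕜) := rfl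
  have h40 : ∀ i, (inputState a r δ B ε).arr 40 i = 0 := fun i => rfl
  have h0 : (inputState a r δ B ε).reg = fun _ => 0 := rfl
  generalize inputState a r δ B ε = s₀ at *
  obtain ⟨s₁, hs₁, h41, hstart⟩ := stage_start h0 h40 h13
  have H₁ : Runs (countUp 14 1 20 41 31) s₁ (3 * n + 1) (Stage s₀ n 0 0 0) := by
    refine hs₁.countUp (fun k => ((2 ^ k * ε : ℝ) : 𝕜)) (by decide) rfl (by decide) ?_
      (by simp [h41]) ?_ ?_ ?_
    · ext i; simp only [Function.update_apply, initialCounters]; grind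
    · intro m
      rw [if_pos ⟨rfl, rfl⟩, ← RCLike.ofReal_add]
      congr 1
      ring
    · intro k hk
      simpa [hs₁.arr 1 (by lia), initialCounters, h12] using h.lt_n k hk
    · simpa [hs₁.arr 1 (by lia), initialCounters, h12] using h.le_n
  have H₂ : ∀ s, Stage s₀ n 0 0 0 s → Runs (.seq (.instr (.const 41 31 0)) (countUp 3 42 31 1 1)) s
      (3 * j + 2) (Stage s₀ n j 0 0) := by
    intro s hs
    refine hs.countMultiples r 1 (by decide) rfl (by decide) ?_ ?_ ?_ h.lt_j h.le_j
    · ext i; simp only [Function.update_apply, initialCounters]; grind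
    · simpa [initialCounters, hs.arr 1 (by lia)] using h10
    · simpa [initialCounters] using hs.one
  have H₃ : ∀ s, Stage s₀ n j 0 0 s → Runs (.seq (.instr (.const 41 31 0)) (countUp 15 42 31 1 2))
      s (3 * d + 2) (Stage s₀ n j d 0) := by
    intro s hs
    refine hs.countMultiples δ 1 (by decide) rfl (by decide) ?_ ?_ ?_ h.lt_d h.le_d
    · ext i; simp only [Function.update_apply, initialCounters]; grind
    · simpa [initialCounters, hs.arr 1 (by lia)] using h11
    · simpa [initialCounters] using hs.one
  have H₄ : ∀ s, Stage s₀ n j d 0 s → Runs (.seq (.instr (.const 41 31 0)) (countUp 16 1 1 1 2))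
      s (3 * e + 2) (Stage s₀ n j d e) := by
    intro s hs
    refine hs.countMultiples δ r (by decide) rfl (by decide) ?_ ?_ ?_ h.lt_e h.le_e
    · ext i; simp only [Function.update_apply, initialCounters]; grind
    · simpa [initialCounters, hs.arr 1 (by lia)] using h11
    · simpa [initialCounters, hs.arr 1 (by lia)] using h10
  have H₅ : ∀ s, Stage s₀ n j d e s → Runs (NatCmd.compileList counters) s
      (NatCmd.costList counters (initialCounters n j d e)) (fun s => (∀ i < 41, s.arr i = s₀.arr i) ∧
        ∀ i < 33, s.reg i = NatCmd.runList counters (initialCounters n j d e) i) := by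
    intro s hs
    refine (NatCmd.runs_compileList counters wellFormed_counters (ρ := initialCounters n j d e)
      (fun i hi => by rw [hs.reg]) rfl).mono le_rfl ?_
    rintro s' ⟨h4, h5⟩
    exact ⟨fun i hi => by rw [h4, hs.arr i hi], h5⟩
  generalize NatCmd.costList counters (initialCounters n j d e) = c at *
  have := hstart (H₁.seq fun s hs => (H₂ s hs).seq fun s hs => (H₃ s hs).seq fun s hs =>
    (H₄ s hs).seq H₅)
  exact this.mono (by lia) fun _ h => h

end setup

/-- The values computed by `counters`. -/
lemma runList_counters (n j d e : ℕ) :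
    let ρ := NatCmd.runList counters (initialCounters n j d e)
    let Q := 4 * e * (n + 5)
    let Z := degreeBound n j d e
    ρ 0 = Z ∧ ρ 1 = 0 ∧ ρ 2 = 1 ∧ ρ 3 = j ∧ ρ 4 = Q ∧ ρ 5 = Q ^ 3 ∧ ρ 6 = Q * (2 * j + 1) ∧
      ρ 7 = 26 * d ∧ ρ 8 = n + 5 + (n + 5) ∧ ρ 9 = Z ^ 5 ∧ ρ 13 = 4 * e ∧ ρ 30 = Z ^ 5 + 1 ∧
      ρ 31 = 0 ∧ ρ 32 = 1 := by
  intro ρ Q Z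
  have h1 : Z = (26 * d + 26 * d) * (n + 5 + (n + 5)) + 4 * e * (n + 5) * (j + j + 1) + 1 := by
    simp only [Z, degreeBound]
    ring
  rw [h1]
  refine ⟨rfl, rfl, rfl, rfl, rfl, ?_, ?_, rfl, rfl, ?_, rfl, ?_, rfl, rfl⟩
  · change Q * Q * Q = Q ^ 3
    ring
  · change Q * (j + j + 1) = Q * (2 * j + 1)
    ring
  · rw [← h1]
    change ρ 0 * ρ 0 * (ρ 0 * ρ 0) * ρ 0 = Z ^ 5
    rw [show ρ 0 = Z from h1.symm]
    ring
  · rw [← h1]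
    change ρ 0 * ρ 0 * (ρ 0 * ρ 0) * ρ 0 + 1 = Z ^ 5 + 1
    rw [show ρ 0 = Z from h1.symm]
    ring

/-- Multiplication is repeated addition and costs as much as its first factor. The largest such
factor is Z⁴, met on the way to Z⁵. -/
lemma costList_counters_le {n j d e : ℕ} (hd : 1 ≤ d) (he : 1 ≤ e) :
    3 * n + 3 * j + 3 * d + 3 * e + 13 + NatCmd.costList counters (initialCounters n j d e) ≤
      200 * (degreeBound n j d e ^ 5 + 1) := by
  set Q := 4 * e * (n + 5) with hQ
  set Z := degreeBound n j d e with hZ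
  have h1 : Z = (26 * d + 26 * d) * (n + 5 + (n + 5)) + Q * (j + j + 1) + 1 := by
    simp only [Z, degreeBound, Q]
    ring
  have h2 : NatCmd.costList counters (initialCounters n j d e) = 1 + (1 + (1 + (3 * 4 + 3 +
      (3 * (4 * e) + 3 + (3 * Q + 3 + (3 * (Q * Q) + 3 + (1 + (1 + (3 * Q + 3 + (1 + (3 * 26 + 3 +
      (1 + (1 + (3 * (26 * d + 26 * d) + 3 + (1 + (1 + (3 * Z + 3 + (3 * (Z * Z) + 3 +
      (3 * (Z * Z * (Z * Z)) + 3 + (1 + 1)))))))))))))))))))) := by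
    rw [h1]
    rfl
  have hne : n + 5 ≤ Q := by rw [hQ]; nlinarith
  have hee : 4 * e ≤ Q := by rw [hQ]; nlinarith
  have hj : Q * 1 ≤ Q * (j + j + 1) := by gcongr; lia
  have hj' : 1 * (j + j + 1) ≤ Q * (j + j + 1) := by gcongr; lia
  have hd' : (26 * d + 26 * d) * 1 ≤ (26 * d + 26 * d) * (n + 5 + (n + 5)) := by gcongr; lia
  have hQZ : Q ≤ Z := by lia
  have hQQ : Q * Q ≤ Z * Z := by gcongr
  have hZ1 : 1 ≤ Z := by lia
  have p1 : Z ≤ Z ^ 5 := Nat.le_self_pow (by lia) _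
  have p2 : Z * Z ≤ Z ^ 5 := by rw [← pow_two]; exact Nat.pow_le_pow_right hZ1 (by lia)
  have p4 : Z * Z * (Z * Z) ≤ Z ^ 5 := by
    rw [show Z * Z * (Z * Z) = Z ^ 4 by ring]; exact Nat.pow_le_pow_right hZ1 (by lia)
  rw [h2]
  lia

end FieldRAM

/-! ### Taylor polynomials of sin(a arcsin y) -/

/-- Taylor coefficients of `sin (a * arcsin y)`; entry `i` belongs to `y ^ (2 * i + 1)`. -/
noncomputable def sinArcsinCoeff (a : ℝ) : ℕ → ℝ
  | 0 => a
  | i + 1 => sinArcsinCoeff a i * (((2 * i + 1) ^ 2 - a ^ 2) / ((2 * i + 2) * (2 * i + 3)))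

/-- Taylor polynomial of `sin (a * arcsin y)`. -/
noncomputable def sinArcsinPoly (a : ℝ) (k : ℕ) : ℝ[X] :=
  ∑ i ∈ Finset.range k, C (sinArcsinCoeff a i) * X ^ (2 * i + 1)

section sinArcsin

variable {a : ℝ}

/-- All ratios are nonnegative because a ≤ 1 ≤ 2i + 1. Nonnegativity is what allows substitution
into a power series without increasing its absolute coefficient sum. -/
lemma sinArcsinCoeff_nonneg (h0 : 0 ≤ a) (h1 : a ≤ 1) (i : ℕ) : 0 ≤ sinArcsinCoeff a i := by
  induction i with
  | zero => exact h0
  | succ i ih =>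
    refine mul_nonneg ih (div_nonneg ?_ (by positivity))
    have : (0 : ℝ) ≤ i := by positivity
    nlinarith

lemma sinArcsinCoeff_le (h0 : 0 ≤ a) (h1 : a ≤ 1) (i : ℕ) : sinArcsinCoeff a i ≤ a := by
  induction i with
  | zero => exact le_rfl
  | succ i ih =>
    refine (mul_le_of_le_one_right (sinArcsinCoeff_nonneg h0 h1 i) ?_).trans ih
    rw [div_le_one (by positivity)]
    have : (0 : ℝ) ≤ i := by positivity
    nlinarith

/-- The function g = sin(a arcsin y) solves (1 - y²) g'' - y g' + a² g = 0. Truncating its series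
leaves only the one monomial that the next coefficient would cancel. -/
lemma sinArcsinPoly_ode (a : ℝ) (k : ℕ) :
    (1 - X ^ 2) * derivative (derivative (sinArcsinPoly a (k + 1))) -
      X * derivative (sinArcsinPoly a (k + 1)) + C (a ^ 2) * sinArcsinPoly a (k + 1) =
      -(C (sinArcsinCoeff a k * ((2 * k + 1) ^ 2 - a ^ 2)) * X ^ (2 * k + 1)) := by
  induction k with
  | zero =>
    simp [sinArcsinPoly, sinArcsinCoeff]
    ring
  | succ k ih =>
    have h1 : sinArcsinPoly a (k + 1 + 1) =
        sinArcsinPoly a (k + 1) + C (sinArcsinCoeff a (k + 1)) * X ^ (2 * k + 3) := by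
      rw [sinArcsinPoly, Finset.sum_range_succ]; rfl
    have h2 : derivative (C (sinArcsinCoeff a (k + 1)) * X ^ (2 * k + 3)) =
        C (sinArcsinCoeff a (k + 1) * (2 * k + 3)) * X ^ (2 * k + 2) := by
      rw [derivative_C_mul_X_pow]; push_cast; rfl
    have h3 : derivative (C (sinArcsinCoeff a (k + 1) * (2 * k + 3)) * X ^ (2 * k + 2)) =
        C (sinArcsinCoeff a (k + 1) * (2 * k + 3) * (2 * k + 2)) * X ^ (2 * k + 1) := by
      rw [derivative_C_mul_X_pow]; push_cast; rfl
    have h4 : sinArcsinCoeff a (k + 1) * (2 * k + 3) * (2 * k + 2) =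
        sinArcsinCoeff a k * ((2 * k + 1) ^ 2 - a ^ 2) := by
      rw [sinArcsinCoeff]; field_simp
    have h5 : ((2 * ((k + 1 : ℕ) : ℝ) + 1) ^ 2 - a ^ 2) = (2 * k + 3) * (2 * k + 2) +
      (2 * k + 3) - a ^ 2 := by push_cast; ring
    rw [h1, derivative_add, h2, derivative_add, h3, h5]
    have e1 : C (sinArcsinCoeff a (k + 1) * ((2 * (k : ℝ) + 3) * (2 * k + 2) +
      (2 * k + 3) - a ^ 2)) = C (sinArcsinCoeff a (k + 1) * (2 * (k : ℝ) + 3) * (2 * k + 2)) +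
      C (sinArcsinCoeff a (k + 1) * (2 * (k : ℝ) + 3)) -
      C (a ^ 2) * C (sinArcsinCoeff a (k + 1)) := by
      simp only [← C_add, ← C_mul, ← C_sub]; congr 1; ring
    rw [e1]
    rw [h4] at *
    linear_combination ih

lemma eval_sinArcsinPoly_zero (a : ℝ) (k : ℕ) : (sinArcsinPoly a k).eval 0 = 0 := by
  simp [sinArcsinPoly, eval_finsetSum]

lemma eval_derivative_sinArcsinPoly_zero (a : ℝ) (k : ℕ) :
    (derivative (sinArcsinPoly a (k + 1))).eval 0 = a := by
  induction k with
  | zero => simp [sinArcsinPoly, sinArcsinCoeff]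
  | succ k ih =>
    rw [sinArcsinPoly, Finset.sum_range_succ, ← sinArcsinPoly, derivative_add, eval_add, ih]
    simp

/-- With u(s) = p(sin s), the equation above becomes u'' + a² u = -c sin^(2k+1) s. Variation of
constants against sin(a(φ - s)) gives a function `w` running from a sin(aφ) to a p(sin φ) with
derivative -c sin^(2k+1)(s) sin(a(φ - s)). Its sign gives the first bound, its size the second. -/
lemma sinArcsin_bounds (h0 : 0 < a) (h1 : a ≤ 1) (k : ℕ) {φ : ℝ} (hφ0 : 0 ≤ φ)
    (hφ : φ ≤ Real.pi / 2) :
    (sinArcsinPoly a (k + 1)).eval (Real.sin φ) ≤ Real.sin (a * φ) ∧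
      Real.sin (a * φ) - (sinArcsinPoly a (k + 1)).eval (Real.sin φ) ≤
        10 * (k + 1) ^ 2 * a * Real.sin φ ^ (2 * k + 1) := by
  set p := sinArcsinPoly a (k + 1) with hp
  set c := sinArcsinCoeff a k * ((2 * k + 1) ^ 2 - a ^ 2) with hc
  have hk : (0 : ℝ) ≤ k := by positivity
  have hc0 : 0 ≤ c := mul_nonneg (sinArcsinCoeff_nonneg h0.le h1 k) (by nlinarith)
  have hc1 : c ≤ a * (4 * (k + 1) ^ 2) := by
    refine mul_le_mul (sinArcsinCoeff_le h0.le h1 k) (by nlinarith) (by nlinarith) h0.le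
  let w : ℝ → ℝ := fun s => p.eval (Real.sin s) * a * Real.cos (a * (φ - s)) +
    (derivative p).eval (Real.sin s) * Real.cos s * Real.sin (a * (φ - s))
  have hw : ∀ s, HasDerivAt w (-(c * Real.sin s ^ (2 * k + 1)) * Real.sin (a * (φ - s))) s := by
    intro s
    have d1 : HasDerivAt (fun s => p.eval (Real.sin s))
        ((derivative p).eval (Real.sin s) * Real.cos s) s :=
      (p.hasDerivAt (Real.sin s)).comp s (Real.hasDerivAt_sin s)
    have d2 : HasDerivAt (fun s => (derivative p).eval (Real.sin s))
        ((derivative (derivative p)).eval (Real.sin s) * Real.cos s) s :=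
      ((derivative p).hasDerivAt (Real.sin s)).comp s (Real.hasDerivAt_sin s)
    have d3 : HasDerivAt (fun s => a * (φ - s)) (-a) s := by
      simpa using ((hasDerivAt_id s).const_sub φ).const_mul a
    have d4 := d3.cos
    have d5 := d3.sin
    have := ((d1.mul_const a).mul d4).add ((d2.mul (Real.hasDerivAt_cos s)).mul d5)
    refine this.congr_deriv ?_
    have ode := congrArg (eval (Real.sin s)) (sinArcsinPoly_ode a k)
    simp only [eval_add, eval_sub, eval_mul, eval_one, eval_pow, eval_X, eval_C, eval_neg,
      ← hp, ← hc] at ode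
    rw [← ode]
    simp only [Pi.mul_apply]
    have hsc : 1 - Real.sin s ^ 2 = Real.cos s ^ 2 := by
      have := Real.sin_sq_add_cos_sq s; linarith
    rw [hsc]
    ring
  have hw0 : w 0 = a * Real.sin (a * φ) := by
    simp [w, hp, eval_sinArcsinPoly_zero, eval_derivative_sinArcsinPoly_zero]
  have hwφ : w φ = a * p.eval (Real.sin φ) := by
    simp [w]; ring
  have hpi := Real.pi_pos
  have hsin : ∀ s ∈ Set.Icc 0 φ, 0 ≤ Real.sin s ∧ Real.sin s ≤ Real.sin φ ∧
      0 ≤ Real.sin (a * (φ - s)) ∧ Real.sin (a * (φ - s)) ≤ a * φ := by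
    rintro s ⟨hs0, hs1⟩
    have h2 : 0 ≤ a * (φ - s) := mul_nonneg h0.le (by linarith)
    have h3 : a * (φ - s) ≤ a * φ := by gcongr; linarith
    have h4 : a * φ ≤ φ := mul_le_of_le_one_left hφ0 h1
    refine ⟨Real.sin_nonneg_of_nonneg_of_le_pi hs0 (by linarith),
      Real.sin_le_sin_of_le_of_le_pi_div_two (by linarith) hφ hs1,
      Real.sin_nonneg_of_nonneg_of_le_pi h2 (by linarith), (Real.sin_le h2).trans h3⟩
  have hmono : w φ ≤ w 0 := by
    refine antitoneOn_of_deriv_nonpos (convex_Icc 0 φ)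
      (fun s _ => (hw s).continuousAt.continuousWithinAt)
      (fun s _ => (hw s).differentiableAt.differentiableWithinAt) (fun s hs => ?_)
      (Set.left_mem_Icc.2 hφ0) (Set.right_mem_Icc.2 hφ0) hφ0
    rw [interior_Icc] at hs
    obtain ⟨e1, e2, e3, e4⟩ := hsin s ⟨hs.1.le, hs.2.le⟩
    rw [(hw s).deriv]
    have := mul_nonneg (mul_nonneg hc0 (pow_nonneg e1 (2 * k + 1))) e3
    linarith
  have hbound : ‖w φ - w 0‖ ≤ (c * Real.sin φ ^ (2 * k + 1) * (a * φ)) * ‖φ - 0‖ := by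
    refine (convex_Icc 0 φ).norm_image_sub_le_of_norm_hasDerivWithin_le
      (fun s _ => (hw s).hasDerivWithinAt) (fun s hs => ?_)
      (Set.left_mem_Icc.2 hφ0) (Set.right_mem_Icc.2 hφ0)
    obtain ⟨e1, e2, e3, e4⟩ := hsin s hs
    rw [norm_mul, norm_neg, Real.norm_of_nonneg (by positivity), Real.norm_of_nonneg e3]
    gcongr
    exact mul_nonneg hc0 (pow_nonneg (e1.trans e2) _)
  rw [hw0, hwφ] at hmono hbound
  have hle : p.eval (Real.sin φ) ≤ Real.sin (a * φ) := le_of_mul_le_mul_left hmono h0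
  refine ⟨hle, ?_⟩
  rw [sub_zero, Real.norm_of_nonneg hφ0, ← mul_sub, norm_mul, Real.norm_of_nonneg h0.le,
    Real.norm_of_nonpos (by linarith)] at hbound
  have hS : 0 ≤ Real.sin φ ^ (2 * k + 1) :=
    pow_nonneg (Real.sin_nonneg_of_nonneg_of_le_pi hφ0 (by linarith)) _
  have h5 : Real.sin (a * φ) - p.eval (Real.sin φ) ≤ c * Real.sin φ ^ (2 * k + 1) * φ * φ := by
    refine le_of_mul_le_mul_left ?_ h0
    nlinarith
  refine h5.trans ?_
  -- The constant 10 is 4 · 5/2, from c ≤ 4(k+1)² a and (π/2)² ≤ 5/2.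
  have h6 : φ * φ ≤ 5 / 2 := by
    have := Real.pi_lt_d2
    nlinarith
  calc c * Real.sin φ ^ (2 * k + 1) * φ * φ = (c * Real.sin φ ^ (2 * k + 1)) * (φ * φ) := by ring
    _ ≤ (a * (4 * (k + 1) ^ 2) * Real.sin φ ^ (2 * k + 1)) * (5 / 2) := by gcongr
    _ = _ := by ring

lemma eval_neg_sinArcsinPoly (k : ℕ) (y : ℝ) :
    (sinArcsinPoly a k).eval (-y) = -(sinArcsinPoly a k).eval y := by
  simp only [sinArcsinPoly, eval_finsetSum, eval_mul, eval_C, eval_pow, eval_X,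
    ← Finset.sum_neg_distrib]
  refine Finset.sum_congr rfl fun i _ => ?_
  rw [Odd.neg_pow ⟨i, rfl⟩]
  ring

lemma abs_sin_sub_sinArcsin_le (h0 : 0 < a) (h1 : a ≤ 1) (k : ℕ) {φ : ℝ}
    (hφ : |φ| ≤ Real.pi / 2) :
    |(sinArcsinPoly a (k + 1)).eval (Real.sin φ) - Real.sin (a * φ)| ≤
        10 * (k + 1) ^ 2 * a * |Real.sin φ| ^ (2 * k + 1) := by
  wlog hφ0 : 0 ≤ φ generalizing φ
  · have := this (φ := -φ) (by rwa [abs_neg]) (by linarith)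
    rw [Real.sin_neg, eval_neg_sinArcsinPoly, mul_neg, Real.sin_neg, abs_neg] at this
    rwa [neg_sub_neg, abs_sub_comm] at this
  · rw [abs_of_nonneg hφ0] at hφ
    obtain ⟨h2, h3⟩ := sinArcsin_bounds h0 h1 k hφ0 hφ
    rw [abs_sub_comm, abs_of_nonneg (by linarith), abs_of_nonneg
      (Real.sin_nonneg_of_nonneg_of_le_pi hφ0 (by linarith [Real.pi_pos]))]
    exact h3

lemma eval_one_sinArcsinPoly_le (h0 : 0 < a) (h1 : a ≤ 1) (k : ℕ) :
    (sinArcsinPoly a (k + 1)).eval 1 ≤ Real.sin (a * (Real.pi / 2)) := by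
  simpa using (sinArcsin_bounds h0 h1 k (by positivity) le_rfl).1

lemma le_eval_one_sinArcsinPoly (h0 : 0 < a) (h1 : a ≤ 1) (k : ℕ) :
    a ≤ (sinArcsinPoly a (k + 1)).eval 1 := by
  rw [sinArcsinPoly, eval_finsetSum, Finset.sum_range_succ']
  have : 0 ≤ ∑ i ∈ Finset.range k,
      eval 1 (C (sinArcsinCoeff a (i + 1)) * X ^ (2 * (i + 1) + 1)) :=
    Finset.sum_nonneg fun i _ => by simpa using sinArcsinCoeff_nonneg h0.le h1 (i + 1)
  simpa [sinArcsinCoeff] using this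

lemma abs_eval_sinArcsinPoly_le (h0 : 0 < a) (h1 : a ≤ 1) (k : ℕ) {y : ℝ} (hy : |y| ≤ 1) :
    |(sinArcsinPoly a k).eval y| ≤ (sinArcsinPoly a k).eval 1 := by
  simp only [sinArcsinPoly, eval_finsetSum, eval_mul, eval_C, eval_pow, eval_X, one_pow, mul_one]
  refine (Finset.abs_sum_le_sum_abs _ _).trans (Finset.sum_le_sum fun i _ => ?_)
  rw [abs_mul, abs_of_nonneg (sinArcsinCoeff_nonneg h0.le h1 i), abs_pow]
  exact mul_le_of_le_one_right (sinArcsinCoeff_nonneg h0.le h1 i) (pow_le_one₀ (abs_nonneg _) hy)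

end sinArcsin

/-! ### The odd multiple-angle polynomials of the sine -/

/-- The polynomials with `sin ((2 * j + 1) * θ) = sin θ * sinMulPoly j (sin θ)`. -/
noncomputable def sinMulPoly (R : Type) [CommRing R] : ℕ → R[X]
  | 0 => 1
  | 1 => (2 - 4 * X ^ 2) + 1
  | j + 2 => (2 - 4 * X ^ 2) * sinMulPoly R (j + 1) - sinMulPoly R j

section sinMulPoly

/-- The recursion is sin(x + 2θ) + sin(x - 2θ) = 2 cos(2θ) sin x with 2 cos 2θ = 2 - 4 sin² θ. -/
lemma sin_mul_eval_sinMulPoly (j : ℕ) (θ : ℝ) :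
    Real.sin θ * (sinMulPoly ℝ j).eval (Real.sin θ) = Real.sin ((2 * j + 1) * θ) := by
  have key : ∀ x : ℝ, Real.sin (x + 2 * θ) =
      (2 - 4 * Real.sin θ ^ 2) * Real.sin x - Real.sin (x - 2 * θ) := by
    intro x
    rw [Real.sin_add, Real.sin_sub, Real.cos_two_mul]
    have := Real.sin_sq_add_cos_sq θ
    have h2 : Real.cos θ ^ 2 = 1 - Real.sin θ ^ 2 := by linarith
    rw [h2]; ring
  induction j using Nat.twoStepInduction with
  | zero => simp [sinMulPoly]
  | one =>
    have := key θ
    rw [show θ - 2 * θ = -θ by ring, Real.sin_neg] at this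
    rw [show (2 * ((1 : ℕ) : ℝ) + 1) * θ = θ + 2 * θ by push_cast; ring, this]
    simp [sinMulPoly]
    ring
  | more j ih1 ih2 =>
    have := key ((2 * ((j + 1 : ℕ) : ℝ) + 1) * θ)
    rw [show (2 * ((j + 1 : ℕ) : ℝ) + 1) * θ - 2 * θ = (2 * (j : ℝ) + 1) * θ by push_cast; ring,
      ← ih1, ← ih2] at this
    rw [show (2 * ((j + 2 : ℕ) : ℝ) + 1) * θ = (2 * ((j + 1 : ℕ) : ℝ) + 1) * θ + 2 * θ by
      push_cast; ring, this]
    simp [sinMulPoly]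
    ring

lemma natDegree_sinMulPoly_le (R : Type) [CommRing R] (j : ℕ) :
    (sinMulPoly R j).natDegree ≤ 2 * j := by
  have h : (2 - 4 * X ^ 2 : R[X]).natDegree ≤ 2 := by compute_degree
  induction j using Nat.twoStepInduction with
  | zero => simp [sinMulPoly]
  | one => rw [sinMulPoly]; compute_degree
  | more j ih1 ih2 =>
    rw [sinMulPoly]
    refine (natDegree_sub_le _ _).trans (max_le (natDegree_mul_le.trans ?_) ?_) <;> lia

lemma map_sinMulPoly {R S : Type} [CommRing R] [CommRing S] (f : R →+* S) (j : ℕ) :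
    (sinMulPoly R j).map f = sinMulPoly S j := by
  induction j using Nat.twoStepInduction with
  | zero => simp [sinMulPoly]
  | one => simp [sinMulPoly]
  | more j ih1 ih2 => simp [sinMulPoly, ih1, ih2]

lemma exists_sin_eq {x : ℝ} (hx : |x| ≤ 1) : ∃ θ, |θ| ≤ Real.pi / 2 ∧ Real.sin θ = x :=
  ⟨Real.arcsin x, abs_le.2 ⟨Real.neg_pi_div_two_le_arcsin x, Real.arcsin_le_pi_div_two x⟩,
    Real.sin_arcsin (abs_le.1 hx).1 (abs_le.1 hx).2⟩

/-- Used twice: it bounds the folded variable on [-1, 1], and it makes the base of the window kernel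
decay like 1/|x|. -/
lemma abs_mul_eval_sinMulPoly_le_one (j : ℕ) {x : ℝ} (hx : |x| ≤ 1) :
    |x * (sinMulPoly ℝ j).eval x| ≤ 1 := by
  obtain ⟨θ, -, rfl⟩ := exists_sin_eq hx
  rw [sin_mul_eval_sinMulPoly]
  exact Real.abs_sin_le_one _

/-- The coefficient of highest order. -/
lemma coeff_sinMulPoly (R : Type) [CommRing R] (j : ℕ) :
    (sinMulPoly R j).coeff (2 * j) = (-4) ^ j := by
  induction j using Nat.twoStepInduction with
  | zero => simp [sinMulPoly]
  | one =>
    rw [sinMulPoly]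
    simp [coeff_one, coeff_ofNat_succ]
  | more j ih1 ih2 =>
    rw [sinMulPoly, coeff_sub, coeff_eq_zero_of_natDegree_lt (p := sinMulPoly R j)
      ((natDegree_sinMulPoly_le R j).trans_lt (by lia))]
    rw [sub_mul, coeff_sub, mul_assoc, show (4 : R[X]) = C 4 from rfl,
      show (2 : R[X]) = C 2 from rfl, coeff_C_mul, coeff_C_mul, coeff_eq_zero_of_natDegree_lt
      (p := sinMulPoly R (j + 1)) ((natDegree_sinMulPoly_le R (j + 1)).trans_lt (by lia)),
      show 2 * (j + 2) = 2 * (j + 1) + 2 by ring, coeff_X_pow_mul, ih2]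
    ring

end sinMulPoly

/-! ### Chebyshev expansions and reduction modulo T_Q -/

section chebyshev

open Polynomial.Chebyshev (T T_real_cosh T_real_cos T_eval_neg algebraMap_eval_T T_add_one T_natAbs
  T_mul_T T_neg degree_T)

lemma cosh_le_of_one_le {x : ℝ} (hx : 1 ≤ x) : ∃ τ, 0 ≤ τ ∧ Real.cosh τ = x :=
  ⟨Real.arcosh x, Real.arcosh_nonneg hx, Real.cosh_arcosh hx⟩

/-- On [1, ∞) write x = cosh τ; then T_j(x) = cosh(jτ), which grows with j. -/
lemma eval_T_mono {x : ℝ} (hx : 1 ≤ x) {i j : ℕ} (hij : i ≤ j) :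
    (T ℝ i).eval x ≤ (T ℝ j).eval x := by
  obtain ⟨τ, h0, rfl⟩ := cosh_le_of_one_le hx
  rw [T_real_cosh, T_real_cosh, Real.cosh_le_cosh, Int.cast_natCast, Int.cast_natCast,
    abs_of_nonneg (by positivity), abs_of_nonneg (by positivity)]
  gcongr

lemma one_le_eval_T {x : ℝ} (hx : 1 ≤ x) (j : ℕ) : 1 ≤ (T ℝ j).eval x := by
  simpa using eval_T_mono hx (Nat.zero_le j)

lemma abs_eval_T_le_one' (j : ℕ) {t : ℝ} (ht : |t| ≤ 1) : |(T ℝ j).eval t| ≤ 1 := by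
  rw [← Real.cos_arccos (abs_le.1 ht).1 (abs_le.1 ht).2, T_real_cos]
  exact Real.abs_cos_le_one _

lemma abs_eval_T_le {x : ℝ} (hx : 1 ≤ x) (j : ℕ) {t : ℝ} (ht : |t| ≤ x) :
    |(T ℝ j).eval t| ≤ (T ℝ j).eval x := by
  rcases le_total |t| 1 with h | h
  · exact (abs_eval_T_le_one' j h).trans (one_le_eval_T hx j)
  · have key : |(T ℝ j).eval t| = |(T ℝ j).eval (|t|)| := by
      rcases abs_choice t with h' | h' <;> rw [h']
      rw [T_eval_neg, abs_mul]
      rcases Int.units_eq_one_or (Int.negOnePow (j : ℤ)) with h'' | h'' <;> simp [h'']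
    rw [key, abs_of_nonneg (zero_le_one.trans (one_le_eval_T h j))]
    obtain ⟨τ, h0, hτ⟩ := cosh_le_of_one_le h
    obtain ⟨τ', h0', rfl⟩ := cosh_le_of_one_le hx
    rw [← hτ, Real.cosh_le_cosh, abs_of_nonneg h0, abs_of_nonneg h0'] at ht
    rw [← hτ, T_real_cosh, T_real_cosh, Real.cosh_le_cosh, abs_of_nonneg (by positivity),
      abs_of_nonneg (by positivity)]
    gcongr

variable {𝕜 : Type} [RCLike 𝕜]

lemma eval_T_ofReal (j : ℤ) (t : ℝ) : (T 𝕜 j).eval (t : 𝕜) = (((T ℝ j).eval t : ℝ) : 𝕜) :=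
  (algebraMap_eval_T (R' := 𝕜) t j).symm

/-- `ChebBound x p b` says that `p` has an expansion `∑ c_j T_j` with `∑ ‖c_j‖ T_j(x) = b`. -/
inductive ChebBound (x : ℝ) : 𝕜[X] → ℝ → Prop
  | zero : ChebBound x 0 0
  | add_T {p : 𝕜[X]} {b : ℝ} (h : ChebBound x p b) (c : 𝕜) (j : ℕ) :
      ChebBound x (p + C c * T 𝕜 j) (b + ‖c‖ * (T ℝ j).eval x)

namespace ChebBound

variable {x : ℝ} {p q : 𝕜[X]} {b d : ℝ}

lemma add (hp : ChebBound x p b) (hq : ChebBound x q d) : ChebBound x (p + q) (b + d) := by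
  induction hq with
  | zero => simpa using hp
  | add_T h c j ih => simpa [add_assoc] using ih.add_T c j

lemma const_mul (hp : ChebBound x p b) (c : 𝕜) : ChebBound x (C c * p) (‖c‖ * b) := by
  induction hp with
  | zero => simpa using ChebBound.zero
  | add_T h c' j ih =>
    have := ih.add_T (c * c') j
    rw [norm_mul, mul_assoc, ← mul_add, C_mul, mul_assoc, ← mul_add] at this
    exact this

lemma single (c : 𝕜) (j : ℕ) : ChebBound x (C c * T 𝕜 j) (‖c‖ * (T ℝ j).eval x) := by
  simpa using ChebBound.zero.add_T c j

lemma one : ChebBound x (1 : 𝕜[X]) 1 := by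
  simpa using ChebBound.single (x := x) (1 : 𝕜) 0

/-- X T_j = (T_(j+1) + T_|j-1|)/2 has nonnegative coefficients, so its absolute sum at x is its
value x T_j(x). The absolute value covers j = 0, where T_(-1) = T_1. -/
lemma X_mul (hp : ChebBound x p b) : ChebBound x (X * p) (x * b) := by
  induction hp with
  | zero => simpa using ChebBound.zero
  | add_T h c j ih =>
    have key : ∀ (R : Type) [Field R] [CharZero R], X * Chebyshev.T R j =
        C (1 / 2 : R) * Chebyshev.T R ((j + 1 : ℕ) : ℤ) + C (1 / 2 : R) *
          Chebyshev.T R (((j : ℤ) - 1).natAbs : ℤ) := by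
      intro R _ _
      have h2 : (C (1 / 2 : R) * 2 : R[X]) = 1 := by
        rw [show (2 : R[X]) = C 2 from rfl, ← Polynomial.C_mul]; norm_num
      have h1 := T_add_one R (j : ℤ)
      rw [T_natAbs, ← mul_add]
      push_cast
      rw [h1]
      linear_combination (-(X * Chebyshev.T R (j : ℤ))) * h2
    have h1 := (ih.add (ChebBound.single (x := x) (c * (1 / 2)) (j + 1))).add
      (ChebBound.single (x := x) (c * (1 / 2)) ((j : ℤ) - 1).natAbs)
    have h2 := congrArg (eval x) (key ℝ)
    simp only [eval_add, eval_mul, eval_C, eval_X] at h2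
    convert h1 using 1
    · rw [mul_add, mul_left_comm, key 𝕜, Polynomial.C_mul]; ring
    · rw [mul_add, mul_left_comm, h2, norm_mul, norm_div, norm_one, RCLike.norm_ofNat]; ring

lemma X_pow_mul (hp : ChebBound x p b) (n : ℕ) : ChebBound x (X ^ n * p) (x ^ n * b) := by
  induction n with
  | zero => simpa using hp
  | succ n ih => simpa [pow_succ', mul_assoc] using ih.X_mul

lemma sum {ι : Type} (s : Finset ι) {f : ι → 𝕜[X]} {g : ι → ℝ}
    (h : ∀ i ∈ s, ChebBound x (f i) (g i)) : ChebBound x (∑ i ∈ s, f i) (∑ i ∈ s, g i) := by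
  classical
  induction s using Finset.induction_on with
  | empty => simpa using ChebBound.zero
  | insert i s hi ih =>
    rw [Finset.sum_insert hi, Finset.sum_insert hi]
    exact (h i (by simp)).add (ih fun i hi => h i (by simp [hi]))

/-- Multiplication by a polynomial with nonnegative coefficients. -/
lemma map_mul (hp : ChebBound x p b) {q : ℝ[X]} (hq : ∀ i, 0 ≤ q.coeff i) :
    ChebBound x (q.map (algebraMap ℝ 𝕜) * p) (q.eval x * b) := by
  have : q.map (algebraMap ℝ 𝕜) * p =
      ∑ i ∈ Finset.range (q.natDegree + 1), C ((q.coeff i : ℝ) : 𝕜) * (X ^ i * p) := by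
    conv_lhs => rw [q.as_sum_range_C_mul_X_pow]
    simp [Polynomial.map_sum, Finset.sum_mul, mul_assoc]
  rw [this, eval_eq_sum_range, Finset.sum_mul]
  refine ChebBound.sum _ fun i _ => ?_
  have := (hp.X_pow_mul i).const_mul ((q.coeff i : ℝ) : 𝕜)
  rw [RCLike.norm_ofReal, abs_of_nonneg (hq i)] at this
  rwa [mul_assoc]

/-- Nonnegative coefficients make the absolute Chebyshev sum equal to the value. Hence inserting q
into a power series keeps the majorant ∑ |a_l| q(x)^l. -/
lemma map_pow {q : ℝ[X]} (hq : ∀ i, 0 ≤ q.coeff i) (n : ℕ) :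
    ChebBound x (q.map (algebraMap ℝ 𝕜) ^ n) (q.eval x ^ n) := by
  induction n with
  | zero => simpa using ChebBound.one
  | succ n ih => simpa [pow_succ'] using ih.map_mul hq

end ChebBound

lemma degree_C_mul_le {R : Type} [CommRing R] (c : R) (p : R[X]) : (C c * p).degree ≤ p.degree := by
  rw [← smul_eq_C_mul]
  exact degree_smul_le c p

/-- From 2 T_Q T_(j-Q) = T_j + T_(j-2Q) one gets T_j ≡ -T_|j-2Q| modulo T_Q, and |j - 2Q| < j when j
> Q; repeat until the index is below Q. Reaching Q itself yields the coefficient 0. That the index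
never grows keeps the bounds from growing. -/
lemma exists_T_modEq (Q : ℕ) (hQ : 1 ≤ Q) (j : ℕ) :
    ∃ (s : ℤ) (i : ℕ), |s| ≤ 1 ∧ i < Q ∧ i ≤ j ∧
      ∀ (R : Type) [CommRing R], T R Q ∣ T R j - C (s : R) * T R i := by
  induction j using Nat.strong_induction_on with
  | _ j ih =>
    rcases lt_or_ge j Q with h | h
    · exact ⟨1, j, by simp, h, le_rfl, fun R _ => by simp⟩
    · -- reflect `j` at `Q`
      by_cases hj : j = Q
      · exact ⟨0, 0, by simp, by lia, by lia, fun R _ => by simp [hj]⟩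
      obtain ⟨s, i, h1, h2, h3, h4⟩ := ih ((j : ℤ) - 2 * Q).natAbs (by lia)
      refine ⟨-s, i, by simpa using h1, h2, by lia, fun R _ => ?_⟩
      have h5 := T_mul_T R (Q : ℤ) ((j : ℤ) - Q)
      have h6 := h4 R
      rw [T_natAbs] at h6
      have e1 : (Q : ℤ) + (j - Q) = j := by ring
      have e2 : (Q : ℤ) - (j - Q) = -(j - 2 * Q) := by ring
      rw [e1, e2, T_neg] at h5
      have h7 : T R (j : ℤ) - C ((-s : ℤ) : R) * T R i =
          T R Q * (2 * T R ((j : ℤ) - Q)) - (T R ((j : ℤ) - 2 * Q) - C (s : R) * T R i) := by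
        push_cast
        rw [C_neg]
        linear_combination -h5
      rw [h7]
      exact dvd_sub (dvd_mul_right _ _) h6

/-- Reduction of a Chebyshev expansion modulo `T_Q`. -/
lemma ChebBound.exists_remainder {x : ℝ} (hx : 1 ≤ x) {p : 𝕜[X]} {b : ℝ} (h : ChebBound x p b)
    {Q : ℕ} (hQ : 1 ≤ Q) :
    ∃ u : 𝕜[X], u.degree < Q ∧ T 𝕜 Q ∣ p - u ∧
      (∀ t : ℝ, |t| ≤ x → ‖u.eval (t : 𝕜)‖ ≤ b) ∧
      (∀ t : ℝ, |t| ≤ 1 → ‖u.eval (t : 𝕜) - p.eval (t : 𝕜)‖ * (T ℝ Q).eval x ≤ 2 * b) := by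
  induction h with
  | zero => exact ⟨0, by simp, by simp, by simp, by simp⟩
  | @add_T p b h c j ih =>
    obtain ⟨u, h1, h2, h3, h4⟩ := ih
    obtain ⟨s, i, e1, e2, e3, e4⟩ := exists_T_modEq Q hQ j
    have hT := e4 𝕜
    have hs : ‖(s : 𝕜)‖ ≤ 1 := by
      have : ((s : ℝ) : 𝕜) = (s : 𝕜) := by simp
      rw [← this, RCLike.norm_ofReal]
      exact_mod_cast e1
    have hnorm : ∀ (j : ℕ) (t : ℝ), ‖(T 𝕜 j).eval (t : 𝕜)‖ = |(T ℝ j).eval t| := fun j t => by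
      rw [eval_T_ofReal, RCLike.norm_ofReal]
    by_cases hjQ : j < Q
    · refine ⟨u + C c * T 𝕜 j, ?_, ?_, fun t ht => ?_, fun t ht => ?_⟩
      · refine (degree_add_le _ _).trans_lt (max_lt h1 ((degree_C_mul_le _ _).trans_lt ?_))
        rw [degree_T]
        exact_mod_cast hjQ
      · simpa using h2
      · rw [eval_add, eval_mul, eval_C]
        refine (norm_add_le _ _).trans (add_le_add (h3 t ht) ?_)
        rw [norm_mul, hnorm]
        gcongr
        exact abs_eval_T_le hx j ht
      · rw [eval_add, eval_add, add_sub_add_right_eq_sub]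
        refine (h4 t ht).trans ?_
        have := mul_nonneg (norm_nonneg c) (zero_le_one.trans (one_le_eval_T hx j))
        linarith
    · refine ⟨u + C (c * s) * T 𝕜 i, ?_, ?_, fun t ht => ?_, fun t ht => ?_⟩
      · refine (degree_add_le _ _).trans_lt (max_lt h1 ((degree_C_mul_le _ _).trans_lt ?_))
        rw [degree_T]
        exact_mod_cast e2
      · have : p + C c * T 𝕜 j - (u + C (c * s) * T 𝕜 i) =
            (p - u) + C c * (T 𝕜 j - C (s : 𝕜) * T 𝕜 i) := by rw [Polynomial.C_mul]; ring
        rw [this]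
        exact dvd_add h2 (hT.mul_left _)
      · rw [eval_add, eval_mul, eval_C]
        refine (norm_add_le _ _).trans (add_le_add (h3 t ht) ?_)
        rw [norm_mul, norm_mul, hnorm]
        have := (abs_eval_T_le hx i ht).trans (eval_T_mono hx e3)
        calc ‖c‖ * ‖(s : 𝕜)‖ * |eval t (T ℝ i)| ≤ ‖c‖ * 1 * eval x (T ℝ j) := by gcongr
          _ = _ := by ring
      · have e5 : ‖eval (t : 𝕜) (C (c * s) * T 𝕜 i) - eval (t : 𝕜) (C c * T 𝕜 j)‖ ≤ ‖c‖ * 2 := by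
          rw [eval_mul, eval_mul, eval_C, eval_C, mul_assoc, ← mul_sub, norm_mul]
          gcongr
          refine (norm_sub_le _ _).trans ?_
          rw [norm_mul, hnorm, hnorm]
          have f1 := abs_eval_T_le_one' i ht
          have f2 := abs_eval_T_le_one' j ht
          have : ‖(s : 𝕜)‖ * |eval t (T ℝ i)| ≤ 1 * 1 := by gcongr
          linarith
        -- Replacing T_j by s T_i costs at most 2‖c‖ on [-1, 1]. As j ≥ Q, multiplying by T_Q(x) ≤
        -- T_j(x) keeps this within twice the contribution of the term to the bound.
        have e6 : (0 : ℝ) ≤ eval x (T ℝ Q) := zero_le_one.trans (one_le_eval_T hx Q)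
        have e7 : eval x (T ℝ Q) ≤ eval x (T ℝ j) := eval_T_mono hx (by lia)
        rw [eval_add, eval_add, add_sub_add_comm]
        calc _ ≤ (‖eval (t : 𝕜) u - eval (t : 𝕜) p‖ + ‖c‖ * 2) * eval x (T ℝ Q) := by
              gcongr
              exact (norm_add_le _ _).trans (by gcongr)
          _ = ‖eval (t : 𝕜) u - eval (t : 𝕜) p‖ * eval x (T ℝ Q) +
                2 * (‖c‖ * eval x (T ℝ Q)) := by ring
          _ ≤ 2 * b + 2 * (‖c‖ * eval x (T ℝ j)) := by exact add_le_add (h4 t ht) (by gcongr)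
          _ = _ := by ring

/-- The remainder modulo a monic multiple of `T_Q ∘ g`. -/
lemma comp_modByMonic_eq {p u g : 𝕜[X]} {Q : ℕ} (hQ : 1 ≤ Q) (hg : 1 ≤ g.natDegree)
    (hu : u.degree < Q) (h : T 𝕜 Q ∣ p - u) :
    (p.comp g) %ₘ (C ((T 𝕜 Q).comp g).leadingCoeff⁻¹ * (T 𝕜 Q).comp g) = u.comp g := by
  have hTdeg : (T 𝕜 Q).natDegree = Q := by simp
  have hne : (T 𝕜 Q).comp g ≠ 0 := by
    intro h0
    have := natDegree_comp (p := T 𝕜 Q) (q := g)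
    rw [h0, natDegree_zero, hTdeg] at this
    have := Nat.mul_le_mul hQ hg
    lia
  have hl : ((T 𝕜 Q).comp g).leadingCoeff ≠ 0 := leadingCoeff_ne_zero.2 hne
  have hmon : (C ((T 𝕜 Q).comp g).leadingCoeff⁻¹ * (T 𝕜 Q).comp g).Monic := by
    rw [Monic, leadingCoeff_mul, leadingCoeff_C, inv_mul_cancel₀ hl]
  obtain ⟨v, hv⟩ := h
  refine (div_modByMonic_unique (C ((T 𝕜 Q).comp g).leadingCoeff * v.comp g) _ hmon ⟨?_, ?_⟩).2
  · have h1 : p = u + T 𝕜 Q * v := by rw [← hv]; ring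
    conv_rhs => rw [h1]
    rw [add_comp, mul_comp]
    have : (C ((T 𝕜 Q).comp g).leadingCoeff⁻¹ * C ((T 𝕜 Q).comp g).leadingCoeff : 𝕜[X]) = 1 := by
      rw [← C_mul, inv_mul_cancel₀ hl, C_1]
    linear_combination ((T 𝕜 Q).comp g * v.comp g) * this
  · rw [degree_C_mul (inv_ne_zero hl)]
    by_cases hu0 : u = 0
    · rw [hu0, zero_comp, degree_zero, bot_lt_iff_ne_bot, Ne, degree_eq_bot]
      exact hne
    refine degree_lt_degree ?_
    rw [natDegree_comp, natDegree_comp, hTdeg]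
    have := (natDegree_lt_iff_degree_lt hu0).2 hu
    exact Nat.mul_lt_mul_of_pos_right this (by lia)

end chebyshev

/-! ### Numerical estimates for the truncation parameters -/

section numerics

lemma pow_le_half_of_le {v t : ℝ} (hv0 : 0 ≤ v) (hv : v ≤ 1 - t) {N : ℕ} (hN : 1 ≤ N * t) :
    v ^ N ≤ 1 / 2 := by
  calc v ^ N ≤ Real.exp (-t) ^ N := by
        gcongr
        linarith [Real.add_one_le_exp (-t)]
    _ = Real.exp (-(N * t)) := by rw [← Real.exp_nat_mul]; ring_nf
    _ ≤ Real.exp (-1) := by gcongr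
    _ ≤ 1 / 2 := by
        rw [Real.exp_neg, one_div]
        gcongr
        linarith [Real.add_one_le_exp (1 : ℝ)]

lemma sq_le_two_pow {Q : ℕ} (hQ : 4 ≤ Q) : (Q : ℝ) ^ 2 ≤ 2 ^ Q := by
  have : Q ^ 2 ≤ 2 ^ Q := by
    induction Q, hQ using Nat.le_induction with
    | base => norm_num
    | succ Q hQ ih => rw [pow_succ 2]; nlinarith
  exact_mod_cast this

end numerics

/-- Half the inverse of this number is the right end of an interval that is mapped to `[-1, 1]`. -/
noncomputable def shrink (q : ℝ) : ℝ := 2 * (1 + 1 / q) / (1 + (1 + 1 / q) ^ 2)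

section shrink

variable {q : ℝ}

lemma shrink_pos (hq : 0 < q) : 0 < shrink q := by unfold shrink; positivity

/-- With t = 1/q, `shrink q` equals 1 - t²/(2 + 2t + t²); the denominator is at least 2, and at most
5 when t ≤ 1, which gives this bound and the next one. -/
lemma one_sub_le_shrink (hq : 0 < q) : 1 - 1 / (2 * q ^ 2) ≤ shrink q := by
  have h : (0 : ℝ) < 1 / q := by positivity
  rw [shrink, le_div_iff₀ (by positivity), show 1 / (2 * q ^ 2) = (1 / q) ^ 2 / 2 by field_simp]
  generalize 1 / q = t at *
  nlinarith [pow_pos h 3, pow_pos h 4]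

lemma shrink_le (hq : 1 ≤ q) : shrink q ≤ 1 - 1 / (5 * q ^ 2) := by
  have h : (0 : ℝ) < 1 / q := by positivity
  have h1 : 1 / q ≤ 1 := (div_le_one (by linarith)).2 hq
  rw [shrink, div_le_iff₀ (by positivity), show 1 / (5 * q ^ 2) = (1 / q) ^ 2 / 5 by field_simp]
  generalize 1 / q = t at *
  nlinarith [pow_pos h 3, pow_pos h 4]

lemma one_le_inv_shrink (hq : 1 ≤ q) : 1 ≤ (shrink q)⁻¹ := by
  refine (one_le_inv₀ (shrink_pos (by linarith))).2 ((shrink_le hq).trans ?_)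
  have : 0 ≤ 1 / (5 * q ^ 2) := by positivity
  linarith

/-- The number (shrink q)⁻¹ is cosh(log ρ) with ρ = 1 + 1/q, so T_(qN) takes there the value cosh(qN
log ρ) ≥ ρ^(qN)/2, and ρ^q ≥ 2 by Bernoulli. -/
lemma two_pow_le_eval_T {q N : ℕ} (hq : 1 ≤ q) :
    2 ^ N / 2 ≤ (Chebyshev.T ℝ ((q * N : ℕ) : ℤ)).eval (shrink q)⁻¹ := by
  have hq' : (1 : ℝ) ≤ q := by exact_mod_cast hq
  have hρ : (0 : ℝ) < 1 + 1 / q := by positivity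
  have hcosh : (shrink q)⁻¹ = Real.cosh (Real.log (1 + 1 / q)) := by
    rw [Real.cosh_log hρ, shrink]
    field_simp
    ring
  rw [hcosh, Chebyshev.T_real_cosh, Real.cosh_eq]
  have h1 : Real.exp (((q * N : ℕ) : ℤ) * Real.log (1 + 1 / q)) = (1 + 1 / q) ^ (q * N) := by
    rw [Int.cast_natCast, Real.exp_nat_mul, Real.exp_log hρ]
  rw [h1, pow_mul]
  have h2 : (2 : ℝ) ≤ (1 + 1 / q) ^ q := by
    have := one_add_mul_le_pow (a := 1 / (q : ℝ)) (by linarith [show (0 : ℝ) ≤ 1 / q by positivity]) q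
    rw [mul_one_div_cancel (by positivity)] at this
    linarith
  have h3 : (2 : ℝ) ^ N ≤ ((1 + 1 / q) ^ q) ^ N := by gcongr
  have := Real.exp_pos (-(((q * N : ℕ) : ℤ) * Real.log (1 + 1 / q)))
  linarith

/-- This is why Q³ terms of the Taylor polynomial suffice. Every 5q² factors of `shrink q` halve the
product, and Q³ = q²N²Q ≥ 5q² · 5Q, so the power is at most 2^(-5Q); this beats 10 Q⁷ ≤ 2^(4Q). The
factor Q⁷ is Q powers times (Q³)² from the Taylor error. -/
lemma shrink_pow_le {q N : ℕ} (hq : 1 ≤ q) (hN : 5 ≤ N) :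
    10 * ((q * N : ℕ) : ℝ) ^ 7 * shrink q ^ ((q * N) ^ 3) ≤ (2 ^ N)⁻¹ := by
  set Q := q * N with hQ
  have hq' : (1 : ℝ) ≤ q := by exact_mod_cast hq
  have hpos := shrink_pos (q := (q : ℝ)) (by linarith)
  have hle := shrink_le hq'
  have hY1 : shrink q ≤ 1 := hle.trans (by
    have : 0 ≤ 1 / (5 * (q : ℝ) ^ 2) := by positivity
    linarith)
  have hN' : (5 : ℝ) ≤ N := by exact_mod_cast hN
  have hNQ : N ≤ Q := Nat.le_mul_of_pos_left _ (by lia)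
  have h1 : shrink q ^ (5 * q ^ 2) ≤ 1 / 2 := pow_le_half_of_le hpos.le hle (by
    push_cast
    rw [mul_one_div_cancel (by positivity)])
  have h2 : 5 * q ^ 2 * (5 * Q) ≤ Q ^ 3 := by
    have : 5 * 5 ≤ N * N := Nat.mul_le_mul hN hN
    calc 5 * q ^ 2 * (5 * Q) = 5 * 5 * (q ^ 2 * Q) := by ring
      _ ≤ N * N * (q ^ 2 * Q) := by gcongr
      _ = Q ^ 3 := by rw [hQ]; ring
  have h3 : shrink q ^ (Q ^ 3) ≤ (2 ^ (5 * Q))⁻¹ := by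
    calc shrink q ^ (Q ^ 3) ≤ shrink q ^ (5 * q ^ 2 * (5 * Q)) :=
          pow_le_pow_of_le_one hpos.le hY1 h2
      _ = (shrink q ^ (5 * q ^ 2)) ^ (5 * Q) := by rw [pow_mul]
      _ ≤ (1 / 2) ^ (5 * Q) := by gcongr
      _ = _ := by rw [one_div, inv_pow]
  rcases Nat.lt_or_ge Q 10 with hs | hs
  · -- small cases
    have h5 : (Q : ℝ) ≤ 10 := by exact_mod_cast hs.le
    have h6 : (5 : ℝ) ≤ Q := by exact_mod_cast hN.trans hNQ
    have h7 : (10 : ℝ) * Q ^ 7 ≤ 2 ^ (4 * Q) := by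
      have h5Q : 5 ≤ Q := hN.trans hNQ
      have : 10 * Q ^ 7 ≤ 2 ^ (4 * Q) := by
        interval_cases Q <;> norm_num
      exact_mod_cast this
    calc 10 * (Q : ℝ) ^ 7 * shrink q ^ (Q ^ 3) ≤ 2 ^ (4 * Q) * (2 ^ (5 * Q))⁻¹ := by gcongr
      _ = (2 ^ Q)⁻¹ := by
        rw [show 5 * Q = 4 * Q + Q by ring, pow_add]; field_simp
      _ ≤ (2 ^ N)⁻¹ := by gcongr; norm_num
  · have h7 : (10 : ℝ) * Q ^ 7 ≤ 2 ^ (4 * Q) := by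
      have h5 : (10 : ℝ) ≤ Q := by exact_mod_cast hs
      calc (10 : ℝ) * Q ^ 7 ≤ Q * Q ^ 7 := by gcongr
        _ = ((Q : ℝ) ^ 2) ^ 4 := by ring
        _ ≤ (2 ^ Q) ^ 4 := by gcongr; exact sq_le_two_pow (by lia)
        _ = _ := by rw [← pow_mul, mul_comm]
    calc 10 * (Q : ℝ) ^ 7 * shrink q ^ (Q ^ 3) ≤ 2 ^ (4 * Q) * (2 ^ (5 * Q))⁻¹ := by gcongr
      _ = (2 ^ Q)⁻¹ := by
        rw [show 5 * Q = 4 * Q + Q by ring, pow_add]; field_simp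
      _ ≤ (2 ^ N)⁻¹ := by gcongr; norm_num

lemma one_sub_inv_pow_le {q N : ℕ} (hq : 1 ≤ q) :
    (1 - 1 / (q : ℝ)) ^ (q * N) ≤ (2 ^ N)⁻¹ := by
  have hq' : (1 : ℝ) ≤ q := by exact_mod_cast hq
  have h0 : 0 ≤ 1 - 1 / (q : ℝ) := by
    have : 1 / (q : ℝ) ≤ 1 := (div_le_one (by linarith)).2 hq'
    linarith
  rw [pow_mul]
  calc ((1 - 1 / (q : ℝ)) ^ q) ^ N ≤ (1 / 2) ^ N := by
        gcongr
        exact pow_le_half_of_le h0 le_rfl (by rw [mul_one_div_cancel (by positivity)])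
    _ = _ := by rw [one_div, inv_pow]

end shrink

/-! ### The folded variable near the origin -/

section folding

/-- `sin` of the reduced angle: with `S = sin (π / (2 * (2 * j + 1)))` replaced by a lower bound. -/
lemma folding_bounds {j k q : ℕ} (hq : 1 ≤ q) {v : ℝ}
    (hv : |v| ≤ (1 - 1 / q) * (sinArcsinPoly (1 / (2 * j + 1)) (k + 1)).eval 1) :
    |v * (sinMulPoly ℝ j).eval v| ≤ shrink q ∧
      |(sinArcsinPoly (1 / (2 * j + 1)) (k + 1)).eval (v * (sinMulPoly ℝ j).eval v) - v| ≤
        10 * (k + 1) ^ 2 * (1 / (2 * j + 1)) * shrink q ^ (2 * k + 1) := by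
  set a : ℝ := 1 / (2 * j + 1) with ha
  have hj : (0 : ℝ) ≤ j := by positivity
  have ha0 : 0 < a := by positivity
  have ha1 : a ≤ 1 := by rw [ha, div_le_one (by positivity)]; linarith
  have ham : a * (2 * j + 1) = 1 := by rw [ha]; field_simp
  have hq' : (1 : ℝ) ≤ q := by exact_mod_cast hq
  have hpi := Real.pi_pos
  have hq0 : 0 < 1 / (q : ℝ) := by positivity
  have hq1 : 1 / (q : ℝ) ≤ 1 := (div_le_one (by linarith)).2 hq'
  set t : ℝ := 1 - 1 / q with ht
  have ht0 : 0 ≤ t := by linarith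
  have ht1 : t ≤ 1 := by linarith
  have haπ : a * (Real.pi / 2) ≤ Real.pi / 2 := mul_le_of_le_one_left (by positivity) ha1
  have haπ0 : 0 ≤ a * (Real.pi / 2) := by positivity
  -- concavity of the sine
  have hconc : t * Real.sin (a * (Real.pi / 2)) ≤ Real.sin (t * (a * (Real.pi / 2))) := by
    have := strictConcaveOn_sin_Icc.concaveOn.2
      (show a * (Real.pi / 2) ∈ Set.Icc 0 Real.pi from ⟨haπ0, by linarith⟩)
      (show (0 : ℝ) ∈ Set.Icc 0 Real.pi from ⟨le_rfl, hpi.le⟩) ht0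
      (show 0 ≤ 1 - t by linarith) (by ring)
    simpa using this
  have hv' : |v| ≤ Real.sin (t * (a * (Real.pi / 2))) := by
    refine hv.trans (le_trans ?_ hconc)
    gcongr
    exact eval_one_sinArcsinPoly_le ha0 ha1 k
  obtain ⟨θ, hθ, rfl⟩ := exists_sin_eq (hv'.trans (Real.sin_le_one _))
  have habs : ∀ x : ℝ, |x| ≤ Real.pi / 2 → |Real.sin x| = Real.sin |x| := by
    intro x hx
    rw [Real.abs_sin_eq_sin_abs_of_abs_le_pi (by linarith)]
  have hta : t * (a * (Real.pi / 2)) ≤ Real.pi / 2 :=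
    (mul_le_of_le_one_left haπ0 ht1).trans haπ
  have hta0 : 0 ≤ t * (a * (Real.pi / 2)) := by positivity
  have hθ' : |θ| ≤ t * (a * (Real.pi / 2)) := by
    rw [habs θ hθ] at hv'
    refine (Real.strictMonoOn_sin.le_iff_le ⟨?_, hθ⟩ ⟨?_, hta⟩).1 hv'
    · linarith [abs_nonneg θ]
    · linarith
  rw [sin_mul_eval_sinMulPoly]
  -- The angle φ stays within [-π/2, π/2]: v lies in the first monotone branch, where folding can be
  -- undone.
  set φ := (2 * (j : ℝ) + 1) * θ with hφ
  have haφ : a * φ = θ := by rw [hφ, ← mul_assoc, ham, one_mul]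
  have hφ1 : |φ| ≤ t * (Real.pi / 2) := by
    rw [hφ, abs_mul, abs_of_nonneg (by positivity : (0 : ℝ) ≤ 2 * j + 1)]
    calc (2 * (j : ℝ) + 1) * |θ| ≤ (2 * j + 1) * (t * (a * (Real.pi / 2))) := by gcongr
      _ = (a * (2 * j + 1)) * (t * (Real.pi / 2)) := by ring
      _ = _ := by rw [ham, one_mul]
  have hφ2 : |φ| ≤ Real.pi / 2 := hφ1.trans (mul_le_of_le_one_left (by positivity) ht1)
  -- The distance of |φ| from π/2 is at least π/(2q), so the sine is at most cos(π/(2q)) ≤ 1 -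
  -- 1/(2q²), the lower bound known for `shrink q`.
  have hY : |Real.sin φ| ≤ shrink q := by
    rw [habs φ hφ2]
    calc Real.sin |φ| ≤ Real.sin (t * (Real.pi / 2)) :=
          Real.sin_le_sin_of_le_of_le_pi_div_two (by linarith [abs_nonneg φ])
            (mul_le_of_le_one_left (by positivity) ht1) hφ1
      _ = Real.cos (Real.pi / 2 * (1 / q)) := by
          rw [← Real.cos_pi_div_two_sub]; congr 1; rw [ht]; ring
      _ ≤ 1 - 2 / Real.pi ^ 2 * (Real.pi / 2 * (1 / q)) ^ 2 := by
          refine Real.cos_le_one_sub_mul_cos_sq ?_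
          rw [abs_of_nonneg (by positivity)]
          nlinarith
      _ = 1 - 1 / (2 * (q : ℝ) ^ 2) := by field_simp
      _ ≤ shrink q := one_sub_le_shrink (by linarith)
  refine ⟨hY, ?_⟩
  have := abs_sin_sub_sinArcsin_le ha0 ha1 k hφ2
  rw [haφ] at this
  refine this.trans ?_
  gcongr

end folding

/-! ### The folded Taylor polynomial -/

section construction

/-- The expansion variable: `sin ((2 * j + 1) * arcsin (β * x))`. -/
noncomputable def foldPoly (j : ℕ) (β : ℝ) : ℝ[X] :=
  (C β * X) * (sinMulPoly ℝ j).comp (C β * X)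

/-- The scaling factor for `foldPoly`. -/
noncomputable def foldScale (R : ℝ) (j k : ℕ) : ℝ :=
  (sinArcsinPoly (1 / (2 * j + 1)) k).eval 1 / R

/-- An approximate left inverse of `foldPoly`. -/
noncomputable def unfoldPoly (β : ℝ) (j k : ℕ) : ℝ[X] :=
  C β⁻¹ * sinArcsinPoly (1 / (2 * j + 1)) k

/-- A multiple of a Chebyshev polynomial of the rescaled expansion variable. -/
noncomputable def foldModulus (β Y : ℝ) (j Q : ℕ) : ℝ[X] :=
  (Chebyshev.T ℝ (Q : ℤ)).comp (C Y⁻¹ * foldPoly j β)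

/-- A polynomial that is bounded on `[-1, 1]` and close to the power series on a smaller
interval. -/
noncomputable def foldedTaylor {𝕜 : Type} [RCLike 𝕜] (a : ℕ → 𝕜) (R : ℝ) (j k q Q : ℕ) : 𝕜[X] :=
  (∑ l ∈ Finset.range Q, C (a l) *
    (((unfoldPoly (foldScale R j k) j k).comp (foldPoly j (foldScale R j k))).map
      (algebraMap ℝ 𝕜)) ^ l) %ₘ
    (C (foldModulus (foldScale R j k) (shrink q) j Q).leadingCoeff⁻¹ *
      foldModulus (foldScale R j k) (shrink q) j Q).map (algebraMap ℝ 𝕜)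

variable {𝕜 : Type} [RCLike 𝕜]

lemma eval_map_algebraMap_ofReal (p : ℝ[X]) (x : ℝ) :
    (p.map (algebraMap ℝ 𝕜)).eval (x : 𝕜) = ((p.eval x : ℝ) : 𝕜) := by
  rw [eval_map]
  exact eval₂_at_apply (algebraMap ℝ 𝕜) x

lemma eval_foldPoly (j : ℕ) (β x : ℝ) :
    (foldPoly j β).eval x = (β * x) * (sinMulPoly ℝ j).eval (β * x) := by
  simp [foldPoly]

/-- The exact degree matters: the remainder routine is told the degree of its modulus by a register.
The composed factor is nonzero since `sinMulPoly` takes the value 2j + 1 at 0. -/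
lemma natDegree_foldPoly {j : ℕ} {β : ℝ} (hβ : β ≠ 0) : (foldPoly j β).natDegree = 2 * j + 1 := by
  have h1 : (sinMulPoly ℝ j).natDegree = 2 * j := by
    refine le_antisymm (natDegree_sinMulPoly_le ℝ j) (le_natDegree_of_ne_zero ?_)
    rw [coeff_sinMulPoly]
    exact pow_ne_zero _ (by norm_num)
  have h2 : (C β * X : ℝ[X]).natDegree = 1 := natDegree_C_mul_X _ hβ
  have h3 : (sinMulPoly ℝ j).comp (C β * X) ≠ 0 := by
    intro h
    have h4 := congrArg (eval 0) h
    have h5 : ∀ i, (sinMulPoly ℝ i).eval 0 = 2 * i + 1 := by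
      intro i
      induction i using Nat.twoStepInduction with
      | zero => simp [sinMulPoly]
      | one => simp [sinMulPoly]
      | more i ih1 ih2 =>
        simp [sinMulPoly, ih1, ih2]
        ring
    simp only [eval_comp, eval_mul, eval_C, eval_X, mul_zero, eval_zero, h5] at h4
    exact absurd h4 (by positivity)
  rw [foldPoly, natDegree_mul (by intro h; simp [h] at h2) h3, natDegree_comp, h1, h2]
  ring

lemma natDegree_foldModulus {j Q : ℕ} {β Y : ℝ} (hβ : β ≠ 0) (hY : Y ≠ 0) :
    (foldModulus β Y j Q).natDegree = Q * (2 * j + 1) := by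
  rw [foldModulus, natDegree_comp, natDegree_C_mul (inv_ne_zero hY), natDegree_foldPoly hβ]
  simp

lemma coeff_comp_C_mul_X {R : Type} [CommRing R] (p : R[X]) (c : R) (i : ℕ) :
    (p.comp (C c * X)).coeff i = p.coeff i * c ^ i := by
  exact comp_C_mul_X_coeff

lemma sinArcsinPoly_coeff_nonneg {b : ℝ} (h0 : 0 ≤ b) (h1 : b ≤ 1) (k i : ℕ) :
    0 ≤ (sinArcsinPoly b k).coeff i := by
  rw [sinArcsinPoly, finsetSum_coeff]
  refine Finset.sum_nonneg fun l _ => ?_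
  rw [coeff_C_mul_X_pow]
  split_ifs
  · exact sinArcsinCoeff_nonneg h0 h1 l
  · exact le_rfl

lemma norm_pow_sub_pow_le {x y : 𝕜} {R : ℝ} (hx : ‖x‖ ≤ R) (hy : ‖y‖ ≤ R) (l : ℕ) :
    ‖x ^ (l + 1) - y ^ (l + 1)‖ ≤ (l + 1) * R ^ l * ‖x - y‖ := by
  have hR : 0 ≤ R := (norm_nonneg x).trans hx
  induction l with
  | zero => simp
  | succ l ih =>
    have : x ^ (l + 1 + 1) - y ^ (l + 1 + 1) = x * (x ^ (l + 1) - y ^ (l + 1)) +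
      (x - y) * y ^ (l + 1) := by ring
    rw [this]
    refine (norm_add_le _ _).trans ?_
    rw [norm_mul, norm_mul, norm_pow]
    calc ‖x‖ * ‖x ^ (l + 1) - y ^ (l + 1)‖ + ‖x - y‖ * ‖y‖ ^ (l + 1)
        ≤ R * ((l + 1) * R ^ l * ‖x - y‖) + ‖x - y‖ * R ^ (l + 1) := by gcongr
      _ = _ := by push_cast; ring

/-- Partial sums of a power series at nearby points of its disk of convergence. -/
lemma norm_sum_sub_le {a : ℕ → 𝕜} {R B : ℝ} (hR : 0 < R) (hs : Summable fun k => ‖a k‖ * R ^ k)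
    (hB : ∑' k, ‖a k‖ * R ^ k ≤ B) {x v : 𝕜} (hx : ‖x‖ ≤ R) (hv : ‖v‖ ≤ R) (Q : ℕ) :
    ‖∑ l ∈ Finset.range Q, a l * v ^ l - ∑ l ∈ Finset.range Q, a l * x ^ l‖ ≤
      Q * B * (‖v - x‖ / R) := by
  rw [← Finset.sum_sub_distrib]
  refine (norm_sum_le _ _).trans ?_
  have key : ∀ l ∈ Finset.range Q, ‖a l * v ^ l - a l * x ^ l‖ ≤
      (‖a l‖ * R ^ l) * (Q * (‖v - x‖ / R)) := by
    intro l hl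
    rw [← mul_sub, norm_mul, mul_assoc]
    gcongr
    cases l with
    | zero => simp; positivity
    | succ l =>
      refine (norm_pow_sub_pow_le hv hx l).trans ?_
      have : (l : ℝ) + 1 ≤ Q := by
        have := (Finset.mem_range.1 hl).le
        exact_mod_cast this
      calc ((l : ℝ) + 1) * R ^ l * ‖v - x‖ ≤ Q * R ^ l * ‖v - x‖ := by gcongr
        _ = R ^ (l + 1) * (Q * (‖v - x‖ / R)) := by rw [pow_succ]; field_simp
  refine (Finset.sum_le_sum key).trans ?_
  rw [← Finset.sum_mul]
  have h1 : ∑ l ∈ Finset.range Q, ‖a l‖ * R ^ l ≤ B :=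
    (hs.sum_le_tsum _ fun i _ => by positivity).trans hB
  calc _ ≤ B * (Q * (‖v - x‖ / R)) := by gcongr
    _ = _ := by ring

/-- From order Q on, each term is at most t^Q times the corresponding term of the majorant. -/
lemma norm_tail_le {a : ℕ → 𝕜} {R B t : ℝ} (hR : 0 < R) (ht0 : 0 ≤ t) (ht1 : t ≤ 1)
    (hs : Summable fun k => ‖a k‖ * R ^ k) (hB : ∑' k, ‖a k‖ * R ^ k ≤ B) {x f : 𝕜}
    (hx : ‖x‖ ≤ t * R) (hf : HasSum (fun k => a k * x ^ k) f) (Q : ℕ) :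
    ‖∑ l ∈ Finset.range Q, a l * x ^ l - f‖ ≤ t ^ Q * B := by
  have h1 : HasSum (fun k => a (k + Q) * x ^ (k + Q)) (f - ∑ l ∈ Finset.range Q, a l * x ^ l) := by
    rwa [hasSum_nat_add_iff' (f := fun k => a k * x ^ k)]
  have h2 : Summable fun k => ‖a (k + Q)‖ * R ^ (k + Q) :=
    (summable_nat_add_iff (f := fun k => ‖a k‖ * R ^ k) Q).2 hs
  rw [norm_sub_rev, ← h1.tsum_eq]
  have h3 : ∀ k, ‖a (k + Q) * x ^ (k + Q)‖ ≤ t ^ Q * (‖a (k + Q)‖ * R ^ (k + Q)) := by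
    intro k
    rw [norm_mul, norm_pow]
    calc ‖a (k + Q)‖ * ‖x‖ ^ (k + Q) ≤ ‖a (k + Q)‖ * (t * R) ^ (k + Q) := by gcongr
      _ = t ^ (k + Q) * (‖a (k + Q)‖ * R ^ (k + Q)) := by rw [mul_pow]; ring
      _ ≤ t ^ Q * (‖a (k + Q)‖ * R ^ (k + Q)) := by
          gcongr ?_ * _
          exact pow_le_pow_of_le_one ht0 ht1 (by lia)
  refine (tsum_of_norm_bounded (h2.mul_left _).hasSum h3).trans ?_
  rw [tsum_mul_left]
  gcongr
  have := hs.sum_add_tsum_nat_add Q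
  have h4 : 0 ≤ ∑ l ∈ Finset.range Q, ‖a l‖ * R ^ l := Finset.sum_nonneg fun i _ => by positivity
  linarith

/-- The approximation, without a cut-off outside the interval of interest. -/
theorem foldedTaylor_spec {f : ℝ → 𝕜} {a : ℕ → 𝕜} {r δ B : ℝ} (hr : 0 < r) (hδ : 0 < δ)
    (hδr : δ ≤ r)
    (hf : ∀ x ∈ Set.Icc (-r - δ) (r + δ), HasSum (fun k => a k * (x : 𝕜) ^ k) (f x))
    (hs : Summable (fun k => ‖a k‖ * (r + δ) ^ k)) (hB : ∑' k, ‖a k‖ * (r + δ) ^ k ≤ B)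
    {j e N : ℕ} (hj : 1 ≤ j * r) (he : r ≤ e * δ) (hN : 5 ≤ N) :
    let p := foldedTaylor a (r + δ) j ((4 * e * N) ^ 3) (4 * e) (4 * e * N)
    p.natDegree < 4 * e * N * (2 * j + 1) ∧ (∀ x : ℝ, |x| ≤ 1 → ‖p.eval (x : 𝕜)‖ ≤ B) ∧
      ∀ x : ℝ, |x| ≤ r + δ / 2 → ‖p.eval (x : 𝕜) - f x‖ ≤ 6 * B * (2 ^ N)⁻¹ := by
  intro p
  set R := r + δ with hRdef
  have hR : 0 < R := by positivity
  have hB0 : 0 ≤ B := (tsum_nonneg fun k => by positivity).trans hB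
  have he1 : 1 ≤ e := by
    by_contra h
    have : e = 0 := by lia
    simp [this] at he
    linarith
  set q := 4 * e with hqdef
  have hq : 1 ≤ q := by lia
  have hq' : (1 : ℝ) ≤ q := by exact_mod_cast hq
  set Q := q * N with hQdef
  have hQ1 : 1 ≤ Q := Nat.mul_pos (by lia) (by lia)
  -- The Taylor estimates are stated for length k + 1.
  obtain ⟨k, hk⟩ : ∃ k, Q ^ 3 = k + 1 := ⟨Q ^ 3 - 1, by have := Nat.pow_pos (n := 3) hQ1; lia⟩
  have hp : p = foldedTaylor a R j (k + 1) q Q := by rw [← hk]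
  set α : ℝ := 1 / (2 * j + 1) with hα
  have hj0 : (0 : ℝ) ≤ j := by positivity
  have hα0 : 0 < α := by positivity
  have hα1 : α ≤ 1 := by rw [hα, div_le_one (by positivity)]; linarith
  set h := sinArcsinPoly α (k + 1) with hh
  set S := h.eval 1 with hS
  have hαS : α ≤ S := le_eval_one_sinArcsinPoly hα0 hα1 k
  have hS0 : 0 < S := hα0.trans_le hαS
  -- Here βR = S ≤ sin(απ/2), so [-R, R] stays inside the first monotone branch, and the unfolding
  -- takes 1 exactly to R.
  set β := foldScale R j (k + 1) with hβdef
  have hβ : β = S / R := rfl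
  have hβ0 : 0 < β := by rw [hβ]; positivity
  have hβR : β * R = S := by rw [hβ]; field_simp
  -- From 1 ≤ jr follows S ≤ 2α = 2/(2j + 1) ≤ r. Hence β ≤ 1, and the folded variable is bounded by
  -- 1 on all of [-1, 1].
  have hS1 : S ≤ R := by
    have h1 : S ≤ Real.sin (α * (Real.pi / 2)) := eval_one_sinArcsinPoly_le hα0 hα1 k
    have h2 : Real.sin (α * (Real.pi / 2)) ≤ α * (Real.pi / 2) := Real.sin_le (by positivity)
    have h3 : α * (Real.pi / 2) ≤ α * 2 := by
      gcongr; linarith [Real.pi_le_four]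
    have h4 : α * 2 ≤ r := by
      rw [hα, div_mul_eq_mul_div, one_mul, div_le_iff₀ (by positivity)]
      nlinarith
    linarith
  have hβ1 : β ≤ 1 := by rw [hβ, div_le_one hR]; exact hS1
  set Y := shrink q with hY
  have hY0 : 0 < Y := shrink_pos (by linarith)
  have hx0 : 1 ≤ Y⁻¹ := one_le_inv_shrink hq'
  set y := foldPoly j β with hy
  -- the expansion in the rescaled variable
  set G : ℝ[X] := (unfoldPoly β j (k + 1)).comp (C Y * X) with hG
  have hGcoeff : ∀ i, 0 ≤ G.coeff i := by
    intro i
    rw [hG, coeff_comp_C_mul_X, unfoldPoly, coeff_C_mul]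
    have := sinArcsinPoly_coeff_nonneg hα0.le hα1 (k + 1) i
    positivity
  -- The point Y⁻¹ corresponds to y = 1, where the unfolding equals R; so the majorant ∑ |a_l| R^l
  -- carries over without loss.
  have hGeval : G.eval Y⁻¹ = R := by
    rw [hG, eval_comp, unfoldPoly, ← hα, ← hh]
    simp only [eval_mul, eval_C, eval_X, mul_inv_cancel₀ hY0.ne']
    rw [← hS, hβ]
    field_simp
  set F : 𝕜[X] := ∑ l ∈ Finset.range Q, C (a l) * (G.map (algebraMap ℝ 𝕜)) ^ l with hF
  have hFbound : ChebBound Y⁻¹ F (∑ l ∈ Finset.range Q, ‖a l‖ * R ^ l) :=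
    ChebBound.sum _ fun l _ => by
      have := (ChebBound.map_pow (𝕜 := 𝕜) (x := Y⁻¹) hGcoeff l).const_mul (a l)
      rwa [hGeval] at this
  have hsumB : ∑ l ∈ Finset.range Q, ‖a l‖ * R ^ l ≤ B :=
    (hs.sum_le_tsum _ fun i _ => by positivity).trans hB
  obtain ⟨u, hu1, hu2, hu3, hu4⟩ := hFbound.exists_remainder hx0 hQ1
  set g : ℝ[X] := C Y⁻¹ * y with hg
  have hgdeg : g.natDegree = 2 * j + 1 := by
    rw [hg, natDegree_C_mul (inv_ne_zero hY0.ne'), hy, natDegree_foldPoly hβ0.ne']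
  have hgdeg' : (g.map (algebraMap ℝ 𝕜)).natDegree = 2 * j + 1 := by rw [natDegree_map, hgdeg]
  -- Composing with g turns the congruence modulo T_Q into one modulo the monic multiple of T_Q ∘ g,
  -- so the remainder taken in x is the Chebyshev reduction u in disguise.
  have hpu : p = u.comp (g.map (algebraMap ℝ 𝕜)) := by
    have h1 : F.comp (g.map (algebraMap ℝ 𝕜)) = ∑ l ∈ Finset.range Q, C (a l) *
        (((unfoldPoly β j (k + 1)).comp y).map (algebraMap ℝ 𝕜)) ^ l := by
      have h2 : G.comp g = (unfoldPoly β j (k + 1)).comp y := by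
        rw [hG, comp_assoc, hg]
        congr 1
        rw [mul_comp, C_comp, X_comp, ← mul_assoc, ← C_mul, mul_inv_cancel₀ hY0.ne', C_1, one_mul]
      rw [← h2, hF, ← coe_compRingHom_apply, map_sum]
      refine Finset.sum_congr rfl fun l _ => ?_
      rw [coe_compRingHom_apply, mul_comp, C_comp, pow_comp, Polynomial.map_comp (algebraMap ℝ 𝕜) G g]
    have h3 : (Chebyshev.T 𝕜 (Q : ℤ)).comp (g.map (algebraMap ℝ 𝕜)) =
        (foldModulus β Y j Q).map (algebraMap ℝ 𝕜) := by
      rw [foldModulus, Polynomial.map_comp, Chebyshev.map_T]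
    have h4 := comp_modByMonic_eq hQ1 (by rw [hgdeg']; lia) hu1 hu2 (g := g.map (algebraMap ℝ 𝕜))
    rw [h1, h3, leadingCoeff_map] at h4
    rw [hp, ← h4, foldedTaylor, Polynomial.map_mul, map_C, map_inv₀]
  have heval : ∀ x : ℝ, p.eval (x : 𝕜) = u.eval ((g.eval x : ℝ) : 𝕜) := by
    intro x
    rw [hpu, eval_comp]
    congr 1
    exact eval_map_algebraMap_ofReal g x
  have hgx : ∀ x, g.eval x = Y⁻¹ * ((β * x) * (sinMulPoly ℝ j).eval (β * x)) := by
    intro x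
    rw [hg, eval_mul, eval_C, hy, eval_foldPoly]
  refine ⟨?_, fun x hx => ?_, fun x hx => ?_⟩
  · rw [hpu, natDegree_comp, hgdeg']
    refine Nat.mul_lt_mul_of_pos_right ?_ (by lia)
    by_cases hu0 : u = 0
    · rw [hu0, natDegree_zero]; lia
    · exact (natDegree_lt_iff_degree_lt hu0).2 hu1
  · rw [heval]
    refine (hu3 _ ?_).trans hsumB
    rw [hgx, abs_mul, abs_of_pos (inv_pos.2 hY0)]
    refine mul_le_of_le_one_right (inv_pos.2 hY0).le (abs_mul_eval_sinMulPoly_le_one j ?_)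
    rw [abs_mul, abs_of_pos hβ0]
    exact mul_le_one₀ hβ1 (abs_nonneg _) hx
  -- R ≤ 2r ≤ 2eδ, so q = 4e gives R/q ≤ δ/2.
  · have hδ2 : r + δ / 2 ≤ (1 - 1 / (q : ℝ)) * R := by
      have h1 : (q : ℝ) = 4 * e := by rw [hqdef]; push_cast; ring
      have h2 : (0 : ℝ) < e := by exact_mod_cast he1
      have h3 : 1 / (q : ℝ) * R ≤ δ / 2 := by
        rw [h1, one_div_mul_eq_div, div_le_iff₀ (by positivity)]
        nlinarith
      rw [sub_mul, one_mul]
      linarith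
    have hv : |β * x| ≤ (1 - 1 / (q : ℝ)) * S := by
      rw [abs_mul, abs_of_pos hβ0]
      calc β * |x| ≤ β * ((1 - 1 / (q : ℝ)) * R) := by gcongr; linarith
        _ = (1 - 1 / (q : ℝ)) * (β * R) := by ring
        _ = _ := by rw [hβR]
    obtain ⟨hb1, hb2⟩ := folding_bounds hq hv
    have hq0 : 0 ≤ 1 - 1 / (q : ℝ) := by
      have : 1 / (q : ℝ) ≤ 1 := (div_le_one (by linarith)).2 hq'
      linarith
    have hq1 : 1 - 1 / (q : ℝ) ≤ 1 := by
      have : 0 ≤ 1 / (q : ℝ) := by positivity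
      linarith
    set yx := β * x * (sinMulPoly ℝ j).eval (β * x) with hyx
    have hxR : ‖(x : 𝕜)‖ ≤ (1 - 1 / (q : ℝ)) * R := by
      rw [RCLike.norm_ofReal]; exact hx.trans hδ2
    have hxR' : ‖(x : 𝕜)‖ ≤ R := hxR.trans (mul_le_of_le_one_left hR.le hq1)
    -- The point recovered from x by folding and then unfolding; it differs from x only by the
    -- Taylor error.
    set v : ℝ := β⁻¹ * h.eval yx with hvdef
    have hyx1 : |yx| ≤ 1 := hb1.trans ((one_le_inv₀ hY0).1 hx0)
    have hvR : ‖(v : 𝕜)‖ ≤ R := by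
      rw [RCLike.norm_ofReal, hvdef, abs_mul, abs_of_pos (inv_pos.2 hβ0)]
      have := abs_eval_sinArcsinPoly_le hα0 hα1 (k + 1) hyx1
      calc β⁻¹ * |h.eval yx| ≤ β⁻¹ * S := by gcongr
        _ = R := by rw [← hβR]; field_simp
    have hvx : ‖(v : 𝕜) - x‖ / R ≤ 10 * (k + 1) ^ 2 * Y ^ (2 * k + 1) := by
      rw [← RCLike.ofReal_sub, RCLike.norm_ofReal, div_le_iff₀ hR]
      have h1 : v - x = β⁻¹ * (h.eval yx - β * x) := by
        rw [mul_sub, ← mul_assoc β⁻¹ β x, inv_mul_cancel₀ hβ0.ne', one_mul]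
      rw [h1, abs_mul, abs_of_pos (inv_pos.2 hβ0)]
      calc β⁻¹ * |h.eval yx - β * x| ≤
            β⁻¹ * (10 * (k + 1) ^ 2 * α * Y ^ (2 * k + 1)) := by gcongr
        _ ≤ β⁻¹ * (10 * (k + 1) ^ 2 * S * Y ^ (2 * k + 1)) := by gcongr
        _ = 10 * (k + 1) ^ 2 * Y ^ (2 * k + 1) * (β⁻¹ * S) := by ring
        _ = _ := by rw [← hβR, ← mul_assoc β⁻¹ β R, inv_mul_cancel₀ hβ0.ne', one_mul]
    have hF_eval : F.eval ((g.eval x : ℝ) : 𝕜) = ∑ l ∈ Finset.range Q, a l * (v : 𝕜) ^ l := by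
      have h1 : G.eval (g.eval x) = v := by
        rw [hG, eval_comp, hgx, unfoldPoly, ← hα, ← hh]
        simp only [eval_mul, eval_C, eval_X]
        rw [← hyx, ← mul_assoc Y, mul_inv_cancel₀ hY0.ne', one_mul]
      rw [hF, eval_finsetSum]
      refine Finset.sum_congr rfl fun l _ => ?_
      rw [eval_mul, eval_C, eval_pow, ← h1]
      congr 2
      exact eval_map_algebraMap_ofReal G (g.eval x)
    have hgx1 : |g.eval x| ≤ 1 := by
      rw [hgx, abs_mul, abs_of_pos (inv_pos.2 hY0)]
      calc Y⁻¹ * |yx| ≤ Y⁻¹ * Y := by gcongr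
        _ = 1 := inv_mul_cancel₀ hY0.ne'
    -- The three errors: Chebyshev reduction, 4B/2^N here; replacing v by x, B/2^N; the tail of the
    -- power series, B/2^N.
    have hE1 : ‖u.eval ((g.eval x : ℝ) : 𝕜) - F.eval ((g.eval x : ℝ) : 𝕜)‖ ≤ 4 * B * (2 ^ N)⁻¹ := by
      have h1 := hu4 _ hgx1
      have h2 : (2 : ℝ) ^ N / 2 ≤ (Chebyshev.T ℝ (Q : ℤ)).eval Y⁻¹ := two_pow_le_eval_T hq
      have h3 : ‖u.eval ((g.eval x : ℝ) : 𝕜) - F.eval ((g.eval x : ℝ) : 𝕜)‖ * (2 ^ N / 2) ≤ 2 * B :=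
        (mul_le_mul_of_nonneg_left h2 (norm_nonneg _)).trans (h1.trans (by linarith))
      rw [← le_div_iff₀ (by positivity)] at h3
      refine h3.trans (le_of_eq ?_)
      field_simp
      ring
    have hE2 := norm_sum_sub_le hR hs hB hxR' hvR Q
    have hE2' : (Q : ℝ) * B * (‖(v : 𝕜) - x‖ / R) ≤ B * (2 ^ N)⁻¹ := by
      calc (Q : ℝ) * B * (‖(v : 𝕜) - x‖ / R) ≤
            Q * B * (10 * (k + 1) ^ 2 * Y ^ (2 * k + 1)) := by gcongr
        _ ≤ Q * B * (10 * (k + 1) ^ 2 * Y ^ (Q ^ 3)) := by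
            gcongr _ * (_ * ?_)
            exact pow_le_pow_of_le_one hY0.le ((one_le_inv₀ hY0).1 hx0) (by lia)
        _ = B * (10 * Q ^ 7 * Y ^ (Q ^ 3)) := by
            have : (k : ℝ) + 1 = Q ^ 3 := by exact_mod_cast hk.symm
            rw [this]; ring
        _ ≤ _ := by
            gcongr
            exact shrink_pow_le hq hN
    have hxmem : x ∈ Set.Icc (-r - δ) (r + δ) := by
      have := abs_le.1 hx
      constructor <;> linarith
    have hE3 := norm_tail_le hR hq0 hq1 hs hB hxR (hf x hxmem) Q
    have hE3' : (1 - 1 / (q : ℝ)) ^ Q * B ≤ B * (2 ^ N)⁻¹ := by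
      rw [mul_comm]
      gcongr
      exact one_sub_inv_pow_le hq
    rw [heval]
    have htri := (norm_sub_le_norm_sub_add_norm_sub (u.eval ((g.eval x : ℝ) : 𝕜))
      (F.eval ((g.eval x : ℝ) : 𝕜)) (f x)).trans (add_le_add_right
      (norm_sub_le_norm_sub_add_norm_sub (F.eval ((g.eval x : ℝ) : 𝕜))
        (∑ l ∈ Finset.range Q, a l * (x : 𝕜) ^ l) (f x)) _)
    rw [hF_eval] at htri hE1
    linarith

end construction

/-! ### The window polynomial -/

section window

/-- The antiderivative of a polynomial of degree less than `n`. -/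
noncomputable def antideriv (p : ℝ[X]) (n : ℕ) : ℝ[X] :=
  ∑ i ∈ Finset.range n, C (p.coeff i / (i + 1)) * X ^ (i + 1)

/-- A polynomial close to the indicator function of `[-s, s]` on `[-1, 1]`. -/
noncomputable def windowPoly (s : ℝ) (j M n : ℕ) : ℝ[X] :=
  C (2 * (antideriv (sinMulPoly ℝ j ^ M) n).eval 1)⁻¹ *
    ((antideriv (sinMulPoly ℝ j ^ M) n).comp (C (1 / 4) * (C s + X)) +
      (antideriv (sinMulPoly ℝ j ^ M) n).comp (C (1 / 4) * (C s - X)))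

lemma derivative_antideriv {p : ℝ[X]} {n : ℕ} (hn : p.natDegree < n) :
    derivative (antideriv p n) = p := by
  rw [antideriv, derivative_sum]
  conv_rhs => rw [p.as_sum_range' n hn]
  refine Finset.sum_congr rfl fun i _ => ?_
  rw [derivative_C_mul_X_pow, ← C_mul_X_pow_eq_monomial]
  push_cast
  rw [div_mul_cancel₀ _ (by positivity)]

lemma eval_antideriv_zero (p : ℝ[X]) (n : ℕ) : (antideriv p n).eval 0 = 0 := by
  simp [antideriv, eval_finsetSum]

lemma natDegree_antideriv_le (p : ℝ[X]) (n : ℕ) :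
    (antideriv p n).natDegree ≤ p.natDegree + 1 := by
  refine natDegree_sum_le_of_forall_le _ _ fun i _ => ?_
  by_cases h : p.natDegree < i
  · simp [coeff_eq_zero_of_natDegree_lt h]
  · exact (natDegree_C_mul_X_pow_le _ _).trans (by lia)

lemma eval_neg_sinMulPoly (j : ℕ) (x : ℝ) :
    (sinMulPoly ℝ j).eval (-x) = (sinMulPoly ℝ j).eval x := by
  induction j using Nat.twoStepInduction with
  | zero => simp [sinMulPoly]
  | one => simp [sinMulPoly]
  | more j ih1 ih2 => simp [sinMulPoly, ih1, ih2]

lemma eval_neg_antideriv {p : ℝ[X]} {n : ℕ} (hn : p.natDegree < n)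
    (hp : ∀ x, p.eval (-x) = p.eval x) (x : ℝ) :
    (antideriv p n).eval (-x) = -(antideriv p n).eval x := by
  have hd : ∀ x, HasDerivAt (fun x => (antideriv p n).eval x + (antideriv p n).eval (-x)) 0 x := by
    intro x
    have h1 := (antideriv p n).hasDerivAt x
    have h2 := ((antideriv p n).hasDerivAt (-x)).comp x (hasDerivAt_neg x)
    rw [derivative_antideriv hn] at h1 h2
    refine (h1.add h2).congr_deriv ?_
    rw [hp]
    ring
  have := is_const_of_deriv_eq_zero (fun x => (hd x).differentiableAt) (fun x => (hd x).deriv) x 0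
  simp only [neg_zero, eval_antideriv_zero, add_zero] at this
  linarith

/-- Concentration near the origin of the primitive of an even power of `sinMulPoly`. -/
lemma antideriv_tail {j N n : ℕ} (hN : 2 ≤ N) (hn : (sinMulPoly ℝ j ^ (N + N)).natDegree < n)
    {u : ℝ} (hu1 : u ≤ 1) (hu : Real.pi ≤ (2 * j + 1) * u) :
    Monotone (fun t => (antideriv (sinMulPoly ℝ j ^ (N + N)) n).eval t) ∧
      0 < (antideriv (sinMulPoly ℝ j ^ (N + N)) n).eval 1 ∧
      (1 - (2 ^ N)⁻¹) * (antideriv (sinMulPoly ℝ j ^ (N + N)) n).eval 1 ≤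
        (antideriv (sinMulPoly ℝ j ^ (N + N)) n).eval u := by
  set A := antideriv (sinMulPoly ℝ j ^ (N + N)) n with hA
  set m : ℝ := 2 * j + 1 with hm
  have hpi := Real.pi_pos
  have hm1 : 1 ≤ m := by rw [hm]; linarith [show (0 : ℝ) ≤ j by positivity]
  have hm0 : 0 < m := by linarith
  have hu0 : 0 < u := by
    by_contra h
    have : m * u ≤ 0 := mul_nonpos_of_nonneg_of_nonpos hm0.le (by linarith)
    linarith
  have hd : ∀ t, HasDerivAt (fun t => A.eval t) ((sinMulPoly ℝ j).eval t ^ (N + N)) t := by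
    intro t
    have := A.hasDerivAt t
    rwa [hA, derivative_antideriv hn, eval_pow] at this
  have hnn : ∀ t : ℝ, 0 ≤ (sinMulPoly ℝ j).eval t ^ (N + N) := fun t => Even.pow_nonneg ⟨N, rfl⟩ _
  have hmono : Monotone (fun t => A.eval t) :=
    monotone_of_deriv_nonneg (fun t => (hd t).differentiableAt) fun t => by
      rw [(hd t).deriv]; exact hnn t
  -- lower bound for the total mass
  have hlow : (2 * m / Real.pi) ^ (N + N) / m ≤ A.eval 1 := by
    -- With t = sin θ the base of the kernel is sin(mθ)/sin θ. If t ≤ 1/m then mθ ≤ π/2, and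
    -- Jordan's inequality bounds it below by 2m/π.
    have h1 : ∀ t ∈ Set.Ioo 0 (1 / m), 2 * m / Real.pi ≤ (sinMulPoly ℝ j).eval t := by
      rintro t ⟨ht0, ht1⟩
      have h2 : 1 / m ≤ 1 := (div_le_one hm0).2 hm1
      have hθ1 : 2 / Real.pi * (Real.pi / (2 * m)) ≤ Real.sin (Real.pi / (2 * m)) :=
        Real.mul_le_sin (by positivity) (by gcongr; linarith)
      rw [show 2 / Real.pi * (Real.pi / (2 * m)) = 1 / m by field_simp] at hθ1
      obtain ⟨θ, hθ, rfl⟩ := exists_sin_eq (x := t) (by rw [abs_of_pos ht0]; linarith)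
      rw [abs_le] at hθ
      have hθ0 : 0 < θ := by
        by_contra h
        have := Real.sin_nonpos_of_nonpos_of_neg_pi_le (x := θ) (by linarith) (by linarith)
        linarith
      have hθ2 : θ ≤ Real.pi / (2 * m) := by
        refine (Real.strictMonoOn_sin.le_iff_le ⟨by linarith, hθ.2⟩ ⟨?_, ?_⟩).1 (by linarith)
        · have : 0 ≤ Real.pi / (2 * m) := by positivity
          linarith
        · gcongr; linarith
      have h3 : m * θ ≤ Real.pi / 2 := by
        calc m * θ ≤ m * (Real.pi / (2 * m)) := by gcongr
          _ = _ := by field_simp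
      have h4 := Real.mul_le_sin (x := m * θ) (by positivity) h3
      have h5 := sin_mul_eval_sinMulPoly j θ
      rw [← hm] at h5
      have h6 : Real.sin θ * (2 * m / Real.pi) ≤
          Real.sin θ * (sinMulPoly ℝ j).eval (Real.sin θ) := by
        rw [h5]
        refine le_trans ?_ h4
        rw [show 2 / Real.pi * (m * θ) = θ * (2 * m / Real.pi) by ring]
        gcongr
        exact Real.sin_le hθ0.le
      exact le_of_mul_le_mul_left h6 ht0
    have h7 : MonotoneOn (fun t => A.eval t - (2 * m / Real.pi) ^ (N + N) * t)
        (Set.Icc 0 (1 / m)) := by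
      have hd' : ∀ t, HasDerivAt (fun t => A.eval t - (2 * m / Real.pi) ^ (N + N) * t)
          ((sinMulPoly ℝ j).eval t ^ (N + N) - (2 * m / Real.pi) ^ (N + N)) t := fun t => by
        exact ((hd t).sub ((hasDerivAt_id t).const_mul ((2 * m / Real.pi) ^ (N + N)))).congr_deriv
          (by simp)
      refine monotoneOn_of_deriv_nonneg (convex_Icc _ _)
        (fun t _ => (hd' t).continuousAt.continuousWithinAt)
        (fun t _ => (hd' t).differentiableAt.differentiableWithinAt) fun t ht => ?_
      rw [interior_Icc] at ht
      rw [(hd' t).deriv, sub_nonneg]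
      have := h1 t ht
      gcongr
    have h8 := h7 (Set.left_mem_Icc.2 (by positivity)) (Set.right_mem_Icc.2 (by positivity))
      (show (0 : ℝ) ≤ 1 / m by positivity)
    have h9 : A.eval (1 / m) ≤ A.eval 1 := hmono ((div_le_one hm0).2 hm1)
    simp only [hA, eval_antideriv_zero, mul_zero, sub_zero] at h8
    rw [← hA, mul_one_div] at h8
    linarith
  have hpos : 0 < A.eval 1 := lt_of_lt_of_le (by positivity) hlow
  refine ⟨hmono, hpos, ?_⟩
  -- upper bound for the tail
  have htail : A.eval 1 - A.eval u ≤ (u ^ (N + N - 2))⁻¹ * u⁻¹ := by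
    -- On [u, 1] the kernel is at most t^(-2N) ≤ u^(-(2N-2)) t^(-2), whose primitive is used for
    -- comparison.
    have hd' : ∀ t ∈ Set.Icc u 1, HasDerivAt (fun t => A.eval t + (u ^ (N + N - 2))⁻¹ * t⁻¹)
        ((sinMulPoly ℝ j).eval t ^ (N + N) + (u ^ (N + N - 2))⁻¹ * -(t ^ 2)⁻¹) t := by
      rintro t ⟨ht, -⟩
      exact (hd t).add ((hasDerivAt_inv (by linarith)).const_mul _)
    have h1 : AntitoneOn (fun t => A.eval t + (u ^ (N + N - 2))⁻¹ * t⁻¹) (Set.Icc u 1) := by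
      refine antitoneOn_of_deriv_nonpos (convex_Icc _ _)
        (fun t ht => (hd' t ht).continuousAt.continuousWithinAt) (fun t ht =>
          (hd' t (interior_subset ht)).differentiableAt.differentiableWithinAt) fun t ht => ?_
      rw [(hd' t (interior_subset ht)).deriv]
      obtain ⟨ht0, ht1⟩ := interior_subset ht
      have ht : 0 < t := by linarith
      have h2 := abs_mul_eval_sinMulPoly_le_one j (x := t) (by rw [abs_of_pos ht]; exact ht1)
      rw [abs_mul, abs_of_pos ht, ← le_div_iff₀' ht] at h2
      have h3 : (sinMulPoly ℝ j).eval t ^ (N + N) ≤ (1 / t) ^ (N + N) := by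
        rw [← Even.pow_abs ⟨N, rfl⟩]
        gcongr
      have h4 : (1 / t) ^ (N + N) = (t ^ (N + N - 2))⁻¹ * (t ^ 2)⁻¹ := by
        rw [one_div, inv_pow, ← mul_inv, ← pow_add]
        congr 2
        lia
      have h5 : (t ^ (N + N - 2))⁻¹ * (t ^ 2)⁻¹ ≤ (u ^ (N + N - 2))⁻¹ * (t ^ 2)⁻¹ := by
        gcongr
      linarith
    have h2 := h1 (Set.left_mem_Icc.2 hu1) (Set.right_mem_Icc.2 hu1) hu1
    simp only [inv_one, mul_one] at h2
    have : 0 < (u ^ (N + N - 2))⁻¹ := by positivity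
    linarith
  -- The tail is at most (1/u)^(2N-1) and the mass at least (2m/π)^(2N-1) · (2/π). Since 2/u ≤ 2m/π,
  -- the quotient is at most 2^(-(2N-1)) π/2, hence at most 2^(-N) as N ≥ 2.
  have hcomp : (u ^ (N + N - 2))⁻¹ * u⁻¹ ≤ (2 ^ N)⁻¹ * ((2 * m / Real.pi) ^ (N + N) / m) := by
    have h1 : (u ^ (N + N - 2))⁻¹ * u⁻¹ = u * ((1 / u) ^ (N + N)) := by
      obtain ⟨M, rfl⟩ : ∃ M, N = M + 1 := ⟨N - 1, by lia⟩
      rw [show M + 1 + (M + 1) - 2 = M + M by lia, show M + 1 + (M + 1) = M + M + 2 by lia,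
        one_div, inv_pow]
      field_simp
      ring
    have h2 : 2 * (1 / u) ≤ 2 * m / Real.pi := by
      rw [mul_one_div, div_le_div_iff₀ hu0 hpi]
      nlinarith
    have h3 : (2 : ℝ) ^ (N + N) * (1 / u) ^ (N + N) ≤ (2 * m / Real.pi) ^ (N + N) := by
      rw [← mul_pow]
      gcongr
    -- one factor is used to absorb `u * m`
    obtain ⟨M, hM⟩ : ∃ M, N + N = M + 1 := ⟨N + N - 1, by lia⟩
    have h4 : (2 : ℝ) ^ M * (1 / u) ^ M ≤ (2 * m / Real.pi) ^ M := by
      rw [← mul_pow]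
      gcongr
    have h5 : u * (1 / u) ^ (N + N) = (1 / u) ^ M := by
      rw [hM, pow_succ]; field_simp
    have h6 : (2 * m / Real.pi) ^ (N + N) / m = (2 * m / Real.pi) ^ M * (2 / Real.pi) := by
      rw [hM, pow_succ]; field_simp
    have h7 : (2 : ℝ) ^ N * 2 ≤ 2 ^ M := by
      rw [← pow_succ]
      exact pow_le_pow_right₀ (by norm_num) (by lia)
    rw [h1, h5, h6]
    have h8 : 1 / 2 ≤ 2 / Real.pi := by
      rw [div_le_div_iff₀ (by norm_num) hpi]
      linarith [Real.pi_le_four]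
    have h9 : (2 : ℝ) ^ N * 2 * (1 / u) ^ M ≤ (2 * m / Real.pi) ^ M := le_trans (by gcongr) h4
    calc (1 / u) ^ M = (2 ^ N)⁻¹ * ((2 ^ N * 2 * (1 / u) ^ M) * (1 / 2)) := by field_simp
      _ ≤ (2 ^ N)⁻¹ * ((2 * m / Real.pi) ^ M * (2 / Real.pi)) := by gcongr
  have : (2 ^ N)⁻¹ * ((2 * m / Real.pi) ^ (N + N) / m) ≤ (2 ^ N)⁻¹ * A.eval 1 := by gcongr
  linarith

/-- The odd increasing primitive A is a smoothed step at 0, concentrated in [-δ/16, δ/16]. The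
window adds two opposite steps at ± s, s = r + δ/4; monotonicity and oddness place it in [0, 1]. The
factor 1/4 keeps all arguments in [-1, 1], as s ≤ 5/4. -/
theorem windowPoly_spec {r δ : ℝ} (hr : 0 < r) (hr1 : r ≤ 1) (hδ : 0 < δ) (hδr : δ ≤ r) {d N n : ℕ}
    (hd : 1 ≤ d * δ) (hN : 2 ≤ N) (hn : 2 * (26 * d) * (N + N) < n) :
    let W := windowPoly (r + δ / 4) (26 * d) (N + N) n
    W.natDegree ≤ 2 * (26 * d) * (N + N) + 1 ∧
    (∀ x : ℝ, |x| ≤ 1 → 0 ≤ W.eval x ∧ W.eval x ≤ 1) ∧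
    (∀ x : ℝ, |x| ≤ r → 1 - (2 ^ N)⁻¹ ≤ W.eval x) ∧
    ∀ x : ℝ, |x| ≤ 1 → r + δ / 2 ≤ |x| → W.eval x ≤ (2 ^ N)⁻¹ := by
  intro W
  set κ := sinMulPoly ℝ (26 * d) ^ (N + N) with hκ
  have hκdeg : κ.natDegree ≤ 2 * (26 * d) * (N + N) := by
    refine natDegree_pow_le.trans ?_
    rw [mul_comm]
    gcongr
    exact natDegree_sinMulPoly_le ℝ _
  -- The points r and r + δ/2 are at distance δ/4 from s, which becomes δ/16 after scaling. The
  -- factor 26 is chosen since (52d + 1)δ/16 ≥ 52/16 > π.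
  obtain ⟨hmono, hpos, htail⟩ := antideriv_tail (j := 26 * d) (N := N) (n := n) (u := δ / 16) hN
    (hκdeg.trans_lt hn) (by linarith) (by
      have := Real.pi_lt_d2
      push_cast
      nlinarith)
  rw [← hκ] at hmono hpos htail
  set A := antideriv κ n with hA
  have hodd : ∀ x, A.eval (-x) = -A.eval x := eval_neg_antideriv (hκdeg.trans_lt hn) fun x => by
    rw [hκ, eval_pow, eval_pow, eval_neg_sinMulPoly]
  set s := r + δ / 4 with hs
  have hW : ∀ x, W.eval x = (A.eval (1 / 4 * (s + x)) + A.eval (1 / 4 * (s - x))) /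
      (2 * A.eval 1) := by
    intro x
    simp only [W, windowPoly, ← hκ, ← hA]
    simp only [eval_mul, eval_add, eval_comp, eval_sub, eval_C, eval_X]
    ring
  have heven : ∀ x, W.eval (-x) = W.eval x := by
    intro x
    rw [hW, hW, sub_neg_eq_add, ← sub_eq_add_neg, add_comm]
  have habs : ∀ x, W.eval x = W.eval |x| := by
    intro x
    rcases abs_choice x with h | h <;> rw [h]
    rw [heven]
  have htail' : A.eval 1 - (2 ^ N)⁻¹ * A.eval 1 ≤ A.eval (δ / 16) := by linarith
  refine ⟨?_, fun x hx => ?_, fun x hx => ?_, fun x hx hx' => ?_⟩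
  · refine (natDegree_C_mul_le _ _).trans ((natDegree_add_le _ _).trans (max_le ?_ ?_))
    · refine natDegree_comp_le.trans ?_
      calc _ ≤ (2 * (26 * d) * (N + N) + 1) * 1 :=
            Nat.mul_le_mul ((natDegree_antideriv_le _ _).trans (by lia)) (by compute_degree)
        _ = _ := mul_one _
    · refine natDegree_comp_le.trans ?_
      calc _ ≤ (2 * (26 * d) * (N + N) + 1) * 1 :=
            Nat.mul_le_mul ((natDegree_antideriv_le _ _).trans (by lia)) (by compute_degree)
        _ = _ := mul_one _
  · rw [habs, hW]
    have hx0 := abs_nonneg x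
    have h1 : A.eval (1 / 4 * (s + |x|)) ≤ A.eval 1 := hmono (by linarith)
    have h2 : A.eval (1 / 4 * (s - |x|)) ≤ A.eval 1 := hmono (by linarith)
    have h3 : A.eval (-(1 / 4 * (s - |x|))) ≤ A.eval (1 / 4 * (s + |x|)) := hmono (by linarith)
    rw [hodd] at h3
    constructor
    · exact div_nonneg (by linarith) (by linarith)
    · rw [div_le_one (by linarith)]
      linarith
  · rw [habs, hW, le_div_iff₀ (by linarith)]
    have h1 : A.eval (δ / 16) ≤ A.eval (1 / 4 * (s + |x|)) := hmono (by linarith [abs_nonneg x])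
    have h2 : A.eval (δ / 16) ≤ A.eval (1 / 4 * (s - |x|)) := hmono (by linarith)
    linarith
  · rw [habs, hW, div_le_iff₀ (by linarith)]
    have h1 : A.eval (1 / 4 * (s + |x|)) ≤ A.eval 1 := hmono (by linarith)
    have h2 : A.eval (1 / 4 * (s - |x|)) ≤ A.eval (-(δ / 16)) := hmono (by linarith)
    rw [hodd] at h2
    have h3 : 0 ≤ (2 ^ N)⁻¹ * A.eval 1 := by positivity
    linarith

end window

/-! ### Polynomial commands that compute the approximation -/

namespace FieldRAM.PolyCmd

section frame

variable {𝕜 : Type} [RCLike 𝕜] {a : ℕ → 𝕜}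

/-- The polynomial registers that a command assigns. -/
def Assigns : PolyCmd → ℕ → Prop
  | const b _, k => k = b
  | var b, k => k = b
  | add b _ _, k => k = b
  | sub b _ _, k => k = b
  | mul b _ _, k => k = b
  | div b _ _, k => k = b
  | coeff b _ _, k => k = b
  | input b _, k => k = b
  | seq p q, k => p.Assigns k ∨ q.Assigns k
  | loop _ _ p, k => p.Assigns k

lemma setPoly_poly (σ : PolyState 𝕜) (b : ℕ) (P : 𝕜[X]) (c : ℕ) :
    (σ.setPoly b P).poly c = if c = b then P else σ.poly c := by
  simp [PolyState.setPoly, Function.update_apply]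

lemma setPoly_reg (σ : PolyState 𝕜) (b : ℕ) (P : 𝕜[X]) : (σ.setPoly b P).reg = σ.reg := rfl

lemma run_poly_of_not_assigns {p : PolyCmd} {k : ℕ} (hk : ¬ p.Assigns k) (σ : PolyState 𝕜) :
    (p.run a σ).poly k = σ.poly k := by
  induction p generalizing σ with
  | seq p q hp hq =>
    simp only [Assigns, not_or] at hk
    rw [run, hq hk.2, hp hk.1]
  | loop i j p hp =>
    rw [run]
    have : ∀ n τ, ((next (p.run a) i)^[n] τ).poly k = τ.poly k := by
      intro n
      induction n with
      | zero => simp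
      | succ n ih =>
        intro τ
        rw [Function.iterate_succ_apply, ih]
        exact hp hk τ
    rw [this]
    rfl
  | _ => exact (setPoly_poly _ _ _ _).trans (if_neg hk)

lemma run_seq (p q : PolyCmd) (σ : PolyState 𝕜) : (seq p q).run a σ = q.run a (p.run a σ) := rfl

/-- Loop invariants. -/
lemma run_loop_poly {p : PolyCmd} {i j : ℕ} (hi : ¬ p.Writes i) {σ : PolyState 𝕜}
    (Inv : ℕ → (ℕ → 𝕜[X]) → Prop) (h0 : Inv 0 σ.poly)
    (hs : ∀ k τ, τ.reg i = k → (∀ l, l ≠ i → ¬ p.Writes l → τ.reg l = σ.reg l) →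
      Inv k τ.poly → Inv (k + 1) (p.run a τ).poly) :
    Inv (σ.reg j) ((loop i j p).run a σ).poly := by
  rw [run]
  induction σ.reg j with
  | zero => exact h0
  | succ n ih =>
    rw [Function.iterate_succ_apply']
    refine hs n _ ?_ (fun l hl hw => ?_) ih
    · rw [iterate_next_counter hi]
      simp [PolyState.setReg]
    · rw [iterate_next_reg hw hl]
      simp [PolyState.setReg, hl]

end frame

section blocks

variable {𝕜 : Type} [RCLike 𝕜] {a : ℕ → 𝕜} {σ : PolyState 𝕜}

local notation "Γ" => Polynomial.map (algebraMap ℝ 𝕜)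

/-- `p 31 := R j` -/
def natCast (j : ℕ) : PolyCmd :=
  seq (const 30 1) (seq (const 31 0) (loop 10 j (add 31 31 30)))

lemma run_natCast (j : ℕ) : ((natCast j).run a σ).poly 31 = C (σ.reg j : 𝕜) := by
  have := run_loop_poly (a := a) (p := add 31 31 30) (i := 10) (j := j)
    (σ := (const 31 0).run a ((const 30 1).run a σ)) (fun h => h)
    (fun k P => P 30 = 1 ∧ P 31 = C (k : 𝕜)) (by simp [run, setPoly_poly])
    (fun k τ _ _ h => by simp [run, setPoly_poly, h])
  exact this.2

/-- The recursion `(u, v) := (v, c * v - u)` for `c = p 30`, `u = p 31`, `v = p 32`. -/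
def recursion (j : ℕ) : PolyCmd :=
  -- Adding the zero polynomial in register `34` serves as a copy.
  loop 10 j (seq (mul 33 30 32) (seq (sub 33 33 31) (seq (const 34 0) (seq (add 31 32 34)
    (add 32 33 34)))))

/-- Starting at F 0 with the virtual predecessor F(-1) = c F 0 - F 1 in register `31` makes every
pass the same and needs no special case for 0. -/
lemma run_recursion (j : ℕ) (F : ℕ → 𝕜[X]) (h0 : F 0 = σ.poly 32)
    (h1 : F 1 = σ.poly 30 * F 0 - σ.poly 31) (h2 : ∀ n, F (n + 2) = σ.poly 30 * F (n + 1) - F n) :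
    ((recursion j).run a σ).poly 32 = F (σ.reg j) := by
  have := run_loop_poly (a := a) (p := seq (mul 33 30 32) (seq (sub 33 33 31) (seq (const 34 0)
    (seq (add 31 32 34) (add 32 33 34))))) (i := 10) (j := j) (σ := σ) (by simp [Writes])
    (fun k P => P 30 = σ.poly 30 ∧ P 32 = F k ∧ σ.poly 30 * P 32 - P 31 = F (k + 1))
    (by simp [h0, h1]) (fun k τ _ _ h => by
      simp only [run, setPoly_poly]
      norm_num
      rw [h.1, h.2.2, h2, h.2.1]
      exact ⟨rfl, rfl, rfl⟩)
  exact this.2.1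

/-- `p 31 := sinArcsinPoly α (R j) (p 30)` for `α = p 8`. -/
def sinArcsin (j : ℕ) : PolyCmd :=
  seq (const 31 0) <| seq (const 32 1) <| seq (mul 33 8 32) <| seq (mul 34 30 32) <|
  seq (mul 35 30 30) <| seq (const 36 1) <|
  loop 10 j <| seq (mul 37 33 34) <| seq (add 31 31 37) <| seq (mul 34 34 35) <|
    seq (mul 37 36 36) <| seq (mul 38 8 8) <| seq (sub 37 37 38) <| seq (add 38 36 32) <|
    seq (add 36 38 32) <| seq (mul 38 38 36) <| seq (div 37 37 38) (mul 33 33 37)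

lemma run_sinArcsin (j : ℕ) {α : ℝ} {y : ℝ[X]} (hα : σ.poly 8 = Γ (C α)) (hy : σ.poly 30 = Γ y) :
    ((sinArcsin j).run a σ).poly 31 = Γ ((sinArcsinPoly α (σ.reg j)).comp y) := by
  simp only [sinArcsin]
  iterate 6 rw [run_seq]
  generalize hτ : (const 36 1).run a _ = τ
  have hreg : τ.reg j = σ.reg j := by rw [← hτ]; rfl
  rw [← hreg]
  refine (run_loop_poly (a := a) (i := 10) (j := j) (σ := τ) ?_
    (fun k P => P 31 = Γ ((sinArcsinPoly α k).comp y) ∧ P 32 = 1 ∧ P 8 = Γ (C α) ∧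
      P 33 = Γ (C (sinArcsinCoeff α k)) ∧ P 34 = Γ (y ^ (2 * k + 1)) ∧ P 35 = Γ (y ^ 2) ∧
      P 36 = C (2 * k + 1 : 𝕜)) ?_ (fun k τ _ _ h => ?_)).1
  · simp [Writes]
  · subst hτ
    simp [run, setPoly_poly, hα, hy, sinArcsinPoly, sinArcsinCoeff, sq]
  · obtain ⟨h1, h2, h3, h4, h5, h6, h7⟩ := h
    simp only [run, setPoly_poly]
    norm_num [h1, h2, h3, h4, h5, h6, h7, sinArcsinPoly, sinArcsinCoeff, Finset.sum_range_succ]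
    refine ⟨?_, ?_, ?_⟩
    · left
      rw [map_ofNat, map_ofNat]
      congr 1 <;> ring
    · ring
    · rw [show (C 2 : 𝕜[X]) = 2 from rfl]
      ring

/-- `p 19 := ∑ l < R j, a l * (p 17) ^ l` -/
def substitution (j : ℕ) : PolyCmd :=
  seq (const 19 0) <| seq (const 30 1) <| loop 10 j <| seq (input 31 10) <| seq (mul 31 31 30) <|
    seq (add 19 19 31) (mul 30 30 17)

lemma run_substitution (j : ℕ) : ((substitution j).run a σ).poly 19 =
    ∑ l ∈ Finset.range (σ.reg j), C (a l) * σ.poly 17 ^ l := by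
  simp only [substitution]
  iterate 2 rw [run_seq]
  refine (run_loop_poly (a := a) (i := 10) (j := j) ?_
    (fun k P => P 19 = ∑ l ∈ Finset.range k, C (a l) * σ.poly 17 ^ l ∧ P 17 = σ.poly 17 ∧
      P 30 = σ.poly 17 ^ k) ?_ (fun k τ hk _ h => ?_)).1
  · simp [Writes]
  · simp [run, setPoly_poly]
  · obtain ⟨h1, h2, h3⟩ := h
    simp only [run, setPoly_poly]
    norm_num [h1, h2, h3, hk, Finset.sum_range_succ, pow_succ]

/-- Multiplying a remainder by X raises its degree to at most that of Θ, so subtracting one constant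
multiple of the monic Θ reduces it again. -/
lemma X_mul_modByMonic_sub {Θ : 𝕜[X]} (hΘ : Θ.Monic) (P : 𝕜[X]) :
    X * (P %ₘ Θ) - C ((X * (P %ₘ Θ)).coeff Θ.natDegree) * Θ = (X * P) %ₘ Θ := by
  set c := (X * (P %ₘ Θ)).coeff Θ.natDegree with hc
  refine ((div_modByMonic_unique (X * (P /ₘ Θ) + C c) _ hΘ ⟨?_, ?_⟩).2).symm
  · conv_rhs => rw [← modByMonic_add_div P Θ]
    ring
  · rw [degree_eq_natDegree hΘ.ne_zero, degree_lt_iff_coeff_zero]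
    intro m hm
    rcases hm.eq_or_lt with rfl | hm
    · rw [coeff_sub, coeff_C_mul, hΘ.coeff_natDegree, ← hc, mul_one, sub_self]
    · obtain ⟨m, rfl⟩ : ∃ m', m = m' + 1 := ⟨m - 1, by lia⟩
      have h1 : (P %ₘ Θ).coeff m = 0 := by
        have := degree_modByMonic_lt P hΘ
        rw [degree_eq_natDegree hΘ.ne_zero, degree_lt_iff_coeff_zero] at this
        exact this m (by lia)
      rw [coeff_sub, coeff_C_mul, coeff_X_mul, h1, coeff_eq_zero_of_natDegree_lt hm, mul_zero,
        sub_zero]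

/-- `p 26 := p 19 %ₘ p 25`, where `R d` is the degree of the divisor -/
def remainder (d j : ℕ) : PolyCmd :=
  seq (const 26 0) <| seq (const 30 1) <| seq (var 31) <| loop 10 j <| seq (coeff 32 19 10) <|
    seq (mul 32 32 30) <| seq (add 26 26 32) <| seq (mul 30 31 30) <| seq (coeff 32 30 d) <|
    seq (mul 32 32 25) (sub 30 30 32)

/-- By linearity the remainder is the combination of the remainders of X^i with the coefficients of
the dividend, and these are produced one after the other by the preceding lemma. No division routine
is needed. -/
lemma run_remainder (d j : ℕ) (hd : d ≠ 10) (hΘ : (σ.poly 25).Monic)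
    (hd' : (σ.poly 25).natDegree = σ.reg d) (hpos : 0 < σ.reg d)
    (hj : (σ.poly 19).natDegree < σ.reg j) :
    ((remainder d j).run a σ).poly 26 = σ.poly 19 %ₘ σ.poly 25 := by
  have key : ((remainder d j).run a σ).poly 26 =
      ∑ i ∈ Finset.range (σ.reg j), C ((σ.poly 19).coeff i) * (X ^ i %ₘ σ.poly 25) := by
    simp only [remainder]
    iterate 3 rw [run_seq]
    refine (run_loop_poly (a := a) (i := 10) (j := j) ?_
      (fun k P => P 26 = ∑ i ∈ Finset.range k, C ((σ.poly 19).coeff i) * (X ^ i %ₘ σ.poly 25) ∧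
        P 19 = σ.poly 19 ∧ P 25 = σ.poly 25 ∧ P 31 = X ∧ P 30 = X ^ k %ₘ σ.poly 25)
        ?_ (fun k τ hk hreg h => ?_)).1
    · simp [Writes]
    · have : (1 : 𝕜[X]) %ₘ σ.poly 25 = 1 := by
        rw [modByMonic_eq_self_iff hΘ, degree_one, degree_eq_natDegree hΘ.ne_zero, hd']
        exact_mod_cast hpos
      simp [run, setPoly_poly, this]
    · obtain ⟨h1, h2, h3, h4, h5⟩ := h
      have hrd : τ.reg d = σ.reg d := hreg d hd (by simp [Writes])
      simp only [run, setPoly_poly, setPoly_reg]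
      norm_num [h1, h2, h3, h4, h5, hk, hrd, Finset.sum_range_succ, ← hd']
      rw [X_mul_modByMonic_sub hΘ, pow_succ']
  rw [key]
  conv_rhs => rw [(σ.poly 19).as_sum_range' _ hj]
  rw [← modByMonicHom_apply, map_sum]
  refine Finset.sum_congr rfl fun i _ => ?_
  rw [← C_mul_X_pow_eq_monomial, ← smul_eq_C_mul, ← smul_eq_C_mul, map_smul, modByMonicHom_apply]

/-- `p 27 := sinMulPoly (R i) ^ R j` -/
def kernelPower (i j : ℕ) : PolyCmd :=
  seq (var 30) <| seq (mul 30 30 30) <| seq (const 31 2) <| seq (mul 30 30 31) <|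
  -- The constant -1 is the virtual predecessor c · 1 - (c + 1) of the recursion for `sinMulPoly`.
  seq (mul 30 30 31) <| seq (sub 30 31 30) <| seq (const 31 (-1)) <| seq (const 32 1) <|
  seq (recursion i) <| seq (const 27 1) <| loop 10 j <| mul 27 27 32

lemma sinMulPoly_recursion (n : ℕ) : sinMulPoly 𝕜 (n + 2) =
    (2 - 4 * X ^ 2) * sinMulPoly 𝕜 (n + 1) - sinMulPoly 𝕜 n := rfl

lemma run_kernelPower (i j : ℕ) (hj : j ≠ 10) :
    ((kernelPower i j).run a σ).poly 27 = sinMulPoly 𝕜 (σ.reg i) ^ σ.reg j := by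
  simp only [kernelPower]
  iterate 8 rw [run_seq]
  generalize hτ : (const 32 1).run a _ = τ
  rw [run_seq, run_seq]
  have hrec : ((recursion i).run a τ).poly 32 = sinMulPoly 𝕜 (σ.reg i) := by
    have : σ.reg i = τ.reg i := by rw [← hτ]; rfl
    rw [this]
    have h30 : τ.poly 30 = 2 - 4 * X ^ 2 := by
      simp only [← hτ, run, setPoly_poly]
      norm_num
      ring
    refine run_recursion i _ ?_ ?_ fun n => ?_
    · simp [← hτ, run, setPoly_poly, sinMulPoly]
    · rw [h30]
      simp [← hτ, run, setPoly_poly, sinMulPoly]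
    · rw [h30, sinMulPoly_recursion]
  have hregj : σ.reg j = ((const 27 1).run a ((recursion i).run a τ)).reg j := by
    rw [run, setPoly_reg, run_reg_of_not_writes (by simp [recursion, Writes, hj]), ← hτ]
    rfl
  rw [hregj]
  refine (run_loop_poly (a := a) (i := 10) (j := j) ?_
    (fun k P => P 27 = sinMulPoly 𝕜 (σ.reg i) ^ k ∧ P 32 = sinMulPoly 𝕜 (σ.reg i)) ?_
      (fun k τ hk hreg h => ?_)).1
  · simp [Writes]
  · simp [run, setPoly_poly, hrec]
  · simp [run, setPoly_poly, h, pow_succ]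

/-- `p 28 := windowPoly`, from its parameter in `p 9` and the kernel in `p 27` -/
def window (j : ℕ) : PolyCmd :=
  seq (const 30 1) <| seq (const 31 4) <| seq (div 31 30 31) <| seq (var 32) <| seq (add 33 9 32) <|
  seq (mul 33 31 33) <| seq (sub 34 9 32) <| seq (mul 34 31 34) <| seq (mul 35 30 33) <|
  seq (mul 36 30 34) <| seq (const 37 0) <| seq (const 38 0) <| seq (const 28 0) <|
  seq (loop 10 j <| seq (add 37 37 30) <| seq (coeff 39 27 10) <| seq (div 39 39 37) <|
    seq (add 38 38 39) <| seq (mul 29 39 35) <| seq (add 28 28 29) <| seq (mul 29 39 36) <|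
    seq (add 28 28 29) <| seq (mul 35 35 33) (mul 36 36 34)) <|
  seq (add 38 38 38) <| seq (div 38 30 38) (mul 28 38 28)

lemma run_window (j : ℕ) {s : ℝ} {κ : ℝ[X]} (hs : σ.poly 9 = Γ (C s))
    (hκ : σ.poly 27 = Γ κ) : ((window j).run a σ).poly 28 =
      Γ (C (2 * (antideriv κ (σ.reg j)).eval 1)⁻¹ *
        ((antideriv κ (σ.reg j)).comp (C (1 / 4) * (C s + Polynomial.X)) +
          (antideriv κ (σ.reg j)).comp (C (1 / 4) * (C s - Polynomial.X)))) := by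
  simp only [window]
  iterate 13 rw [run_seq]
  generalize hτ : (const 28 0).run a _ = τ
  have hreg : σ.reg j = τ.reg j := by rw [← hτ]; rfl
  rw [run_seq, hreg]
  have key := run_loop_poly (a := a) (i := 10) (j := j) (σ := τ) (p := seq (add 37 37 30) <|
    seq (coeff 39 27 10) <| seq (div 39 39 37) <| seq (add 38 38 39) <| seq (mul 29 39 35) <|
    seq (add 28 28 29) <| seq (mul 29 39 36) <| seq (add 28 28 29) <|
    seq (mul 35 35 33) (mul 36 36 34)) (by simp [Writes])
    (fun k P => P 28 = Γ ((antideriv κ k).comp (C (1 / 4) * (C s + X)) +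
      (antideriv κ k).comp (C (1 / 4) * (C s - X))) ∧ P 38 = Γ (C ((antideriv κ k).eval 1)) ∧
      P 37 = C (k : 𝕜) ∧ P 35 = Γ ((C (1 / 4) * (C s + X)) ^ (k + 1)) ∧
      P 36 = Γ ((C (1 / 4) * (C s - X)) ^ (k + 1)) ∧ P 33 = Γ (C (1 / 4) * (C s + X)) ∧
      P 34 = Γ (C (1 / 4) * (C s - X)) ∧ P 30 = 1 ∧ P 27 = Γ κ) ?_ (fun k τ hk hreg h => ?_)
  · obtain ⟨h1, h2, -, -, -, -, -, h3, -⟩ := key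
    simp only [run_seq]
    generalize (loop 10 j _).run a τ = τ' at *
    simp only [run, setPoly_poly]
    norm_num [h1, h2, h3]
    left
    rw [← C_mul, ← mul_inv, map_ofNat, mul_two]
  · subst hτ
    simp [run, setPoly_poly, hs, hκ, antideriv]
    have h4 : (4 : 𝕜) = algebraMap ℝ 𝕜 4 := (map_ofNat _ 4).symm
    exact ⟨.inl h4, .inl h4, .inl h4, .inl h4⟩
  · obtain ⟨h1, h2, h3, h4, h5, h6, h7, h8, h9⟩ := h
    simp only [run, setPoly_poly, setPoly_reg]
    norm_num [h1, h2, h3, h4, h5, h6, h7, h8, h9, antideriv, Finset.sum_range_succ, hk]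
    refine ⟨?_, ?_, ?_⟩ <;> ring

/-- The scalar parameters, computed from `p 1 = r + δ * X + ⋯` -/
def parameters : PolyCmd :=
  seq (natCast 13) <| seq (const 32 0) <| seq (add 6 31 32) <| seq (natCast 3) <|
  seq (coeff 3 1 1) <| seq (coeff 4 1 2) <| seq (add 5 3 4) <| seq (add 7 31 31) <|
  seq (add 7 7 30) <| seq (div 8 30 7) <| seq (const 32 4) <| seq (div 33 4 32) <|
  seq (add 9 3 33) <| seq (div 33 30 6) <| seq (add 33 30 33) <| seq (mul 34 33 33) <|
  seq (add 34 30 34) <| seq (add 33 33 33) (div 10 33 34)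

lemma run_natCast_one (j : ℕ) : ((natCast j).run a σ).poly 30 = 1 := by
  have := run_loop_poly (a := a) (p := add 31 31 30) (i := 10) (j := j)
    (σ := (const 31 0).run a ((const 30 1).run a σ)) (fun h => h)
    (fun k P => P 30 = 1) (by simp [run, setPoly_poly])
    (fun k τ _ _ h => by simp [run, setPoly_poly, h])
  exact this

lemma run_parameters {r δ : ℝ} (h0 : (σ.poly 1).coeff 0 = r) (h1 : (σ.poly 1).coeff 1 = δ)
    (hr1 : σ.reg 1 = 0) (hr2 : σ.reg 2 = 1) :
    ((parameters).run a σ).poly 5 = Γ (C (r + δ)) ∧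
      ((parameters).run a σ).poly 8 = Γ (C (1 / (2 * (σ.reg 3 : ℝ) + 1))) ∧
      ((parameters).run a σ).poly 9 = Γ (C (r + δ / 4)) ∧
      ((parameters).run a σ).poly 10 = Γ (C (shrink (σ.reg 13))) := by
  simp only [parameters]
  iterate 3 rw [run_seq]
  generalize hτ : (add 6 31 32).run a _ = τ
  have h6 : τ.poly 6 = C (σ.reg 13 : 𝕜) := by
    simp [← hτ, run, setPoly_poly, run_natCast]
  have hp1 : τ.poly 1 = σ.poly 1 := by
    simp only [← hτ, run, setPoly_poly]
    norm_num
    exact run_poly_of_not_assigns (by simp [natCast, Assigns]) _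
  have hreg : ∀ k, k ≠ 10 → τ.reg k = σ.reg k := fun k hk => by
    simp only [← hτ, run, setPoly_reg]
    exact run_reg_of_not_writes (by simp [natCast, Writes, hk]) _
  rw [run_seq]
  have h31 := run_natCast (a := a) (σ := τ) 3
  have h30 := run_natCast_one (a := a) (σ := τ) 3
  rw [hreg 3 (by simp)] at h31
  have h1' : ((natCast 3).run a τ).poly 1 = σ.poly 1 :=
    (run_poly_of_not_assigns (by simp [natCast, Assigns]) _).trans hp1
  have h6' : ((natCast 3).run a τ).poly 6 = C (σ.reg 13 : 𝕜) :=
    (run_poly_of_not_assigns (by simp [natCast, Assigns]) _).trans h6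
  have hreg1 : ((natCast 3).run a τ).reg 1 = 0 :=
    (run_reg_of_not_writes (by simp [natCast, Writes]) _).trans ((hreg 1 (by simp)).trans hr1)
  have hreg2 : ((natCast 3).run a τ).reg 2 = 1 :=
    (run_reg_of_not_writes (by simp [natCast, Writes]) _).trans ((hreg 2 (by simp)).trans hr2)
  generalize (natCast 3).run a τ = υ at *
  simp only [run, setPoly_poly, setPoly_reg]
  norm_num [h1', h6', h30, h31, hreg1, hreg2, h0, h1, shrink]
  rw [map_ofNat, map_ofNat]
  refine ⟨by ring, rfl, ?_⟩
  congr 1 <;> ring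

/-- `p 12` and `p 16` become the scale and the expansion variable. -/
def expansionVariable : PolyCmd :=
  seq (const 30 1) <| seq (sinArcsin 5) <| seq (div 12 31 5) <| seq (var 13) <|
  seq (mul 13 12 13) <| seq (mul 30 13 13) <| seq (const 31 2) <| seq (mul 30 30 31) <|
  seq (mul 30 30 31) <| seq (sub 30 31 30) <| seq (const 31 (-1)) <| seq (const 32 1) <|
  seq (recursion 3) (mul 16 13 32)

lemma run_expansionVariable {R : ℝ} (h5 : σ.poly 5 = Γ (C R))
    (h8 : σ.poly 8 = Γ (C (1 / (2 * (σ.reg 3 : ℝ) + 1)))) :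
    ((expansionVariable).run a σ).poly 12 = Γ (C (foldScale R (σ.reg 3) (σ.reg 5))) ∧
      ((expansionVariable).run a σ).poly 16 =
        Γ (foldPoly (σ.reg 3) (foldScale R (σ.reg 3) (σ.reg 5))) := by
  set β := foldScale R (σ.reg 3) (σ.reg 5) with hβ
  simp only [expansionVariable]
  iterate 12 rw [run_seq]
  generalize hυ : (sinArcsin 5).run a _ = υ
  -- Composition with the constant 1 evaluates the Taylor polynomial there; divided by R this is the
  -- scale.
  have h31 : υ.poly 31 =
      Γ (C ((sinArcsinPoly (1 / (2 * (σ.reg 3 : ℝ) + 1)) (σ.reg 5)).eval 1)) := by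
    rw [← hυ, run_sinArcsin (α := 1 / (2 * (σ.reg 3 : ℝ) + 1)) (y := C 1)]
    · rw [comp_C]
      rfl
    · rw [run, setPoly_poly, if_neg (by simp), h8]
    · simp [run, setPoly_poly]
  have h5' : υ.poly 5 = Γ (C R) := by
    rw [← hυ, run_poly_of_not_assigns (by simp [sinArcsin, Assigns]), run, setPoly_poly,
      if_neg (by simp), h5]
  have hreg : ∀ k, k ≠ 10 → υ.reg k = σ.reg k := fun k hk => by
    rw [← hυ, run_reg_of_not_writes (by simp [sinArcsin, Writes, hk]), run, setPoly_reg]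
  generalize hτ : (const 32 1).run a _ = τ
  have h12 : τ.poly 12 = Γ (C β) := by
    simp only [← hτ, run, setPoly_poly]
    norm_num [h31, h5', hβ, foldScale]
  have h13 : τ.poly 13 = Γ (C β * X) := by
    simp only [← hτ, run, setPoly_poly]
    norm_num [h31, h5', hβ, foldScale]
  have h30 : τ.poly 30 = 2 - 4 * (Γ (C β * X)) ^ 2 := by
    simp only [← hτ, run, setPoly_poly]
    norm_num [h31, h5', hβ, foldScale]
    ring
  have hr3 : σ.reg 3 = τ.reg 3 := by
    rw [← hreg 3 (by simp), ← hτ]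
    rfl
  have hrec : ((recursion 3).run a τ).poly 32 =
      Γ ((sinMulPoly ℝ (σ.reg 3)).comp (C β * X)) := by
    rw [hr3]
    refine run_recursion 3 (fun n => Γ ((sinMulPoly ℝ n).comp (C β * X))) ?_ ?_ fun n => ?_
    · simp [← hτ, run, setPoly_poly, sinMulPoly]
    · rw [h30]
      simp [← hτ, run, setPoly_poly, sinMulPoly]
    · rw [h30]
      simp [sinMulPoly]
  constructor
  · rw [run_seq, run, setPoly_poly, if_neg (by simp),
      run_poly_of_not_assigns (by simp [recursion, Assigns]), h12]
  · rw [run_seq, run, setPoly_poly, if_pos rfl, hrec,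
      run_poly_of_not_assigns (by simp [recursion, Assigns]), h13, foldPoly,
      ← Polynomial.map_mul]

/-- `p 25` becomes the monic modulus. -/
def modulus : PolyCmd :=
  seq (const 30 1) <| seq (div 30 30 10) <| seq (mul 31 30 16) <| seq (add 30 31 31) <|
  seq (const 32 1) <| seq (recursion 4) <| seq (coeff 30 32 6) <| seq (const 31 1) <|
  seq (div 30 31 30) (mul 25 30 32)

/-- This is the Chebyshev recursion with multiplier 2g, started with T_0 ∘ g = 1 and the predecessor
T_(-1) ∘ g = g. The known degree locates the leading coefficient. -/
lemma run_modulus {β Y : ℝ} {j : ℕ} (hβ : β ≠ 0) (hY : Y ≠ 0) (h10 : σ.poly 10 = Γ (C Y))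
    (h16 : σ.poly 16 = Γ (foldPoly j β)) (h6 : σ.reg 6 = σ.reg 4 * (2 * j + 1)) :
    (modulus.run a σ).poly 25 = Γ (C (foldModulus β Y j (σ.reg 4)).leadingCoeff⁻¹ *
      foldModulus β Y j (σ.reg 4)) := by
  simp only [modulus]
  iterate 5 rw [run_seq]
  generalize hτ : (const 32 1).run a _ = τ
  have h30 : τ.poly 30 = 2 * Γ (C Y⁻¹ * foldPoly j β) := by
    simp only [← hτ, run, setPoly_poly]
    norm_num [h10, h16]
    ring
  have h31 : τ.poly 31 = Γ (C Y⁻¹ * foldPoly j β) := by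
    simp only [← hτ, run, setPoly_poly]
    norm_num [h10, h16]
  have h32 : τ.poly 32 = 1 := by
    simp [← hτ, run, setPoly_poly]
  have hreg : τ.reg = σ.reg := by rw [← hτ]; rfl
  have hrec : ((recursion 4).run a τ).poly 32 = Γ (foldModulus β Y j (σ.reg 4)) := by
    rw [← hreg]
    refine run_recursion 4 (fun n => Γ (foldModulus β Y j n)) ?_ ?_ fun n => ?_
    · simp [foldModulus, h32]
    · rw [h30, h31]
      simp [foldModulus]
      ring
    · rw [h30]
      simp only [foldModulus, Nat.cast_add, Nat.cast_ofNat, Nat.cast_one, Chebyshev.T_add_two]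
      simp
  have hreg6 : ((recursion 4).run a τ).reg 6 = (foldModulus β Y j (σ.reg 4)).natDegree := by
    rw [run_reg_of_not_writes (by simp [recursion, Writes]), hreg, h6,
      natDegree_foldModulus hβ hY]
  rw [run_seq]
  generalize (recursion 4).run a τ = υ at *
  simp only [run, setPoly_poly]
  norm_num [hrec, hreg6]

/-- The approximating polynomial, in `p 2`. -/
def approximation : PolyCmd :=
  seq parameters <| seq expansionVariable <|
  seq (seq (const 31 0) <| seq (add 30 16 31) <| seq (sinArcsin 5) <| seq (const 30 1) <|
    seq (div 30 30 12) (mul 17 30 31)) <|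
  seq (substitution 4) <| seq modulus <| seq (remainder 6 9) <| seq (kernelPower 7 8) <|
  seq (window 9) (mul 2 26 28)

lemma wellFormed_approximation : approximation.WellFormed := by
  simp [approximation, parameters, expansionVariable, substitution, modulus, remainder,
    kernelPower, window, natCast, sinArcsin, recursion, WellFormed, Writes]

lemma approximation_writes {k : ℕ} (hk : k ≠ 10) : ¬ approximation.Writes k := by
  simp [approximation, parameters, expansionVariable, substitution, modulus, remainder,
    kernelPower, window, natCast, sinArcsin, recursion, Writes, hk]

lemma natDegree_sinArcsinPoly_le (α : ℝ) (k : ℕ) : (sinArcsinPoly α k).natDegree ≤ 2 * k := by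
  refine natDegree_sum_le_of_forall_le _ _ fun i hi => (natDegree_C_mul_X_pow_le _ _).trans ?_
  have := Finset.mem_range.1 hi
  lia

/-- The hypothesis `hr9` bounds the degree of the substituted series before reduction, so the loops
of length `R 9` reach all its coefficients. -/
lemma run_approximation {r δ : ℝ} (h0 : (σ.poly 1).coeff 0 = r) (h1 : (σ.poly 1).coeff 1 = δ)
    (hr1 : σ.reg 1 = 0) (hr2 : σ.reg 2 = 1) (hr6 : σ.reg 6 = σ.reg 4 * (2 * σ.reg 3 + 1))
    (hr4 : 0 < σ.reg 4) (hr13 : 0 < σ.reg 13)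
    (hβ : foldScale (r + δ) (σ.reg 3) (σ.reg 5) ≠ 0)
    (hr9 : σ.reg 4 * (2 * σ.reg 5 * (2 * σ.reg 3 + 1)) < σ.reg 9) :
    (approximation.run a σ).poly 2 =
      foldedTaylor a (r + δ) (σ.reg 3) (σ.reg 5) (σ.reg 13) (σ.reg 4) *
        Γ (windowPoly (r + δ / 4) (σ.reg 7) (σ.reg 8) (σ.reg 9)) := by
  obtain ⟨p5, p8, p9, p10⟩ := run_parameters (a := a) h0 h1 hr1 hr2
  have hreg₁ : ∀ k, k ≠ 10 → (parameters.run a σ).reg k = σ.reg k := fun k hk =>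
    run_reg_of_not_writes (by simp [parameters, natCast, Writes, hk]) _
  simp only [approximation]
  rw [run_seq]
  generalize parameters.run a σ = σ₁ at *
  rw [← hreg₁ 3 (by simp)] at p8
  obtain ⟨q12, q16⟩ := run_expansionVariable (a := a) p5 p8
  have hreg₂ : ∀ k, k ≠ 10 → (expansionVariable.run a σ₁).reg k = σ.reg k := fun k hk =>
    (run_reg_of_not_writes (by simp [expansionVariable, recursion, sinArcsin, Writes, hk])
      _).trans (hreg₁ k hk)
  have hfr : ∀ k, 7 ≤ k → k ≤ 10 → (expansionVariable.run a σ₁).poly k = σ₁.poly k :=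
    fun k hk hk' => run_poly_of_not_assigns (by
      interval_cases k <;> simp [expansionVariable, recursion, sinArcsin, Assigns]) _
  rw [run_seq]
  rw [← hfr 8 (by simp) (by simp)] at p8
  rw [← hfr 9 (by simp) (by simp)] at p9
  rw [← hfr 10 (by simp) (by simp)] at p10
  generalize expansionVariable.run a σ₁ = σ₂ at *
  rw [hreg₁ 3 (by simp)] at p8 q12 q16
  rw [hreg₁ 5 (by simp)] at q12 q16
  set j := σ.reg 3
  set β := foldScale (r + δ) j (σ.reg 5) with hβdef
  rw [run_seq]
  have hreg₃ : ∀ k, k ≠ 10 → ((seq (const 31 0) <| seq (add 30 16 31) <| seq (sinArcsin 5) <|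
      seq (const 30 1) <| seq (div 30 30 12) (mul 17 30 31)).run a σ₂).reg k = σ.reg k :=
    fun k hk => (run_reg_of_not_writes (by simp [sinArcsin, Writes, hk]) _).trans (hreg₂ k hk)
  have hfr : ∀ k, 7 ≤ k → k ≤ 16 → ((seq (const 31 0) <| seq (add 30 16 31) <|
      seq (sinArcsin 5) <| seq (const 30 1) <| seq (div 30 30 12) (mul 17 30 31)).run a
        σ₂).poly k = σ₂.poly k :=
    fun k hk hk' => run_poly_of_not_assigns (by
      interval_cases k <;> simp [sinArcsin, Assigns]) _
  have p17 : ((seq (const 31 0) <| seq (add 30 16 31) <| seq (sinArcsin 5) <|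
      seq (const 30 1) <| seq (div 30 30 12) (mul 17 30 31)).run a σ₂).poly 17 =
        Γ ((unfoldPoly β j (σ.reg 5)).comp (foldPoly j β)) := by
    iterate 3 rw [run_seq]
    have h31 := run_sinArcsin (a := a) (σ := (add 30 16 31).run a ((const 31 0).run a σ₂)) 5
      (α := 1 / (2 * (j : ℝ) + 1)) (y := foldPoly j β) (by simp [run, setPoly_poly, p8])
      (by simp [run, setPoly_poly, q16])
    have h12 : ((sinArcsin 5).run a ((add 30 16 31).run a ((const 31 0).run a σ₂))).poly 12 =
        Γ (C β) := by
      rw [run_poly_of_not_assigns (by simp [sinArcsin, Assigns])]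
      simp [run, setPoly_poly, q12]
    rw [show ((add 30 16 31).run a ((const 31 0).run a σ₂)).reg 5 = σ.reg 5 from
      hreg₂ 5 (by simp)] at h31
    generalize (sinArcsin 5).run a ((add 30 16 31).run a ((const 31 0).run a σ₂)) = υ at *
    simp only [run, setPoly_poly]
    norm_num [h31, h12, unfoldPoly]
  rw [← hfr 9 (by simp) (by simp)] at p9
  rw [← hfr 10 (by simp) (by simp)] at p10
  rw [← hfr 16 (by simp) (by simp)] at q16
  generalize (seq (const 31 0) <| seq (add 30 16 31) <| seq (sinArcsin 5) <|
      seq (const 30 1) <| seq (div 30 30 12) (mul 17 30 31)).run a σ₂ = σ₃ at *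
  have p19 := run_substitution (a := a) (σ := σ₃) 4
  rw [p17, hreg₃ 4 (by simp)] at p19
  have hreg₄ : ∀ k, k ≠ 10 → ((substitution 4).run a σ₃).reg k = σ.reg k := fun k hk =>
    (run_reg_of_not_writes (by simp [substitution, Writes, hk]) _).trans (hreg₃ k hk)
  have hfr : ∀ k, 7 ≤ k → k ≤ 16 → ((substitution 4).run a σ₃).poly k = σ₃.poly k :=
    fun k hk hk' => run_poly_of_not_assigns (by
      interval_cases k <;> simp [substitution, Assigns]) _
  rw [run_seq]
  rw [← hfr 9 (by simp) (by simp)] at p9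
  rw [← hfr 10 (by simp) (by simp)] at p10
  rw [← hfr 16 (by simp) (by simp)] at q16
  generalize (substitution 4).run a σ₃ = σ₄ at *
  have hY : shrink (σ.reg 13) ≠ 0 := (shrink_pos (by exact_mod_cast hr13)).ne'
  have p25 := run_modulus (a := a) hβ hY p10 q16
    (by rw [hreg₄ 6 (by simp), hreg₄ 4 (by simp), hr6])
  rw [hreg₄ 4 (by simp)] at p25
  have hreg₅ : ∀ k, k ≠ 10 → (modulus.run a σ₄).reg k = σ.reg k := fun k hk =>
    (run_reg_of_not_writes (by simp [modulus, recursion, Writes, hk]) _).trans (hreg₄ k hk)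
  have hfr : ∀ k, 7 ≤ k → k ≤ 19 → (modulus.run a σ₄).poly k = σ₄.poly k :=
    fun k hk hk' => run_poly_of_not_assigns (by
      interval_cases k <;> simp [modulus, recursion, Assigns]) _
  rw [run_seq]
  rw [← hfr 9 (by simp) (by simp)] at p9
  rw [← hfr 19 (by simp) (by simp)] at p19
  generalize modulus.run a σ₄ = σ₅ at *
  have hdeg := natDegree_foldModulus (j := j) (Q := σ.reg 4) hβ hY
  set Θ := foldModulus β (shrink (σ.reg 13)) j (σ.reg 4) with hΘdef
  have hΘ0 : Θ ≠ 0 := by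
    intro h
    rw [h, natDegree_zero] at hdeg
    have : 0 < σ.reg 4 * (2 * j + 1) := by positivity
    lia
  have hlead : Θ.leadingCoeff ≠ 0 := leadingCoeff_ne_zero.2 hΘ0
  have hmonic : (C Θ.leadingCoeff⁻¹ * Θ).Monic := by
    rw [Monic, leadingCoeff_mul, leadingCoeff_C, inv_mul_cancel₀ hlead]
  have p26 := run_remainder (a := a) (σ := σ₅) 6 9 (by simp) (by rw [p25]; exact hmonic.map _)
    (by rw [p25, natDegree_map, natDegree_C_mul (inv_ne_zero hlead), hdeg, hreg₅ 6 (by simp), hr6])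
    (by rw [hreg₅ 6 (by simp), hr6]; positivity)
    (by
      rw [p19, hreg₅ 9 (by simp)]
      refine lt_of_le_of_lt ?_ hr9
      refine natDegree_sum_le_of_forall_le _ _ fun l hl => (natDegree_C_mul_le _ _).trans ?_
      refine natDegree_pow_le.trans ?_
      have hl := Finset.mem_range.1 hl
      refine Nat.mul_le_mul hl.le (natDegree_map_le.trans (natDegree_comp_le.trans ?_))
      rw [natDegree_foldPoly hβ]
      exact Nat.mul_le_mul_right _
        ((natDegree_C_mul_le _ _).trans (natDegree_sinArcsinPoly_le _ _)))
  rw [p19, p25] at p26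
  have hreg₆ : ∀ k, k ≠ 10 → ((remainder 6 9).run a σ₅).reg k = σ.reg k := fun k hk =>
    (run_reg_of_not_writes (by simp [remainder, Writes, hk]) _).trans (hreg₅ k hk)
  have hfr : ∀ k, 7 ≤ k → k ≤ 19 → ((remainder 6 9).run a σ₅).poly k = σ₅.poly k :=
    fun k hk hk' => run_poly_of_not_assigns (by
      interval_cases k <;> simp [remainder, Assigns]) _
  rw [run_seq]
  rw [← hfr 9 (by simp) (by simp)] at p9
  generalize (remainder 6 9).run a σ₅ = σ₆ at *
  have p27 := run_kernelPower (a := a) (σ := σ₆) 7 8 (by simp)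
  rw [← map_sinMulPoly (algebraMap ℝ 𝕜), ← Polynomial.map_pow, hreg₆ 7 (by simp),
    hreg₆ 8 (by simp)] at p27
  have hreg₇ : ∀ k, k ≠ 10 → ((kernelPower 7 8).run a σ₆).reg k = σ.reg k := fun k hk =>
    (run_reg_of_not_writes (by simp [kernelPower, recursion, Writes, hk]) _).trans (hreg₆ k hk)
  rw [run_seq]
  rw [← run_poly_of_not_assigns (p := kernelPower 7 8) (a := a) (by
    simp [kernelPower, recursion, Assigns])] at p9 p26
  generalize (kernelPower 7 8).run a σ₆ = σ₇ at *
  have p28 := run_window (a := a) 9 p9 p27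
  rw [hreg₇ 9 (by simp)] at p28
  rw [run_seq, run, setPoly_poly, if_pos rfl, p28,
    run_poly_of_not_assigns (by simp [window, Assigns]), p26]
  rfl

end blocks

end FieldRAM.PolyCmd

/-! ### Degree and error of the final polynomial -/

/-- The approximating polynomial for given sizes. -/
noncomputable def boundedTaylor {𝕜 : Type} [RCLike 𝕜] (a : ℕ → 𝕜) (r δ : ℝ) (n j d e : ℕ) : 𝕜[X] :=
  foldedTaylor a (r + δ) j ((4 * e * (n + 5)) ^ 3) (4 * e) (4 * e * (n + 5)) *
    (windowPoly (r + δ / 4) (26 * d) (n + 5 + (n + 5)) (degreeBound n j d e ^ 5)).map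
      (algebraMap ℝ 𝕜)

section sizes

variable {r δ B ε : ℝ} {n j d e : ℕ}

lemma exists_sizes (hr : 0 < r) (hδ : 0 < δ) (hε : 0 < ε) : ∃ n j d e, Sizes r δ B ε n j d e := by
  classical
  have h1 : ∃ n : ℕ, B ≤ 2 ^ n * ε := by
    obtain ⟨n, hn⟩ := pow_unbounded_of_one_lt (B / ε) (one_lt_two)
    exact ⟨n, by rw [div_lt_iff₀ hε] at hn; exact hn.le⟩
  have h2 : ∀ x y : ℝ, 0 < y → ∃ n : ℕ, x ≤ n * y := fun x y hy => by
    obtain ⟨n, hn⟩ := exists_nat_ge (x / y)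
    exact ⟨n, by rwa [div_le_iff₀ hy] at hn⟩
  have h3 := h2 1 r hr
  have h4 := h2 1 δ hδ
  have h5 := h2 r δ hδ
  exact ⟨Nat.find h1, Nat.find h3, Nat.find h4, Nat.find h5,
    ⟨fun k hk => not_le.1 (Nat.find_min h1 hk), Nat.find_spec h1,
      fun k hk => not_le.1 (Nat.find_min h3 hk), Nat.find_spec h3,
      fun k hk => not_le.1 (Nat.find_min h4 hk), Nat.find_spec h4,
      fun k hk => not_le.1 (Nat.find_min h5 hk), Nat.find_spec h5⟩⟩

lemma Sizes.one_le_d (h : Sizes r δ B ε n j d e) : 1 ≤ d := by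
  by_contra hd
  have := h.le_d
  simp [show d = 0 by lia] at this
  linarith

lemma Sizes.one_le_e (h : Sizes r δ B ε n j d e) (hr : 0 < r) : 1 ≤ e := by
  by_contra hd
  have := h.le_e
  simp [show e = 0 by lia] at this
  linarith

/-- Minimality puts each of j, d, e within a factor 2 of the real quantity, and n + 5 ≤ 8L. In the
first summand e ~ r/δ meets j ~ 1/r, so that r cancels and folding costs only 1/δ. The constant is
320 + 1664 + 1. -/
lemma Sizes.degreeBound_le (h : Sizes r δ B ε n j d e) (hr : 0 < r) (hr1 : r ≤ 1) (hδ : 0 < δ)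
    (hδr : δ ≤ r) (hε : 0 < ε) :
    (degreeBound n j d e : ℝ) ≤ 1985 * (1 / δ * max 1 (Real.log (B / ε))) := by
  set L := max 1 (Real.log (B / ε)) with hL
  have hL1 : 1 ≤ L := le_max_left _ _
  have hn : (n + 5 : ℝ) ≤ 8 * L := by
    rcases n with _ | n
    · norm_num
      linarith
    · have h1 := h.lt_n n (by lia)
      rw [← lt_div_iff₀ hε] at h1
      have h2 := Real.log_lt_log (by positivity) h1
      rw [Real.log_pow] at h2
      have h3 : Real.log (B / ε) ≤ L := le_max_right _ _
      have := Real.log_two_gt_d9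
      have h4 : (n : ℝ) * 0.5 ≤ n * Real.log 2 := by gcongr; linarith
      push_cast
      linarith
  have hmul : ∀ (k : ℕ) (x y : ℝ), 0 < y → y ≤ x → (∀ l < k, l * y < x) → (k : ℝ) ≤ 2 * (x / y) := by
    intro k x y hy hyx hk
    have h1 : 1 ≤ x / y := (one_le_div hy).2 hyx
    rcases k with _ | k
    · norm_num
      linarith
    · have h2 := hk k (by lia)
      rw [← lt_div_iff₀ hy] at h2
      push_cast
      linarith
  have he := hmul e r δ hδ hδr h.lt_e
  have hj := hmul j 1 r hr hr1 h.lt_j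
  have hd := hmul d 1 δ hδ (hδr.trans hr1) h.lt_d
  have hj' : (2 * j + 1 : ℝ) ≤ 5 * (1 / r) := by
    have : 1 ≤ 1 / r := (one_le_div hr).2 hr1
    linarith
  have hd1 : 1 ≤ 1 / δ := (one_le_div hδ).2 (hδr.trans hr1)
  rw [degreeBound]
  push_cast
  have e1 : 4 * (e : ℝ) * (n + 5) * (2 * j + 1) ≤
      4 * (2 * (r / δ)) * (8 * L) * (5 * (1 / r)) := by gcongr
  have e2 : (26 * (d : ℝ) + 26 * d) * (n + 5 + (n + 5)) ≤
      (26 * (2 * (1 / δ)) + 26 * (2 * (1 / δ))) * (8 * L + 8 * L) := by gcongr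
  have e3 : 1 ≤ 1 / δ * L := one_le_mul_of_one_le_of_one_le hd1 hL1
  have e4 : 4 * (2 * (r / δ)) * (8 * L) * (5 * (1 / r)) = 320 * (1 / δ * L) := by
    field_simp
    norm_num
  have e5 : (26 * (2 * (1 / δ)) + 26 * (2 * (1 / δ))) * (8 * L + 8 * L) = 1664 * (1 / δ * L) := by
    ring
  linarith

end sizes

section spec

variable {𝕜 : Type} [RCLike 𝕜] {f : ℝ → 𝕜} {a : ℕ → 𝕜} {r δ B ε : ℝ} {n j d e : ℕ}

lemma norm_le_of_hasSum
    (hf : ∀ x ∈ Set.Icc (-r - δ) (r + δ), HasSum (fun k => a k * (x : 𝕜) ^ k) (f x))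
    (hs : Summable (fun k => ‖a k‖ * (r + δ) ^ k)) (hB : ∑' k, ‖a k‖ * (r + δ) ^ k ≤ B)
    {x : ℝ} (hx : |x| ≤ r + δ) : ‖f x‖ ≤ B := by
  obtain ⟨h1, h2⟩ := abs_le.1 hx
  rw [← (hf x ⟨by linarith, h2⟩).tsum_eq]
  refine (tsum_of_norm_bounded hs.hasSum fun k => ?_).trans hB
  rw [norm_mul, norm_pow, RCLike.norm_ofReal]
  gcongr

/-- P = pW. For |x| ≤ r both factors are accurate; up to r + δ/2 only W ∈ [0, 1] and the accuracy of
p are used; beyond, the bound B on p meets the smallness of W. -/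
theorem boundedTaylor_spec (hr : 0 < r) (hr1 : r ≤ 1) (hδ : 0 < δ) (hδr : δ ≤ r)
    (hf : ∀ x ∈ Set.Icc (-r - δ) (r + δ), HasSum (fun k => a k * (x : 𝕜) ^ k) (f x))
    (hs : Summable (fun k => ‖a k‖ * (r + δ) ^ k)) (hB : ∑' k, ‖a k‖ * (r + δ) ^ k ≤ B)
    (h : Sizes r δ B ε n j d e) (hε : 0 < ε) :
    let P := boundedTaylor a r δ n j d e
    P.natDegree ≤ degreeBound n j d e ∧ (∀ x : ℝ, |x| ≤ r → ‖P.eval (x : 𝕜) - f x‖ ≤ ε) ∧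
      (∀ x : ℝ, |x| ≤ 1 → |x| ≤ r + δ / 2 → ‖P.eval (x : 𝕜)‖ ≤ ε + ‖f x‖) ∧
      ∀ x : ℝ, |x| ≤ 1 → r + δ / 2 ≤ |x| → ‖P.eval (x : 𝕜)‖ ≤ ε := by
  intro P
  have hd1 := h.one_le_d
  have he1 := h.one_le_e hr
  have hB0 : 0 ≤ B := (tsum_nonneg fun k => by positivity).trans hB
  obtain ⟨p1, p2, p3⟩ := foldedTaylor_spec hr hδ hδr hf hs hB h.le_j h.le_e (N := n + 5) (by lia)
  have hZ : 2 * (26 * d) * (n + 5 + (n + 5)) < degreeBound n j d e ^ 5 := by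
    have h1 : 2 * (26 * d) * (n + 5 + (n + 5)) < degreeBound n j d e := by
      rw [degreeBound]
      have : 2 * (26 * d) * (n + 5 + (n + 5)) = (26 * d + 26 * d) * (n + 5 + (n + 5)) := by ring
      lia
    exact h1.trans_le (Nat.le_self_pow (by simp) _)
  obtain ⟨w1, w2, w3, w4⟩ := windowPoly_spec hr hr1 hδ hδr h.le_d (N := n + 5) (by lia) hZ
  set p := foldedTaylor a (r + δ) j ((4 * e * (n + 5)) ^ 3) (4 * e) (4 * e * (n + 5)) with hp
  set W := windowPoly (r + δ / 4) (26 * d) (n + 5 + (n + 5)) (degreeBound n j d e ^ 5) with hW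
  have hP : ∀ x : ℝ, P.eval (x : 𝕜) = p.eval (x : 𝕜) * ((W.eval x : ℝ) : 𝕜) := fun x => by
    rw [← eval_map_algebraMap_ofReal, ← eval_mul]
    rfl
  -- The shift by 5 makes B/2^(n+5) at most ε/32. The total error on [-r, r] is 6 + 1 = 7 such
  -- units.
  have hb : B * (2 ^ (n + 5))⁻¹ ≤ ε / 32 := by
    rw [← div_eq_mul_inv, div_le_div_iff₀ (by positivity) (by norm_num), pow_add]
    linarith [h.le_n]
  have hPn : ∀ x : ℝ, |x| ≤ 1 → ‖P.eval (x : 𝕜)‖ = ‖p.eval (x : 𝕜)‖ * W.eval x := fun x hx => by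
    rw [hP, norm_mul, RCLike.norm_ofReal, abs_of_nonneg (w2 x hx).1]
  refine ⟨?_, fun x hx => ?_, fun x hx hx' => ?_, fun x hx hx' => ?_⟩
  · refine natDegree_mul_le.trans ?_
    have h1 : (W.map (algebraMap ℝ 𝕜)).natDegree ≤ _ := natDegree_map_le.trans w1
    have h2 : 2 * (26 * d) * (n + 5 + (n + 5)) = (26 * d + 26 * d) * (n + 5 + (n + 5)) := by ring
    have key : ∀ k l s t : ℕ, k < s → l ≤ t + 1 → k + l ≤ s + t + 1 := by lia
    exact (key _ _ _ _ p1 h1).trans (by rw [degreeBound, h2])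
  · have hx1 : |x| ≤ 1 := hx.trans hr1
    have h1 := p3 x (by linarith)
    have h2 := norm_le_of_hasSum hf hs hB (x := x) (by linarith)
    obtain ⟨h3, h4⟩ := w2 x hx1
    have h5 := w3 x hx
    have : P.eval (x : 𝕜) - f x = (p.eval (x : 𝕜) - f x) * ((W.eval x : ℝ) : 𝕜) -
        f x * ((1 - W.eval x : ℝ) : 𝕜) := by
      rw [hP]
      push_cast
      ring
    rw [this]
    refine (norm_sub_le _ _).trans ?_
    rw [norm_mul, norm_mul, RCLike.norm_ofReal, RCLike.norm_ofReal, abs_of_nonneg h3,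
      abs_of_nonneg (by linarith)]
    have h6 : ‖p.eval (x : 𝕜) - f x‖ * W.eval x ≤ 6 * B * (2 ^ (n + 5))⁻¹ * 1 := by gcongr
    have h7 : ‖f x‖ * (1 - W.eval x) ≤ B * (2 ^ (n + 5))⁻¹ := by
      gcongr
      linarith
    linarith
  · rw [hPn x hx]
    obtain ⟨h3, h4⟩ := w2 x hx
    have h1 := p3 x hx'
    have h2 : ‖p.eval (x : 𝕜)‖ * W.eval x ≤ ‖p.eval (x : 𝕜)‖ * 1 := by gcongr
    have h5 := norm_sub_norm_le (p.eval (x : 𝕜)) (f x)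
    linarith
  · rw [hPn x hx]
    have h2 : ‖p.eval (x : 𝕜)‖ * W.eval x ≤ B * (2 ^ (n + 5))⁻¹ := by
      gcongr
      · exact (w2 x hx).1
      · exact p2 x hx
      · exact w4 x hx hx'
    linarith

end spec

/-! ### Correctness and running time of the program -/

namespace FieldRAM

lemma runList_counters_aux (n j d e : ℕ) :
    let ρ := NatCmd.runList counters (initialCounters n j d e)
    ρ 14 = n ∧ ρ 15 = d ∧ ρ 16 = e ∧ ρ 17 = n + 5 ∧ ρ 18 = ρ 0 * ρ 0 ∧
      ρ 19 = ρ 0 * ρ 0 * (ρ 0 * ρ 0) ∧ ρ 20 = 2 ∧ ρ 21 = 3 ∧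
      ∀ i, i = 10 ∨ i = 11 ∨ i = 12 ∨ (21 < i ∧ i < 30) → ρ i = 0 := by
  refine ⟨rfl, rfl, rfl, rfl, rfl, rfl, rfl, rfl, ?_⟩
  rintro i (rfl | rfl | rfl | ⟨h, h'⟩)
  · rfl
  · rfl
  · rfl
  · interval_cases i <;> rfl

lemma runList_counters_lt {n j d e : ℕ} (hd : 1 ≤ d) (he : 1 ≤ e) :
    ∀ i < 30, NatCmd.runList counters (initialCounters n j d e) i < degreeBound n j d e ^ 5 + 1 := by
  obtain ⟨r0, r1, r2, r3, r4, r5, r6, r7, r8, r9, r13, -⟩ := runList_counters n j d e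
  obtain ⟨r14, r15, r16, r17, r18, r19, r20, r21, h0⟩ := runList_counters_aux n j d e
  generalize NatCmd.runList counters (initialCounters n j d e) = ρ at *
  have hZ' : degreeBound n j d e =
    4 * e * (n + 5) * (2 * j + 1) + (26 * d + 26 * d) * (n + 5 + (n + 5)) + 1 := rfl
  generalize degreeBound n j d e = Z at *
  have hne : n + 5 ≤ 4 * e * (n + 5) := Nat.le_mul_of_pos_left _ (by lia)
  have hee : 4 * e ≤ 4 * e * (n + 5) := Nat.le_mul_of_pos_right _ (by lia)
  generalize 4 * e * (n + 5) = Q at *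
  have hj : Q ≤ Q * (2 * j + 1) := Nat.le_mul_of_pos_right _ (by lia)
  have hj' : 2 * j + 1 ≤ Q * (2 * j + 1) := Nat.le_mul_of_pos_left _ (by lia)
  have hd1 : 26 * d + 26 * d ≤ (26 * d + 26 * d) * (n + 5 + (n + 5)) :=
    Nat.le_mul_of_pos_right _ (by lia)
  have hd2 : n + 5 + (n + 5) ≤ (26 * d + 26 * d) * (n + 5 + (n + 5)) :=
    Nat.le_mul_of_pos_left _ (by lia)
  have hQZ : Q ≤ Z := by lia
  have hZ1 : 1 ≤ Z := by lia
  have hp : ∀ k, k ≤ 5 → Z ^ k ≤ Z ^ 5 := fun k hk => Nat.pow_le_pow_right hZ1 hk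
  have h1 := hp 1 (by simp)
  have h2 := hp 2 (by simp)
  have h4 := hp 4 (by simp)
  have h3 : Q ^ 3 ≤ Z ^ 5 := (Nat.pow_le_pow_left hQZ 3).trans (hp 3 (by simp))
  rw [pow_one] at h1
  rw [r0] at r18 r19
  rw [show Z * Z = Z ^ 2 by ring] at r18
  rw [show Z * Z * (Z * Z) = Z ^ 4 by ring] at r19
  generalize Z ^ 5 = Z5 at *
  generalize Z ^ 4 = Z4 at *
  generalize Z ^ 2 = Z2 at *
  generalize Q ^ 3 = Q3 at *
  generalize Q * (2 * j + 1) = Qm at *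
  generalize (26 * d + 26 * d) * (n + 5 + (n + 5)) = dn at *
  intro i hi
  by_cases hi0 : i = 10 ∨ i = 11 ∨ i = 12 ∨ (21 < i ∧ i < 30)
  · rw [h0 i hi0]
    lia
  · clear h0 hp
    interval_cases i <;> omega

variable {𝕜 : Type} [RCLike 𝕜]

/-- The left side bounds the degree of the substituted series before reduction: powers up to Q of a
polynomial of degree at most 2Q³(2j+1). This is what the fifth power in the array length provides
for. -/
lemma mul_two_mul_pow_lt {Q Z j : ℕ} (h : Q * (2 * j + 1) + 2 ≤ Z) :
    Q * (2 * Q ^ 3 * (2 * j + 1)) < Z ^ 5 := by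
  have h1 : Q ≤ Z := (Nat.le_mul_of_pos_right Q (by lia : 0 < 2 * j + 1)).trans (by lia)
  calc Q * (2 * Q ^ 3 * (2 * j + 1)) = Q ^ 3 * (2 * (Q * (2 * j + 1))) := by ring
    _ ≤ Z ^ 3 * (2 * (Q * (2 * j + 1))) := by gcongr
    _ < Z ^ 3 * (Z * Z) := by
        have : 0 < Z ^ 3 := Nat.pow_pos (by lia)
        refine Nat.mul_lt_mul_of_pos_left ?_ this
        nlinarith
    _ = Z ^ 5 := by ring

/-- The program computing the approximating polynomial. -/
def approximationProgram : Program :=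
  .seq setup PolyCmd.approximation.compile

theorem runs_approximationProgram : ∃ A k : ℕ, ∀ (𝕜 : Type) [RCLike 𝕜] (a : ℕ → 𝕜) (r δ B ε : ℝ)
    (n j d e : ℕ), Sizes r δ B ε n j d e → 0 < r → 0 < δ →
    (boundedTaylor a r δ n j d e).natDegree ≤ degreeBound n j d e →
    Runs approximationProgram (inputState a r δ B ε) (A * (degreeBound n j d e ^ 5 + 1) ^ k)
      (fun s => s.Outputs (boundedTaylor a r δ n j d e) ∧ s.reg 0 = degreeBound n j d e) := by
  obtain ⟨A, k, h⟩ := PolyCmd.runs_compile _ PolyCmd.wellFormed_approximation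
  refine ⟨200 + A, k + 1, fun 𝕜 _ a r δ B ε n j d e hs hr hδ hdeg => ?_⟩
  have hd := hs.one_le_d
  have he := hs.one_le_e hr
  have hlt := runList_counters_lt (n := n) (j := j) hd he
  obtain ⟨r0, r1, r2, r3, r4, r5, r6, r7, r8, r9, r13, r30, r31, r32⟩ := runList_counters n j d e
  have hcost := costList_counters_le (n := n) (j := j) hd he
  have hsetup := runs_setup a hs
  generalize NatCmd.runList counters (initialCounters n j d e) = ρ at *
  have hP : boundedTaylor a r δ n j d e =
      foldedTaylor a (r + δ) j ((4 * e * (n + 5)) ^ 3) (4 * e) (4 * e * (n + 5)) *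
        (windowPoly (r + δ / 4) (26 * d) (n + 5 + (n + 5)) (degreeBound n j d e ^ 5)).map
          (algebraMap ℝ 𝕜) := rfl
  have hZQ : 4 * e * (n + 5) * (2 * j + 1) + 2 ≤ degreeBound n j d e := by
    have h2 : 0 < (26 * d + 26 * d) * (n + 5 + (n + 5)) := by positivity
    rw [degreeBound]
    lia
  have hQ0 : 0 < 4 * e * (n + 5) := by positivity
  generalize degreeBound n j d e = Z at *
  generalize hQ : 4 * e * (n + 5) = Q at *
  generalize boundedTaylor a r δ n j d e = P at *
  set D := Z ^ 5 + 1 with hD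
  have hZ5 : Z ≤ Z ^ 5 := Nat.le_self_pow (by simp) _
  -- Input array `1` is read as a polynomial register whose first coefficients are r, δ, B, ε.
  let σ : PolyState 𝕜 := ⟨ρ, fun b => if b = 1 then
    C (r : 𝕜) + C (δ : 𝕜) * X + C (B : 𝕜) * X ^ 2 + C (ε : 𝕜) * X ^ 3 else 0⟩
  have hrun : (PolyCmd.approximation.run a σ).poly 2 = P := by
    have hβ : foldScale (r + δ) j (Q ^ 3) ≠ 0 := by
      obtain ⟨m, hm⟩ : ∃ m, Q ^ 3 = m + 1 := ⟨Q ^ 3 - 1, by have := Nat.pow_pos (n := 3) hQ0; lia⟩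
      have hα : (0 : ℝ) < 1 / (2 * j + 1) := by positivity
      have := le_eval_one_sinArcsinPoly hα (by
        rw [div_le_one (by positivity)]
        linarith [show (0 : ℝ) ≤ j by positivity]) m
      rw [foldScale, hm]
      have : 0 < (sinArcsinPoly (1 / (2 * (j : ℝ) + 1)) (m + 1)).eval 1 := by linarith
      positivity
    have := PolyCmd.run_approximation (a := a) (σ := σ) (r := r) (δ := δ) (by simp [σ])
      (by simp [σ, coeff_X_pow, coeff_C]) r1 r2 (by simp only [σ, r3, r4, r6])
      (by simp only [σ, r4]; exact hQ0) (by simp only [σ, r13]; lia)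
      (by simpa only [σ, r3, r5] using hβ)
      (by
        simp only [σ, r3, r4, r5, r9]
        exact mul_two_mul_pow_lt hZQ)
    rw [this, hP]
    simp only [σ, r3, r4, r5, r7, r8, r9, r13]
  have hreg : (PolyCmd.approximation.run a σ).reg 0 = Z :=
    (PolyCmd.run_reg_of_not_writes (PolyCmd.approximation_writes (by simp)) _).trans r0
  refine (Runs.seq (hsetup.mono hcost fun s hs => hs) fun s hs =>
    h 𝕜 a D s σ (by lia) ?_ hlt).mono ?_ fun s hs => ?_
  · obtain ⟨harr, hreg⟩ := hs
    refine ⟨⟨(hreg 30 (by simp)).trans r30, (hreg 31 (by simp)).trans r31,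
      (hreg 32 (by simp)).trans r32, fun i => ?_⟩, ?_, fun i hi => hreg i (by lia), ?_⟩
    · rw [harr 40 (by simp)]
      rfl
    · rw [harr 0 (by simp)]
      rfl
    · intro b hb hb' i hi
      rw [harr b (by lia)]
      by_cases hb1 : b = 1
      · subst hb1
        match i with
        | 0 => simp [σ, inputState]
        | 1 => simp [σ, inputState, coeff_X_pow, coeff_C]
        | 2 => simp [σ, inputState]
        | 3 => simp [σ, inputState]
        | i + 4 => simp [σ, inputState]
      · obtain ⟨b, rfl⟩ : ∃ b', b = b' + 2 := ⟨b - 2, by lia⟩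
        simp [σ, inputState]
  · have h1 : D ^ 1 ≤ D ^ (k + 1) := Nat.pow_le_pow_right (by lia) (by lia)
    have h2 : D ^ k ≤ D ^ (k + 1) := Nat.pow_le_pow_right (by lia) (by lia)
    rw [pow_one] at h1
    rw [add_mul]
    exact Nat.add_le_add (Nat.mul_le_mul_left _ h1) (Nat.mul_le_mul_left _ h2)
  · have h0 : s.reg 0 = Z := (hs.reg 0 (by simp)).trans hreg
    refine ⟨⟨by rw [h0]; exact hdeg, fun i hi => ?_⟩, h0⟩
    rw [h0] at hi
    rw [hs.poly 2 (by simp) (by simp) i (by lia), hrun]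

end FieldRAM

/-! ### The first statement in terms of sup norms -/

section supNormOn

variable {𝕜 : Type} [RCLike 𝕜]

lemma supNormOn_le {S : Set ℝ} {g : ℝ → 𝕜} {c : ℝ} (hS : S.Nonempty) (h : ∀ x ∈ S, ‖g x‖ ≤ c) :
    supNormOn S g ≤ c := by
  refine csSup_le (hS.image _) ?_
  rintro _ ⟨x, hx, rfl⟩
  exact h x hx

lemma norm_le_supNormOn {S : Set ℝ} {g : ℝ → 𝕜} {c x : ℝ} (h : ∀ x ∈ S, ‖g x‖ ≤ c) (hx : x ∈ S) :
    ‖g x‖ ≤ supNormOn S g := by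
  refine le_csSup ⟨c, ?_⟩ ⟨x, hx, rfl⟩
  rintro _ ⟨y, hy, rfl⟩
  exact h y hy

end supNormOn

theorem exists_program_boundedTaylor :
    ∃ (C : ℝ) (c : ℕ) (prog : FieldRAM.Program), 0 < C ∧
      ∀ (𝕜 : Type) [RCLike 𝕜] (f : ℝ → 𝕜) (a : ℕ → 𝕜) (r δ B ε : ℝ),
        0 < r → r ≤ 1 → 0 < δ → δ ≤ r →
        (∀ x ∈ Set.Icc (-r - δ) (r + δ), HasSum (fun k => a k * (x : 𝕜) ^ k) (f x)) →
        Summable (fun k => ‖a k‖ * (r + δ) ^ k) →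
        ∑' k, ‖a k‖ * (r + δ) ^ k ≤ B →
        0 < ε →
        ∃ P : 𝕜[X],
          (P.natDegree : ℝ) ≤ C * (1 / δ * max 1 (Real.log (B / ε))) ∧
          supNormOn (Set.Icc (-r) r) (fun x => f x - P.eval (x : 𝕜)) ≤ ε ∧
          supNormOn (Set.Icc (-1) 1) (fun x => P.eval (x : 𝕜)) ≤
            ε + supNormOn (Set.Icc (-r - δ / 2) (r + δ / 2)) f ∧
          ∃ (n : ℕ) (s : FieldRAM.State 𝕜),
            (n : ℝ) ≤ C * (1 / δ * max 1 (Real.log (B / ε))) ^ c ∧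
            FieldRAM.Exec prog (FieldRAM.inputState a r δ B ε) n s ∧
            s.Outputs P ∧ (s.reg 0 : ℝ) ≤ C * (1 / δ * max 1 (Real.log (B / ε))) := by
  obtain ⟨A, k, hA⟩ := FieldRAM.runs_approximationProgram
  -- One constant serves degree and time. The time is A D^k with D = Z⁵ + 1 and Z ≤ 1985 N, which
  -- gives the exponent 5k.
  refine ⟨1985 + A * (1985 ^ 5 + 1) ^ k, 5 * k, FieldRAM.approximationProgram, by positivity, ?_⟩
  intro 𝕜 _ f a r δ B ε hr hr1 hδ hδr hf hs hB hε
  obtain ⟨n, j, d, e, hS⟩ := exists_sizes (B := B) hr hδ hε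
  obtain ⟨h1, h2, h3, h4⟩ := boundedTaylor_spec hr hr1 hδ hδr hf hs hB hS hε
  have hZ := hS.degreeBound_le hr hr1 hδ hδr hε
  set M := 1 / δ * max 1 (Real.log (B / ε)) with hM
  have hM1 : 1 ≤ M := one_le_mul_of_one_le_of_one_le ((one_le_div hδ).2 (hδr.trans hr1))
    (le_max_left _ _)
  have hZ' : (degreeBound n j d e : ℝ) ≤ (1985 + A * (1985 ^ 5 + 1) ^ k) * M := by
    refine hZ.trans ?_
    gcongr
    exact le_add_of_nonneg_right (by positivity)
  have hbd : ∀ x ∈ Set.Icc (-r - δ / 2) (r + δ / 2), ‖f x‖ ≤ B := fun x hx =>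
    norm_le_of_hasSum hf hs hB (abs_le.2 ⟨by linarith [hx.1], by linarith [hx.2]⟩)
  have h0 : 0 ≤ supNormOn (Set.Icc (-r - δ / 2) (r + δ / 2)) f :=
    (norm_nonneg _).trans (norm_le_supNormOn hbd (x := 0) ⟨by linarith, by linarith⟩)
  obtain ⟨m, s, hm1, hm2, hm3, hm4⟩ := hA 𝕜 a r δ B ε n j d e hS hr hδ h1
  refine ⟨_, le_trans (by exact_mod_cast h1) hZ', ?_, ?_, m, s, ?_, hm1, hm3, by rw [hm4]; exact hZ'⟩
  · refine supNormOn_le ⟨0, by linarith, by linarith⟩ fun x hx => ?_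
    rw [norm_sub_rev]
    exact h2 x (abs_le.2 hx)
  · refine supNormOn_le ⟨0, by norm_num, by norm_num⟩ fun x hx => ?_
    rcases le_total |x| (r + δ / 2) with h | h
    · refine (h3 x (abs_le.2 hx) h).trans ?_
      gcongr
      exact norm_le_supNormOn hbd ⟨by linarith [(abs_le.1 h).1], (abs_le.1 h).2⟩
    · linarith [h4 x (abs_le.2 hx) h]
  · have e1 : (m : ℝ) ≤ A * ((degreeBound n j d e : ℝ) ^ 5 + 1) ^ k := by exact_mod_cast hm2
    refine e1.trans ?_
    have e2 : (degreeBound n j d e : ℝ) ^ 5 + 1 ≤ (1985 ^ 5 + 1) * M ^ 5 := by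
      have e3 : (degreeBound n j d e : ℝ) ^ 5 ≤ (1985 * M) ^ 5 := by gcongr
      have e4 : 1 ≤ M ^ 5 := one_le_pow₀ hM1
      rw [mul_pow] at e3
      linarith
    calc (A : ℝ) * ((degreeBound n j d e : ℝ) ^ 5 + 1) ^ k
        ≤ A * ((1985 ^ 5 + 1) * M ^ 5) ^ k := by gcongr
      _ = A * (1985 ^ 5 + 1) ^ k * M ^ (5 * k) := by rw [mul_pow, ← pow_mul]; ring
      _ ≤ _ := by
        gcongr
        exact le_add_of_nonneg_left (by norm_num)

/-! ### The second statement: sin and cos of a multiple of x² -/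

lemma exists_bounded_approx {f : ℝ → ℝ} {a : ℕ → ℝ} {r B ε : ℝ} (hr : 0 < r) (hr1 : r ≤ 1)
    (hf : ∀ x, HasSum (fun k => a k * x ^ k) (f x)) (hf1 : ∀ x, |f x| ≤ 1)
    (hs : Summable (fun k => |a k| * (2 * r) ^ k)) (hB : ∑' k, |a k| * (2 * r) ^ k ≤ B)
    (hε : 0 < ε) :
    ∃ P : ℝ[X], (P.natDegree : ℝ) ≤ 1985 * (1 / r * max 1 (Real.log (B / ε))) ∧
      (∀ x ∈ Set.Icc (-1 : ℝ) 1, |P.eval x| ≤ 1) ∧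
      ∀ x ∈ Set.Icc (-r) r, |P.eval x - f x| ≤ 2 * ε := by
  obtain ⟨n, j, d, e, hS⟩ := exists_sizes (B := B) hr hr hε
  rw [two_mul] at hs hB
  obtain ⟨h1, h2, h3, h4⟩ := boundedTaylor_spec (𝕜 := ℝ) hr hr1 hr le_rfl (fun x _ => hf x) hs hB
    hS hε
  have hZ := hS.degreeBound_le hr hr1 hr le_rfl hε
  set P := boundedTaylor a r r n j d e with hP
  have hPe : ∀ x, (C (1 + ε)⁻¹ * P).eval x = P.eval x / (1 + ε) := fun x => by
    rw [eval_mul, eval_C, inv_mul_eq_div]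
  -- Since |f| ≤ 1, P is bounded by 1 + ε on [-1, 1]. Dividing by 1 + ε restores the bound 1, and
  -- the error becomes at most 2ε/(1 + ε).
  refine ⟨C (1 + ε)⁻¹ * P, ?_, fun x hx => ?_, fun x hx => ?_⟩
  · refine le_trans ?_ hZ
    exact_mod_cast (natDegree_C_mul_le _ _).trans h1
  · rw [hPe, abs_div, abs_of_pos (by linarith : 0 < 1 + ε), div_le_one (by linarith)]
    have hx1 := abs_le.2 hx
    rcases le_total |x| (r + r / 2) with h | h
    · have := h3 x hx1 h
      simp only [RCLike.ofReal_real_eq_id, id, Real.norm_eq_abs] at this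
      linarith [hf1 x]
    · have := h4 x hx1 h
      simp only [RCLike.ofReal_real_eq_id, id, Real.norm_eq_abs] at this
      linarith
  · have := h2 x (abs_le.2 hx)
    simp only [RCLike.ofReal_real_eq_id, id, Real.norm_eq_abs] at this
    have e1 : (C (1 + ε)⁻¹ * P).eval x - f x = ((P.eval x - f x) - ε * f x) / (1 + ε) := by
      rw [hPe]
      field_simp
      ring
    rw [e1, abs_div, abs_of_pos (by linarith : 0 < 1 + ε), div_le_iff₀ (by linarith)]
    have e2 := abs_sub (P.eval x - f x) (ε * f x)
    rw [abs_mul, abs_of_pos hε] at e2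
    have e3 : ε * |f x| ≤ ε * 1 := by gcongr; exact hf1 x
    nlinarith

/-- The series of sin(cx²) and cos(cx²) contain only exponents 4k + 2 and 4k; padding with zeros
makes them ordinary power series. -/
lemma hasSum_residue {b : ℕ → ℝ} {q : ℕ} (hq : q < 4) {x s : ℝ}
    (h : HasSum (fun k => b k * x ^ (4 * k + q)) s) :
    HasSum (fun m => (if m % 4 = q then b (m / 4) else 0) * x ^ m) s := by
  have hinj : Function.Injective (fun k : ℕ => 4 * k + q) := fun k l h => by
    simp only at h
    lia
  rw [← hinj.hasSum_iff]
  · convert h using 2 with k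
    simp only [Function.comp]
    rw [if_pos (by lia), show (4 * k + q) / 4 = k by lia]
  · intro m hm
    rw [if_neg, zero_mul]
    rintro rfl
    exact hm ⟨m / 4, by simp only; lia⟩

lemma exists_bounded_approx_residue {f : ℝ → ℝ} {b : ℕ → ℝ} {q : ℕ} (hq : q < 4)
    {r B ε : ℝ} (hr : 0 < r) (hr1 : r ≤ 1)
    (hf : ∀ x, HasSum (fun k => b k * x ^ (4 * k + q)) (f x)) (hf1 : ∀ x, |f x| ≤ 1) {s : ℝ}
    (hs : HasSum (fun k => |b k| * (2 * r) ^ (4 * k + q)) s) (hB : s ≤ B) (hε : 0 < ε) :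
    ∃ P : ℝ[X], (P.natDegree : ℝ) ≤ 1985 * (1 / r * max 1 (Real.log (B / ε))) ∧
      (∀ x ∈ Set.Icc (-1 : ℝ) 1, |P.eval x| ≤ 1) ∧
      ∀ x ∈ Set.Icc (-r) r, |P.eval x - f x| ≤ 2 * ε := by
  have hs' : HasSum (fun m => |if m % 4 = q then b (m / 4) else 0| * (2 * r) ^ m) s := by
    convert hasSum_residue hq hs using 3 with m
    split_ifs <;> simp
  exact exists_bounded_approx hr hr1 (fun x => hasSum_residue hq (hf x)) hf1 hs'.summable
    (hs'.tsum_eq.trans_le hB) hε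

/-- The absolute series at 2r sum to sinh and cosh of |c|(2r)², and both are at most the
exponential. -/
lemma exists_bounded_approx_trig {f : ℝ → ℝ} {c r ε : ℝ} (hr : 0 < r) (hr1 : r ≤ 1)
    (hf : f ∈ ({fun x => Real.sin (c * x ^ 2), fun x => Real.cos (c * x ^ 2)} : Set (ℝ → ℝ)))
    (hε : 0 < ε) :
    ∃ P : ℝ[X], (P.natDegree : ℝ) ≤
        1985 * (1 / r * max 1 (Real.log (Real.exp (|c| * (2 * r) ^ 2) / ε))) ∧
      (∀ x ∈ Set.Icc (-1 : ℝ) 1, |P.eval x| ≤ 1) ∧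
      ∀ x ∈ Set.Icc (-r) r, |P.eval x - f x| ≤ 2 * ε := by
  have hneg : Real.exp (-(|c| * (2 * r) ^ 2)) ≤ Real.exp (|c| * (2 * r) ^ 2) := by
    refine Real.exp_le_exp.2 ?_
    have : 0 ≤ |c| * (2 * r) ^ 2 := by positivity
    linarith
  rcases hf with rfl | rfl
  · refine exists_bounded_approx_residue (q := 2)
      (b := fun k => (-1) ^ k * c ^ (2 * k + 1) / (2 * k + 1).factorial) (by simp) hr hr1
      (fun x => ?_) (fun x => Real.abs_sin_le_one _) (s := Real.sinh (|c| * (2 * r) ^ 2)) ?_ ?_ hε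
    · convert Real.hasSum_sin (c * x ^ 2) using 2 with k
      rw [mul_pow]
      ring
    · generalize 2 * r = R
      convert Real.hasSum_sinh (|c| * R ^ 2) using 2 with k
      rw [mul_pow, abs_div, abs_mul, abs_pow, abs_pow, abs_neg, abs_one, one_pow, Nat.abs_cast]
      ring
    · rw [Real.sinh_eq]
      linarith [Real.exp_pos (-(|c| * (2 * r) ^ 2)), Real.exp_pos (|c| * (2 * r) ^ 2)]
  · refine exists_bounded_approx_residue (q := 0)
      (b := fun k => (-1) ^ k * c ^ (2 * k) / (2 * k).factorial) (by simp) hr hr1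
      (fun x => ?_) (fun x => Real.abs_cos_le_one _) (s := Real.cosh (|c| * (2 * r) ^ 2)) ?_ ?_ hε
    · convert Real.hasSum_cos (c * x ^ 2) using 2 with k
      rw [mul_pow]
      ring
    · generalize 2 * r = R
      convert Real.hasSum_cosh (|c| * R ^ 2) using 2 with k
      rw [mul_pow, abs_div, abs_mul, abs_pow, abs_pow, abs_neg, abs_one, one_pow, Nat.abs_cast]
      ring
    · rw [Real.cosh_eq]
      linarith

theorem lemma2p1 :
    (∃ (C : ℝ) (c : ℕ) (prog : FieldRAM.Program), 0 < C ∧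
      ∀ (𝕜 : Type) [RCLike 𝕜] (f : ℝ → 𝕜) (a : ℕ → 𝕜) (r δ B ε : ℝ),
        0 < r → r ≤ 1 → 0 < δ → δ ≤ r →
        (∀ x ∈ Set.Icc (-r - δ) (r + δ), HasSum (fun k => a k * (x : 𝕜) ^ k) (f x)) →
        0 < B →
        Summable (fun k => ‖a k‖ * (r + δ) ^ k) →
        ∑' k, ‖a k‖ * (r + δ) ^ k ≤ B →
        0 < ε → ε < 3 * B / 2 →
        ∃ P : 𝕜[X],
          (P.natDegree : ℝ) ≤ C * (1 / δ * max 1 (Real.log (B / ε))) ∧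
          supNormOn (Set.Icc (-r) r) (fun x => f x - P.eval (x : 𝕜)) ≤ ε ∧
          supNormOn (Set.Icc (-1) 1) (fun x => P.eval (x : 𝕜)) ≤
            ε + supNormOn (Set.Icc (-r - δ / 2) (r + δ / 2)) f ∧
          ∃ (n : ℕ) (s : FieldRAM.State 𝕜),
            (n : ℝ) ≤ C * (1 / δ * max 1 (Real.log (B / ε))) ^ c ∧
            FieldRAM.Exec prog (FieldRAM.inputState a r δ B ε) n s ∧
            s.Outputs P ∧ (s.reg 0 : ℝ) ≤ C * (1 / δ * max 1 (Real.log (B / ε)))) ∧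
    (∃ C : ℝ, 0 < C ∧
      ∀ ε t Γ lam : ℝ, 0 < ε → 0 < Γ → Γ ≤ lam →
        ∀ f ∈ ({fun x => Real.sin (t * lam * x ^ 2), fun x => Real.cos (t * lam * x ^ 2)} :
            Set (ℝ → ℝ)),
          ∃ P : ℝ[X],
            (P.natDegree : ℝ) ≤
              C * (|t| * √(lam * Γ) + √(lam / Γ) * max 0 (Real.log (1 / ε))) ∧
            (∀ x ∈ Set.Icc (-1 : ℝ) 1, |P.eval x| ≤ 1) ∧
            (∀ x ∈ Set.Icc (-√(Γ / lam)) √(Γ / lam), |P.eval x - f x| ≤ 2 * ε)) := by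
  constructor
  · obtain ⟨C, c, prog, hC, h⟩ := exists_program_boundedTaylor
    exact ⟨C, c, prog, hC, fun 𝕜 _ f a r δ B ε hr hr1 hδ hδr hf _ hs hB hε _ =>
      h 𝕜 f a r δ B ε hr hr1 hδ hδr hf hs hB hε⟩
  · refine ⟨1985 * 4, by norm_num, fun ε t Γ lam hε hΓ hlam f hf => ?_⟩
    have hlam0 : 0 < lam := hΓ.trans_le hlam
    -- For ε ≥ 1/2 the tolerance 2ε is at least 1 and the zero polynomial works; its degree fits
    -- even when the claimed bound vanishes.
    by_cases hε2 : 1 / 2 ≤ ε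
    · refine ⟨0, ?_, fun x _ => by simp, fun x _ => ?_⟩
      · simp only [natDegree_zero, Nat.cast_zero]
        positivity
      · rw [eval_zero, zero_sub, abs_neg]
        have : |f x| ≤ 1 := by
          rcases hf with rfl | rfl
          · exact Real.abs_sin_le_one _
          · exact Real.abs_cos_le_one _
        linarith
    · set r := √(Γ / lam) with hr
      have hr0 : 0 < r := Real.sqrt_pos.2 (by positivity)
      have hr1 : r ≤ 1 := Real.sqrt_le_one.2 ((div_le_one hlam0).2 hlam)
      obtain ⟨P, h1, h2, h3⟩ := exists_bounded_approx_trig hr0 hr1 hf hε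
      refine ⟨P, h1.trans ?_, h2, h3⟩
      have hr2 : r ^ 2 = Γ / lam := Real.sq_sqrt (by positivity)
      have e1 : √(lam / Γ) = 1 / r := by
        rw [hr, one_div, ← Real.sqrt_inv, inv_div]
      have e2 : √(lam * Γ) = Γ * (1 / r) := by
        rw [← e1, ← Real.sqrt_sq hΓ.le, ← Real.sqrt_mul (by positivity), Real.sqrt_sq hΓ.le]
        congr 1
        field_simp
      have e3 : |t * lam| * (2 * r) ^ 2 = 4 * (|t| * Γ) := by
        rw [mul_pow, hr2, abs_mul, abs_of_pos hlam0]
        field_simp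
        norm_num
      have e4 : Real.log (1 / 2) > Real.log ε := Real.log_lt_log hε (by linarith)
      rw [one_div, Real.log_inv] at e4
      have e5 := Real.log_two_gt_d9
      have e8 : max 0 (-Real.log ε) = -Real.log ε := max_eq_right (by linarith)
      rw [e1, e2, e3, Real.log_div (Real.exp_ne_zero _) hε.ne', Real.log_exp, one_div ε,
        Real.log_inv, e8]
      have e6 : 0 ≤ |t| * Γ := by positivity
      -- As ε < 1/2, -log ε > log 2 > 1/4, so four times it absorbs the 1 in the maximum.
      have e7 : max 1 (4 * (|t| * Γ) - Real.log ε) ≤ 4 * (|t| * Γ - Real.log ε) :=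
        max_le (by linarith) (by linarith)
      calc 1985 * (1 / r * max 1 (4 * (|t| * Γ) - Real.log ε))
          ≤ 1985 * (1 / r * (4 * (|t| * Γ - Real.log ε))) := by gcongr
        _ = _ := by ring
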